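/- Setting. Let $X$ be a measurable space and $\mathcal H\subset[0,1]^X$ a nonempty class. Let $\ell:[0,1]^2\to[0,\infty)$ be a loss that is convex in its first argument and $L$-Lipschitz in each argument, $L\ge 0$, and put $\bar L=\max\{L,1\}$. The mixed ERM oracle, given $(x_i,y_i)_{i\le m}$ in $X\times[0,1]$, a weight $C\ge 0$, signs $\epsilon_j\in\{\pm1\}$ and $\tilde x_j\in X$ ($j\le n$), returns $$\inf_{h\in\mathcal H}\Big\{\sum_{i=1}^m\ell(h(x_i),y_i)+C\sum_{j=1}^n\epsilon_jh(\tilde x_j)\Big\}.$$ It is assumed that, for fixed $m,n,y,C,\epsilon$, this value is a measurable function of $(x_1,\dots,x_m,\tilde x_1,\dots,\tilde x_n)$. A prediction rule $\Phi$ assigns to $x^t=(x_1,\dots,x_t)$ and $y^{t-1}=(y_1,\dots,y_{t-1})$ a probability distribution $\Phi(x^t,y^{t-1})$ on $[0,1]$. Its hybrid minimax regret at horizon $T$ is $$\tilde r_T(\mathcal H,\Phi)=\sup_\mu\mathbb E_{x_1}\sup_{y_1\in[0,1]}\mathbb E_{\hat y_1}\cdots\mathbb E_{x_T}\sup_{y_T\in[0,1]}\mathbb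 E_{\hat y_T}\Big[\sum_{t=1}^T\ell(\hat y_t,y_t)-\inf_{h\in\mathcal H}\sum_{t=1}^T\ell(h(x_t),y_t)\Big],$$ where $\mu$ ranges over the probability measures on $X$, $x_t\sim\mu$ and $\hat y_t\sim\Phi(x^t,y^{t-1})$ (expectations of possibly non-measurable functions are upper expectations). The Rademacher complexity is $\mathsf{Rad}_T(\mathcal H)=\sup_{x^T\in X^T}\mathbb E_{\epsilon}\sup_{h\in\mathcal H}\sum_{t=1}^T\epsilon_th(x_t)$ with $\epsilon$ uniform on $\{\pm1\}^T$. A rule is computed by a program of a randomized real-number machine which in round $t$ has access to $y^{t-1}$, to the loss $\ell$, and to the features $x^t$ only through the mixed ERM oracle (queried with features among $x_1,\dots,x_t$); arithmetic operations, comparisons, evaluations of $\ell$, drawing a uniform index, adding an entry to an oracle query, and oracle calls take one step each. Call a program $(A,k)$-efficient (for $\mathcal H,\ell$) if, for all data and coin tosses, it makes at most $A\,t^k$ steps in every round $t$, and for every $T\ge2$ at most $A\bar L\sqrt T\log T$ oracle calls in each of the rounds $1,\dots,T$. The programs below do not depend on $T$, $X$, $\mathcal H$, $\ell$ or $\mu$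 (but may depend on $L$ and on the constants fixed before $A$). Theorem. (1) Let $q\in[\tfrac12,1]$ and $c\in\mathbb R$. There are $A,k$ depending only on $q,c$ such that for every $L\ge0$ there is a program which, for all $X,\mathcal H,\ell$ as above with $\mathsf{Rad}_T(\mathcal H)\le cT^q$ for all $T\ge1$, is $(A,k)$-efficient and computes a rule $\Phi$ with $$\tilde r_T(\mathcal H,\Phi)\le A\,L\sqrt{\log(\bar LT)}\;T^{\frac{2-q}{3-2q}}\qquad\text{for all }T\ge2 .$$ (2) There are absolute constants $A,k$ such that for every $L\ge0$ there is a program which, for all $X,\mathcal H,\ell$ as above with $\mathcal H$ $\{0,1\}$-valued and all integers $d\ge1$ with $\mathsf{VC}(\mathcal H)\le d$, is $(A,k)$-efficient and computes a rule $\Phi$ with $$\tilde r_T(\mathcal H,\Phi)\le A\,L\sqrt{d\log(\bar LT)}\;T^{3/4}\qquad\text{for all }T\ge2 .$$ (3) Let $p>0$ and $c\in\mathbb R$. There are $A,k,m$ depending only on $p,c$ such that for every $L\ge0$ there is a program which, for all $X,\mathcal H,\ell$ as above whose $\alpha$-fat shattering dimension is at most $c\,\alpha^{-p}$ for all $\alpha\in(0,1]$,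 is $(A,k)$-efficient and computes a rule $\Phi$ with $$\tilde r_T(\mathcal H,\Phi)\le A\,L\,(\log(\bar LT))^m\;T^{\max\{\frac34,\frac{p+1}{p+2}\}}\qquad\text{for all }T\ge2 .$$ -/

import Mathlib

open MeasureTheory
open scoped unitInterval ENNReal

universe u

namespace HybridLearning

noncomputable section

/-! ### Losses, hypothesis classes and their complexities

Labels and predictions live in `I = [0,1]`; a hypothesis class is a set of functions `X → I`. -/

/-- A nonnegative loss on `[0,1]²`, convex in its first argument and `L`-Lipschitz in each of its
two arguments. Only the values of `ℓ` on `[0,1]²` are constrained (or ever used). -/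
structure IsConvexLipschitzLoss (L : ℝ) (ℓ : ℝ → ℝ → ℝ) : Prop where
  nonneg : ∀ a b : I, 0 ≤ ℓ a b
  convex : ∀ b : I, ConvexOn ℝ (Set.Icc (0 : ℝ) 1) (fun a => ℓ a b)
  lipschitz_left : ∀ a a' b : I, |ℓ a b - ℓ a' b| ≤ L * |(a : ℝ) - a'|
  lipschitz_right : ∀ a b b' : I, |ℓ a b - ℓ a b'| ≤ L * |(b : ℝ) - b'|

/-- Rademacher complexity at horizon `T`:
`sup_{x ∈ X^T} E_ε sup_{h ∈ H} ∑ ε_t h(x_t)`, the signs being uniform on `{±1}^T`.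
All suprema are of quantities in `[-T, T]`. -/
def rademacher {X : Type u} (H : Set (X → I)) (T : ℕ) : ℝ :=
  ⨆ x : Fin T → X,
    (∑ ε : Fin T → ℤˣ, ⨆ h : H, ∑ t, ((ε t : ℤ) : ℝ) * (h.1 (x t) : ℝ)) / 2 ^ T

/-- `H` consists of `{0,1}`-valued functions. -/
def IsBinary {X : Type u} (H : Set (X → I)) : Prop :=
  ∀ h ∈ H, ∀ x, h x = 0 ∨ h x = 1

/-- A finite set is shattered if every `0/1` labelling of it is realized by `H`. -/
def Shatters {X : Type u} (H : Set (X → I)) (S : Finset X) : Prop :=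
  ∀ A ⊆ S, ∃ h ∈ H, ∀ x ∈ S, (x ∈ A → h x = 1) ∧ (x ∉ A → h x = 0)

/-- VC-dimension (possibly infinite). -/
def vcDim {X : Type u} (H : Set (X → I)) : ℕ∞ :=
  ⨆ (S : Finset X) (_ : Shatters H S), (S.card : ℕ∞)

/-- A finite set is `α`-fat shattered if, for some witness `r`, every subset `A` of it is cut out
by `H` with margin `α` around `r`. -/
def FatShatters {X : Type u} (H : Set (X → I)) (α : ℝ) (S : Finset X) : Prop :=
  ∃ r : X → ℝ, ∀ A ⊆ S, ∃ h ∈ H, ∀ x ∈ S,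
    (x ∈ A → r x + α ≤ h x) ∧ (x ∉ A → (h x : ℝ) ≤ r x - α)

/-- `α`-fat shattering dimension (possibly infinite). -/
def fatDim {X : Type u} (H : Set (X → I)) (α : ℝ) : ℕ∞ :=
  ⨆ (S : Finset X) (_ : FatShatters H α S), (S.card : ℕ∞)

/-! ### The mixed ERM oracle -/

/-- The value returned by the mixed ERM oracle on the labelled sample `S`, the weight `C` and the
signed sample `Q`: `inf_{h ∈ H} (∑_{(x,y) ∈ S} ℓ(h(x), y) + C ∑_{(ε,x) ∈ Q} ε h(x))`. -/
def mixedERM {X : Type u} (ℓ : ℝ → ℝ → ℝ) (H : Set (X → I)) (S : List (X × I)) (C : ℝ)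
    (Q : List (ℤˣ × X)) : ℝ :=
  ⨅ h : H, ((S.map fun p => ℓ (h.1 p.1) p.2).sum
    + C * (Q.map fun p => ((p.1 : ℤ) : ℝ) * (h.1 p.2 : ℝ)).sum)

/-- Measurability assumption: for fixed labels, weight and signs, the mixed ERM value is a
measurable function of the features. -/
def MeasurableERM {X : Type u} [MeasurableSpace X] (ℓ : ℝ → ℝ → ℝ) (H : Set (X → I)) : Prop :=
  ∀ (m n : ℕ) (y : Fin m → I) (C : ℝ) (ε : Fin n → ℤˣ), 0 ≤ C →
    Measurable fun p : (Fin m → X) × (Fin n → X) =>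
      mixedERM ℓ H (List.ofFn fun i => (p.1 i, y i)) C (List.ofFn fun j => (ε j, p.2 j))

/-! ### The game and its minimax regret -/

/-- A (randomized) prediction rule: from `(x₁,y₁),…,(x_{t-1},y_{t-1})` and `x_t` it produces a
probability distribution on `[0,1]`. -/
abbrev PredictionRule (X : Type u) := List (X × I) → X → ProbabilityMeasure I

/-- The (upper) expectation of an extended-real function: the infimum of the expectations of its
integrable majorants. It is the usual expectation whenever `f` is real-valued and integrable, and
it makes sense without any measurability of `f`. -/
def upperExp {Ω : Type*} [MeasurableSpace Ω] (μ : Measure Ω) (f : Ω → EReal) : EReal :=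
  ⨅ (g : Ω → ℝ) (_ : Integrable g μ ∧ ∀ ω, f ω ≤ (g ω : EReal)), ((∫ ω, g ω ∂μ : ℝ) : EReal)

/-- The value of the remaining `n` rounds of the game when the features and labels so far are
`hist` and the loss suffered so far is `s`:
`E_x sup_y E_ŷ ⋯ E_x sup_y E_ŷ [total loss - inf_{h ∈ H} (total loss of h)]`. -/
def gameValue {X : Type u} [MeasurableSpace X] (ℓ : ℝ → ℝ → ℝ) (H : Set (X → I))
    (Φ : PredictionRule X) (μ : Measure X) : ℕ → List (X × I) → ℝ → EReal
  | 0, hist, s => ((s - ⨅ h : H, (hist.map fun p => ℓ (h.1 p.1) p.2).sum : ℝ) : EReal)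
  | n + 1, hist, s =>
      upperExp μ fun x => ⨆ y : I, upperExp (Φ hist x : Measure I) fun z =>
        gameValue ℓ H Φ μ n (hist ++ [(x, y)]) (s + ℓ z y)

/-- The hybrid minimax regret of `Φ` against `H` at horizon `T`. -/
def hybridRegret {X : Type u} [MeasurableSpace X] (ℓ : ℝ → ℝ → ℝ) (H : Set (X → I))
    (Φ : PredictionRule X) (T : ℕ) : EReal :=
  ⨆ μ : ProbabilityMeasure X, gameValue ℓ H Φ (μ : Measure X) T [] 0

/-! ### The machine model

A randomized real-number machine with access to the mixed ERM oracle. A program is a finite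
piece of text that uses finitely many registers and arrays, holding naturals or reals. The
features are opaque to the program: it may only name them by their time index and pass them to the
oracle. Elementary operations (arithmetic and comparison, evaluation of the loss, drawing a uniform
index, extending an oracle query by one entry) and oracle calls take one step each. Loops
are bounded, so every program halts. -/

/-- Elementary instructions. `N`, `R` denote the natural and the real registers, `NA`, `RA` the
arrays. -/
inductive Instr : Type
  /-- `N[d] := k` -/
  | natConst (d k : ℕ)
  /-- `N[d] := N[a] + N[b]` -/
  | natAdd (d a b : ℕ)
  /-- `N[d] := N[a] - N[b]` (truncated) -/
  | natSub (d a b : ℕ)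
  /-- `N[d] := NA[k][N[a]]` -/
  | natLoad (d k a : ℕ)
  /-- `NA[k][N[a]] := N[b]` -/
  | natStore (k a b : ℕ)
  /-- `R[d] := c`, for a fixed real constant `c` -/
  | realConst (d : ℕ) (c : ℝ)
  /-- `R[d] := N[a]` -/
  | realOfNat (d a : ℕ)
  /-- `R[d] := R[a] + R[b]` -/
  | realAdd (d a b : ℕ)
  /-- `R[d] := R[a] - R[b]` -/
  | realSub (d a b : ℕ)
  /-- `R[d] := R[a] * R[b]` -/
  | realMul (d a b : ℕ)
  /-- `R[d] := R[a] / R[b]` -/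
  | realDiv (d a b : ℕ)
  /-- `R[d] := RA[k][N[a]]` -/
  | realLoad (d k a : ℕ)
  /-- `RA[k][N[a]] := R[b]` -/
  | realStore (k a b : ℕ)
  /-- `R[d] :=` the past label number `N[a]` (counted from `0`) -/
  | label (d a : ℕ)
  /-- `R[d] := ℓ(R[a], R[b])`, both arguments being clamped to `[0,1]` -/
  | loss (d a b : ℕ)
  /-- `N[d] :=` a uniformly random element of `{0, …, N[a] - 1}` -/
  | random (d a : ℕ)
  /-- append to the oracle query the labelled pair of the feature number `N[a]` (counted from `0`)
  and the label `R[b]`, clamped to `[0,1]` -/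
  | pushLabelled (a b : ℕ)
  /-- append to the oracle query the feature number `N[a]` with the sign `ε` -/
  | pushSigned (ε : ℤˣ) (a : ℕ)
  /-- empty the oracle query -/
  | clearQuery
  /-- `R[d] :=` the answer of the mixed ERM oracle to the current query with weight `|R[a]|` -/
  | oracle (d a : ℕ)

/-- Programs. -/
inductive Prog : Type
  | instr (i : Instr)
  | seq (P Q : Prog)
  /-- if `N[a] < N[b]` then `P` else `Q` -/
  | ifNatLt (a b : ℕ) (P Q : Prog)
  /-- if `R[a] < R[b]` then `P` else `Q` -/
  | ifRealLt (a b : ℕ) (P Q : Prog)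
  /-- repeat `P`, as many times as the value of `N[a]` on entry -/
  | loop (a : ℕ) (P : Prog)

/-- Configurations of the machine, with counters for the steps and for the oracle calls. -/
structure Config (X : Type u) where
  /-- natural registers -/
  nat : ℕ → ℕ
  /-- real registers -/
  real : ℕ → ℝ
  /-- arrays of naturals -/
  natArr : ℕ → ℕ → ℕ
  /-- arrays of reals -/
  realArr : ℕ → ℕ → ℝ
  /-- labelled part of the current oracle query -/
  labelled : List (X × I)
  /-- signed part of the current oracle query -/
  signed : List (ℤˣ × X)
  /-- number of steps so far -/
  steps : ℕ
  /-- number of oracle calls so far -/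
  calls : ℕ

/-- The point of `[0,1]` closest to a real number. -/
def clamp (r : ℝ) : I := Set.projIcc 0 1 zero_le_one r

/-- Feature number `i`, counted from `0`, of `x₁, …, x_t` (indices out of range give `x_t`). -/
def feature {X : Type u} (hist : List (X × I)) (x : X) (i : ℕ) : X :=
  (hist.map Prod.fst).getD i x

/-- Past label number `i`, counted from `0` (indices out of range give `0`). -/
def pastLabel {X : Type u} (hist : List (X × I)) (i : ℕ) : I :=
  (hist.map Prod.snd).getD i 0

namespace Config

variable {X : Type u}

/-- Count one step. -/
def tick (c : Config X) : Config X := { c with steps := c.steps + 1 }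

/-- Write a natural register. -/
def setNat (c : Config X) (d v : ℕ) : Config X := { c with nat := Function.update c.nat d v }

/-- Write a real register. -/
def setReal (c : Config X) (d : ℕ) (v : ℝ) : Config X :=
  { c with real := Function.update c.real d v }

/-- Initial configuration in round `t`: `N[0] = t`, everything else is zero or empty. -/
def init (t : ℕ) : Config X where
  nat := Function.update (fun _ => 0) 0 t
  real := fun _ => 0
  natArr := fun _ _ => 0
  realArr := fun _ _ => 0
  labelled := []
  signed := []
  steps := 0
  calls := 0

end Config

/-- Effect of an elementary instruction, apart from the step count. -/
def Instr.exec {X : Type u} (ℓ : ℝ → ℝ → ℝ) (H : Set (X → I)) (hist : List (X × I)) (x : X)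
    (c : Config X) : Instr → PMF (Config X)
  | .natConst d k => PMF.pure (c.setNat d k)
  | .natAdd d a b => PMF.pure (c.setNat d (c.nat a + c.nat b))
  | .natSub d a b => PMF.pure (c.setNat d (c.nat a - c.nat b))
  | .natLoad d k a => PMF.pure (c.setNat d (c.natArr k (c.nat a)))
  | .natStore k a b => PMF.pure
      { c with natArr :=
          Function.update c.natArr k (Function.update (c.natArr k) (c.nat a) (c.nat b)) }
  | .realConst d r => PMF.pure (c.setReal d r)
  | .realOfNat d a => PMF.pure (c.setReal d (c.nat a))
  | .realAdd d a b => PMF.pure (c.setReal d (c.real a + c.real b))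
  | .realSub d a b => PMF.pure (c.setReal d (c.real a - c.real b))
  | .realMul d a b => PMF.pure (c.setReal d (c.real a * c.real b))
  | .realDiv d a b => PMF.pure (c.setReal d (c.real a / c.real b))
  | .realLoad d k a => PMF.pure (c.setReal d (c.realArr k (c.nat a)))
  | .realStore k a b => PMF.pure
      { c with realArr :=
          Function.update c.realArr k (Function.update (c.realArr k) (c.nat a) (c.real b)) }
  | .label d a => PMF.pure (c.setReal d (pastLabel hist (c.nat a)))
  | .loss d a b => PMF.pure (c.setReal d (ℓ (clamp (c.real a)) (clamp (c.real b))))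
  | .random d a =>
      -- for `N[a] = 0` the result is `0`
      PMF.map (fun i : Fin (c.nat a - 1 + 1) => c.setNat d i.val) (PMF.uniformOfFintype _)
  | .pushLabelled a b => PMF.pure
      { c with labelled := c.labelled ++ [(feature hist x (c.nat a), clamp (c.real b))] }
  | .pushSigned ε a => PMF.pure
      { c with signed := c.signed ++ [(ε, feature hist x (c.nat a))] }
  | .clearQuery => PMF.pure { c with labelled := [], signed := [] }
  | .oracle d a => PMF.pure
      { c.setReal d (mixedERM ℓ H c.labelled |c.real a| c.signed) with calls := c.calls + 1 }

/-- Iterate a random transition `n` times. -/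
def iterate {Ω : Type*} (f : Ω → PMF Ω) : ℕ → Ω → PMF Ω
  | 0, c => PMF.pure c
  | n + 1, c => (f c).bind (iterate f n)

/-- The law of the final configuration when a program is started in a given configuration, in the
round in which `hist` is the past and `x` is the current feature. Each instruction, each test, the
entry of each loop and each repetition of its body count as one step (in addition to the steps of
the body). -/
def Prog.exec {X : Type u} (ℓ : ℝ → ℝ → ℝ) (H : Set (X → I)) (hist : List (X × I)) (x : X) :
    Prog → Config X → PMF (Config X)
  | .instr i, c => i.exec ℓ H hist x c.tick
  | .seq P Q, c => (P.exec ℓ H hist x c).bind (Q.exec ℓ H hist x)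
  | .ifNatLt a b P Q, c =>
      if c.nat a < c.nat b then P.exec ℓ H hist x c.tick else Q.exec ℓ H hist x c.tick
  | .ifRealLt a b P Q, c =>
      open Classical in
      if c.real a < c.real b then P.exec ℓ H hist x c.tick else Q.exec ℓ H hist x c.tick
  | .loop a P, c => iterate (fun c => P.exec ℓ H hist x c.tick) (c.nat a) c.tick

/-- The law of the final configuration of the program in the round with past `hist` and current
feature `x`. -/
def Prog.run {X : Type u} (P : Prog) (ℓ : ℝ → ℝ → ℝ) (H : Set (X → I)) (hist : List (X × I))
    (x : X) : PMF (Config X) :=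
  P.exec ℓ H hist x (Config.init (hist.length + 1))

/-- The prediction rule computed by a program: the law of `R[0]`, clamped to `[0,1]`, at the end
of the run. -/
def Prog.rule {X : Type u} (P : Prog) (ℓ : ℝ → ℝ → ℝ) (H : Set (X → I)) : PredictionRule X :=
  fun hist x => ⟨((P.run ℓ H hist x).map fun c => clamp (c.real 0)).toMeasure, inferInstance⟩

/-- In every round `t`, whatever the data and the coin tosses, the program halts after at most
`A t ^ k` steps, oracle calls counting as one step. -/
def Prog.RunsInTime {X : Type u} (P : Prog) (ℓ : ℝ → ℝ → ℝ) (H : Set (X → I)) (A : ℝ) (k : ℕ) :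
    Prop :=
  ∀ (hist : List (X × I)) (x : X), ∀ c ∈ (P.run ℓ H hist x).support,
    (c.steps : ℝ) ≤ A * ((hist.length + 1 : ℕ) : ℝ) ^ k

/-- In each of the rounds `1, …, T`, whatever the data and the coin tosses, the program makes at
most `B` oracle calls. -/
def Prog.CallsAtMost {X : Type u} (P : Prog) (ℓ : ℝ → ℝ → ℝ) (H : Set (X → I)) (T : ℕ) (B : ℝ) :
    Prop :=
  ∀ (hist : List (X × I)) (x : X), hist.length + 1 ≤ T →
    ∀ c ∈ (P.run ℓ H hist x).support, (c.calls : ℝ) ≤ B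

end

end HybridLearning

open HybridLearning

/-! Cut time into blocks of length M and compete on each block with its own best hypothesis. A
minimum of a sum is at least the sum of the minima, so this only makes the task harder. Inside a
block the rule is a randomized relaxation: the features still to come are replaced by features drawn
with replacement from a pool of N features seen before the block, each carrying a random sign. For a
fixed draw, the forecast is the normalized difference of the oracle values with the present feature
signed + and −. Whatever the label, the relaxation "minus ERM value" then pays for the loss
(`predict_admissible`).

The relaxation expects the present feature to come from the pool, whereas it comes from μ. This gap
is `deviation`. The labels of the block may depend on the pool, so the gap is controlled uniformly
over all label sequences, rounded to a grid of mesh 1/N. For fixed labels and a fixed draw, the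
relaxation does not see the pool features that were not drawn. Their centred sum is sub-Gaussian,
and the few drawn ones are bounded trivially. An exponential-moment argument
(`integral_deviation_le`) yields O(L √(M log T / N)) per round.

At the start of a block the relaxation costs at most L times the Rademacher complexity at M
(`relax_nil_le`). If that complexity is at most W M^q, a round costs L times W M^(q−1) + √(M log T /
N), up to constants. This is balanced by M = N^(1/(3−2q)). Doubling N as time doubles removes the
horizon from the program, and powers of two keep the blocks aligned with the doublings
(`schedSpec`). In the game, `gameValue_le_of_step` telescopes a potential whose increments are
dominated by measurable functions of an i.i.d. sequence of features, so upper expectations cause no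
harm. The sum over the rounds is `IsConvexLipschitzLoss.hybridRegret_le`. Each round takes two
oracle calls and linearly many steps (`run_program`).

The program uses only q and L, so W may depend on T and on the class. For VC classes, Sauer–Shelah
and Massart's lemma give q = 1/2 and W of order √(d log T). For fat-shattering classes, separated
discretized families are bounded by counting strongly shattered graphs (`card_separated_lt`). The
resulting uniform covers are chained dyadically to q = 1 − 1/max(p, 2) with W of order log² T. -/

namespace HybridLearning

open Finset
open scoped BigOperators

/-! ### Elementary properties of the mixed ERM oracle -/

section Oracle

variable {X : Type u} {ℓ : ℝ → ℝ → ℝ} {H : Set (X → I)} {L : ℝ}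

/-- Cumulative loss of `h` on a labelled sample. -/
noncomputable def lossSum (ℓ : ℝ → ℝ → ℝ) (h : X → I) (S : List (X × I)) : ℝ :=
  (S.map fun p => ℓ (h p.1) p.2).sum

/-- Correlation of `h` with a signed sample. -/
noncomputable def signSum (h : X → I) (Q : List (ℤˣ × X)) : ℝ :=
  (Q.map fun p => ((p.1 : ℤ) : ℝ) * (h p.2 : ℝ)).sum

lemma lossSum_nil (h : X → I) : lossSum ℓ h [] = 0 := rfl

lemma lossSum_append (h : X → I) (S S' : List (X × I)) :
    lossSum ℓ h (S ++ S') = lossSum ℓ h S + lossSum ℓ h S' := by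
  simp [lossSum]

lemma lossSum_singleton (h : X → I) (x : X) (y : I) : lossSum ℓ h [(x, y)] = ℓ (h x) y := by
  simp [lossSum]

lemma signSum_nil (h : X → I) : signSum h [] = 0 := rfl

lemma signSum_cons (h : X → I) (e : ℤˣ) (x : X) (Q : List (ℤˣ × X)) :
    signSum h ((e, x) :: Q) = ((e : ℤ) : ℝ) * h x + signSum h Q := by
  simp [signSum]

lemma signSum_append (h : X → I) (Q Q' : List (ℤˣ × X)) :
    signSum h (Q ++ Q') = signSum h Q + signSum h Q' := by
  simp [signSum]

lemma abs_sign (e : ℤˣ) : |((e : ℤ) : ℝ)| = 1 := by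
  rcases Int.units_eq_one_or e with rfl | rfl <;> simp

lemma abs_signSum_le (h : X → I) (Q : List (ℤˣ × X)) : |signSum h Q| ≤ Q.length := by
  induction Q with
  | nil => simp [signSum]
  | cons p Q ih =>
    obtain ⟨e, x⟩ := p
    rw [signSum_cons]
    have h1 : |((e : ℤ) : ℝ) * h x| ≤ 1 := by
      rw [abs_mul, abs_sign, one_mul, abs_of_nonneg (h x).2.1]; exact (h x).2.2
    calc _ ≤ _ := abs_add_le _ _
      _ ≤ 1 + (Q.length : ℝ) := add_le_add h1 ih
      _ = _ := by push_cast [List.length_cons]; ring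

lemma IsConvexLipschitzLoss.lossSum_nonneg (hl : IsConvexLipschitzLoss L ℓ) (h : X → I)
    (S : List (X × I)) : 0 ≤ lossSum ℓ h S :=
  List.sum_nonneg (by simp only [List.mem_map]; rintro _ ⟨p, _, rfl⟩; exact hl.nonneg _ _)

lemma IsConvexLipschitzLoss.loss_le (hl : IsConvexLipschitzLoss L ℓ) (hL : 0 ≤ L) (a b : I) :
    ℓ a b ≤ ℓ 0 0 + 2 * L := by
  have h1 := hl.lipschitz_left a 0 b
  have h2 := hl.lipschitz_right 0 b 0
  simp only [Set.Icc.coe_zero, sub_zero] at h1 h2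
  rw [abs_of_nonneg a.2.1] at h1
  rw [abs_of_nonneg b.2.1] at h2
  have := abs_le.1 h1; have := abs_le.1 h2
  nlinarith [a.2.2, b.2.2]

lemma IsConvexLipschitzLoss.lossSum_le (hl : IsConvexLipschitzLoss L ℓ) (hL : 0 ≤ L) (h : X → I)
    (S : List (X × I)) : lossSum ℓ h S ≤ (ℓ 0 0 + 2 * L) * S.length := by
  induction S with
  | nil => simp [lossSum]
  | cons p S ih =>
    have : lossSum ℓ h (p :: S) = ℓ (h p.1) p.2 + lossSum ℓ h S := by simp [lossSum]
    rw [this, List.length_cons]; push_cast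
    have := hl.loss_le hL (h p.1) p.2
    linarith

lemma mixedERM_eq (S : List (X × I)) (C : ℝ) (Q : List (ℤˣ × X)) :
    mixedERM ℓ H S C Q = ⨅ h : H, (lossSum ℓ h.1 S + C * signSum h.1 Q) := rfl

lemma IsConvexLipschitzLoss.value_ge (hl : IsConvexLipschitzLoss L ℓ) {C : ℝ} (hC : 0 ≤ C)
    (h : X → I) (S : List (X × I)) (Q : List (ℤˣ × X)) :
    -(C * Q.length) ≤ lossSum ℓ h S + C * signSum h Q := by
  have := (abs_le.1 (abs_signSum_le h Q)).1
  have := hl.lossSum_nonneg h S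
  nlinarith

lemma IsConvexLipschitzLoss.mixedERM_le (hl : IsConvexLipschitzLoss L ℓ) {C : ℝ} (hC : 0 ≤ C)
    {h : X → I} (hh : h ∈ H) (S : List (X × I)) (Q : List (ℤˣ × X)) :
    mixedERM ℓ H S C Q ≤ lossSum ℓ h S + C * signSum h Q :=
  ciInf_le (f := fun h : H => lossSum ℓ h.1 S + C * signSum h.1 Q)
    ⟨-(C * Q.length), by rintro _ ⟨h, rfl⟩; exact hl.value_ge hC h.1 S Q⟩ ⟨h, hh⟩

lemma le_mixedERM (hH : H.Nonempty) {C a : ℝ} {S : List (X × I)} {Q : List (ℤˣ × X)}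
    (h : ∀ h ∈ H, a ≤ lossSum ℓ h S + C * signSum h Q) : a ≤ mixedERM ℓ H S C Q := by
  have := hH.to_subtype
  exact le_ciInf fun g : H => h g.1 g.2

lemma IsConvexLipschitzLoss.mixedERM_le_add (hl : IsConvexLipschitzLoss L ℓ) (hH : H.Nonempty)
    {C δ : ℝ} (hC : 0 ≤ C) {S S' : List (X × I)} {Q Q' : List (ℤˣ × X)}
    (h : ∀ h ∈ H, lossSum ℓ h S + C * signSum h Q ≤ lossSum ℓ h S' + C * signSum h Q' + δ) :
    mixedERM ℓ H S C Q ≤ mixedERM ℓ H S' C Q' + δ := by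
  rw [← sub_le_iff_le_add]
  refine le_mixedERM hH fun g hg => ?_
  have := hl.mixedERM_le hC hg S Q
  linarith [h g hg]

lemma IsConvexLipschitzLoss.abs_mixedERM_le (hl : IsConvexLipschitzLoss L ℓ) (hL : 0 ≤ L)
    (hH : H.Nonempty) (S : List (X × I)) (Q : List (ℤˣ × X)) :
    |mixedERM ℓ H S L Q| ≤ (ℓ 0 0 + 2 * L) * S.length + L * Q.length := by
  have h0 : 0 ≤ ℓ 0 0 := hl.nonneg 0 0
  have h1 : 0 ≤ (ℓ 0 0 + 2 * L) * S.length := by positivity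
  have h2 : 0 ≤ L * Q.length := by positivity
  rw [abs_le]; constructor
  · exact le_mixedERM hH fun h _ => by linarith [hl.value_ge hL h S Q]
  · obtain ⟨h, hh⟩ := hH
    have a1 := hl.mixedERM_le hL hh S Q
    have a2 := hl.lossSum_le hL h S
    have a3 := (abs_le.1 (abs_signSum_le h Q)).2
    nlinarith

/-! ### The prediction from two oracle calls -/

/-- Half the normalized difference of the oracle values with positive and negative sign at the
current feature. -/
noncomputable def predict (ℓ : ℝ → ℝ → ℝ) (H : Set (X → I)) (L : ℝ) (S : List (X × I))
    (Q : List (ℤˣ × X)) (x : X) : ℝ :=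
  (mixedERM ℓ H S L (Q ++ [(-1, x), (1, x), (1, x)]) - mixedERM ℓ H S L (Q ++ [(-1, x)]))
    / (2 * L)

/-- Queries can only be extended. Appending +x twice after −x makes the net sign +, so both oracle
values share one hallucinated sample. -/
lemma predict_eq (S : List (X × I)) (Q : List (ℤˣ × X)) (x : X) :
    predict ℓ H L S Q x
      = (mixedERM ℓ H S L ((1, x) :: Q) - mixedERM ℓ H S L ((-1, x) :: Q)) / (2 * L) := by
  have h1 : mixedERM ℓ H S L (Q ++ [(-1, x), (1, x), (1, x)])
      = mixedERM ℓ H S L ((1, x) :: Q) := by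
    simp only [mixedERM_eq, signSum_append, signSum_cons, signSum_nil]
    congr 1; ext h; push_cast; ring
  have h2 : mixedERM ℓ H S L (Q ++ [(-1, x)]) = mixedERM ℓ H S L ((-1, x) :: Q) := by
    simp only [mixedERM_eq, signSum_append, signSum_cons, signSum_nil]
    congr 1; ext h; push_cast; ring
  rw [predict, h1, h2]

/-- Turning the sign at x from − to + raises every objective by 2 L h(x), which lies in [0, 2L], so
the infima differ by an amount in the same range. The identity is written without division so as to
hold for L = 0 too. -/
lemma IsConvexLipschitzLoss.predict_mem (hl : IsConvexLipschitzLoss L ℓ) (hL : 0 ≤ L)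
    (hH : H.Nonempty) (S : List (X × I)) (Q : List (ℤˣ × X)) (x : X) :
    predict ℓ H L S Q x ∈ Set.Icc (0 : ℝ) 1 ∧
    mixedERM ℓ H S L ((1, x) :: Q) - mixedERM ℓ H S L ((-1, x) :: Q)
      = 2 * (L * predict ℓ H L S Q x) := by
  rw [predict_eq]
  have h1 : mixedERM ℓ H S L ((-1, x) :: Q) ≤ mixedERM ℓ H S L ((1, x) :: Q) + 0 := by
    refine hl.mixedERM_le_add hH hL fun h _ => ?_
    simp only [signSum_cons]; push_cast
    nlinarith [mul_nonneg hL (h x).2.1]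
  have h2 : mixedERM ℓ H S L ((1, x) :: Q) ≤ mixedERM ℓ H S L ((-1, x) :: Q) + 2 * L := by
    refine hl.mixedERM_le_add hH hL fun h _ => ?_
    simp only [signSum_cons]; push_cast
    nlinarith [mul_le_mul_of_nonneg_left (h x).2.2 hL]
  rcases hL.eq_or_lt with rfl | hL
  · simp only [mul_zero, div_zero, Set.mem_Icc, le_refl, zero_le_one, and_self, true_and]
    linarith
  · refine ⟨⟨by apply div_nonneg <;> linarith, ?_⟩, by field_simp⟩
    rw [div_le_one (by linarith)]; linarith

lemma coe_clamp_of_mem {r : ℝ} (h : r ∈ Set.Icc (0 : ℝ) 1) : (clamp r : ℝ) = r := by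
  simp [clamp, Set.projIcc_of_mem zero_le_one h]

lemma clamp_coe (y : I) : clamp (y : ℝ) = y := by simp [clamp]

/-- Whatever the label, the loss of the prediction is paid for by the relaxation. -/
lemma IsConvexLipschitzLoss.predict_admissible (hl : IsConvexLipschitzLoss L ℓ) (hL : 0 ≤ L)
    (hH : H.Nonempty) (S : List (X × I)) (Q : List (ℤˣ × X)) (x : X) (y : I) :
    ℓ (clamp (predict ℓ H L S Q x)) y - mixedERM ℓ H (S ++ [(x, y)]) L Q
      ≤ (-mixedERM ℓ H S L ((1, x) :: Q) - mixedERM ℓ H S L ((-1, x) :: Q)) / 2 := by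
  obtain ⟨hm, he⟩ := hl.predict_mem hL hH S Q x
  set p := predict ℓ H L S Q x
  set E₁ := mixedERM ℓ H S L ((1, x) :: Q)
  set E₂ := mixedERM ℓ H S L ((-1, x) :: Q)
  suffices h : ℓ (clamp p) y + (E₁ + E₂) / 2 ≤ mixedERM ℓ H (S ++ [(x, y)]) L Q by linarith
  refine le_mixedERM hH fun h hh => ?_
  rw [lossSum_append, lossSum_singleton]
  have h1 : E₁ ≤ _ := hl.mixedERM_le hL hh S ((1, x) :: Q)
  have h2 : E₂ ≤ _ := hl.mixedERM_le hL hh S ((-1, x) :: Q)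
  have h3 := (abs_le.1 (hl.lipschitz_left (clamp p) (h x) y)).2
  rw [signSum_cons] at h1 h2
  push_cast at h1 h2
  rw [coe_clamp_of_mem hm] at h3
  rw [coe_clamp_of_mem hm]
  -- Since E₁ − E₂ = 2Lp, the mean (E₁ + E₂)/2 equals both E₁ − Lp and E₂ + Lp. The first form
  -- absorbs L|p − h(x)| when p ≥ h(x), the second when p ≤ h(x).
  rcases abs_cases (p - (h x : ℝ)) with ⟨h4, -⟩ | ⟨h4, -⟩ <;> rw [h4] at h3 <;> nlinarith

end Oracle

/-! ### Relaxations with hallucinated features -/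

section Relaxation

variable {X : Type u} {ℓ : ℝ → ℝ → ℝ} {H : Set (X → I)} {L : ℝ} {n : ℕ}

/-- The signed sample drawn from the pool of features with the signs and indices `w`. -/
def hallucination (pool : Fin n → X) {m : ℕ} (w : Fin m → ℤˣ × Fin n) : List (ℤˣ × X) :=
  List.ofFn fun j => ((w j).1, pool (w j).2)

/-- The relaxation with `m` hallucinated features. -/
noncomputable def relax (ℓ : ℝ → ℝ → ℝ) (H : Set (X → I)) (L : ℝ) (S : List (X × I))
    (pool : Fin n → X) (m : ℕ) : ℝ :=
  𝔼 w : Fin m → ℤˣ × Fin n, -mixedERM ℓ H S L (hallucination pool w)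

/-- The relaxation with `m` hallucinated features and one prescribed feature, whose sign is
random. -/
noncomputable def relaxAt (ℓ : ℝ → ℝ → ℝ) (H : Set (X → I)) (L : ℝ) (S : List (X × I))
    (pool : Fin n → X) (m : ℕ) (x : X) : ℝ :=
  𝔼 w : Fin m → ℤˣ × Fin n,
    (-mixedERM ℓ H S L ((1, x) :: hallucination pool w)
      - mixedERM ℓ H S L ((-1, x) :: hallucination pool w)) / 2

lemma expect_units (f : ℤˣ → ℝ) : 𝔼 e : ℤˣ, f e = (f 1 + f (-1)) / 2 := by
  rw [Fintype.expect_eq_sum_div_card]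
  have : (Finset.univ : Finset ℤˣ) = {1, -1} := by decide
  rw [this]; simp [Fintype.card_units_int]

/-- Singles out one hallucinated feature, uniform on the pool with a random sign. The true present
feature will be compared with it. -/
lemma relax_succ (S : List (X × I)) (pool : Fin n → X) (m : ℕ) :
    relax ℓ H L S pool (m + 1) = 𝔼 i : Fin n, relaxAt ℓ H L S pool m (pool i) := by
  unfold relax relaxAt
  rw [← Fintype.expect_equiv (Fin.consEquiv fun _ : Fin (m + 1) => ℤˣ × Fin n)
    (fun p => -mixedERM ℓ H S L ((p.1.1, pool p.1.2) :: hallucination pool p.2)) _ ?_]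
  · rw [← univ_product_univ, expect_product, ← univ_product_univ, expect_product]
    rw [expect_comm]
    refine expect_congr rfl fun i _ => ?_
    rw [expect_comm]
    refine expect_congr rfl fun w _ => ?_
    rw [expect_units]; ring
  · rintro ⟨a, w⟩
    simp [hallucination, Fin.consEquiv, List.ofFn_succ]

lemma IsConvexLipschitzLoss.expect_predict_add_relax_le [NeZero n]
    (hl : IsConvexLipschitzLoss L ℓ)
    (hL : 0 ≤ L) (hH : H.Nonempty) (S : List (X × I)) (pool : Fin n → X) (m : ℕ) (x : X) (y : I) :
    (𝔼 w : Fin m → ℤˣ × Fin n, ℓ (clamp (predict ℓ H L S (hallucination pool w) x)) y)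
      + relax ℓ H L (S ++ [(x, y)]) pool m ≤ relaxAt ℓ H L S pool m x := by
  unfold relax relaxAt
  rw [← expect_add_distrib]
  refine expect_le_expect fun w _ => ?_
  exact hl.predict_admissible hL hH S (hallucination pool w) x y

/-- Flipping all signs preserves the law of the draw and negates the sum. -/
lemma expect_signSum [NeZero n] (pool : Fin n → X) (m : ℕ) (h : X → I) :
    𝔼 w : Fin m → ℤˣ × Fin n, signSum h (hallucination pool w) = 0 := by
  have h1 : 𝔼 w : Fin m → ℤˣ × Fin n, signSum h (hallucination pool w)
      = 𝔼 w : Fin m → ℤˣ × Fin n, -signSum h (hallucination pool w) := by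
    refine Fintype.expect_equiv
      (Equiv.arrowCongr (Equiv.refl _) ((Equiv.neg ℤˣ).prodCongr (Equiv.refl _))) _ _ fun w => ?_
    simp [signSum, hallucination, List.sum_ofFn, Equiv.arrowCongr]
  rw [expect_neg_distrib] at h1
  linarith

/-- The signed terms have mean zero, so by Jensen the average of the perturbed infima is at most the
unperturbed infimum. This lets a block be closed, or the game be stopped, at any moment. -/
lemma IsConvexLipschitzLoss.neg_mixedERM_le_relax [NeZero n] (hl : IsConvexLipschitzLoss L ℓ)
    (hL : 0 ≤ L) (hH : H.Nonempty) (S : List (X × I)) (pool : Fin n → X) (m : ℕ) :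
    -mixedERM ℓ H S L [] ≤ relax ℓ H L S pool m := by
  rw [neg_le]
  refine le_mixedERM hH fun h hh => ?_
  rw [relax, expect_neg_distrib, neg_neg, signSum_nil, mul_zero, add_zero]
  calc _ ≤ 𝔼 w : Fin m → ℤˣ × Fin n, (lossSum ℓ h S + L * signSum h (hallucination pool w)) :=
        expect_le_expect fun w _ => hl.mixedERM_le hL hh _ _
    _ = _ := by
        rw [expect_add_distrib, Fintype.expect_const, ← mul_expect, expect_signSum]; ring

lemma abs_sum_signs_le {T : ℕ} (ε : Fin T → ℤˣ) (x : Fin T → X) (h : X → I) :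
    |∑ t, ((ε t : ℤ) : ℝ) * (h (x t) : ℝ)| ≤ T := by
  calc _ ≤ ∑ t, |((ε t : ℤ) : ℝ) * (h (x t) : ℝ)| := abs_sum_le_sum_abs _ _
    _ ≤ ∑ t : Fin T, (1 : ℝ) := by
        refine sum_le_sum fun t _ => ?_
        rw [abs_mul, abs_sign, one_mul, abs_of_nonneg (h (x t)).2.1]; exact (h (x t)).2.2
    _ = T := by simp

lemma bddAbove_signs {T : ℕ} (ε : Fin T → ℤˣ) (x : Fin T → X) :
    BddAbove (Set.range fun h : H => ∑ t, ((ε t : ℤ) : ℝ) * (h.1 (x t) : ℝ)) :=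
  ⟨T, by rintro _ ⟨h, rfl⟩; exact (abs_le.1 (abs_sum_signs_le ε x h.1)).2⟩

/-- The inner expectation in the Rademacher complexity. -/
noncomputable def rademacherAt (H : Set (X → I)) {T : ℕ} (x : Fin T → X) : ℝ :=
  𝔼 ε : Fin T → ℤˣ, ⨆ h : H, ∑ t, ((ε t : ℤ) : ℝ) * (h.1 (x t) : ℝ)

lemma rademacher_eq (T : ℕ) : rademacher H T = ⨆ x : Fin T → X, rademacherAt H x := by
  unfold rademacher rademacherAt
  congr 1; ext x
  rw [Fintype.expect_eq_sum_div_card]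
  simp [Fintype.card_units_int]

lemma rademacherAt_le_card (hH : H.Nonempty) {T : ℕ} (x : Fin T → X) : rademacherAt H x ≤ T := by
  have := hH.to_subtype
  exact expect_le univ_nonempty fun ε _ =>
    ciSup_le fun h => (abs_le.1 (abs_sum_signs_le ε x h.1)).2

lemma rademacherAt_le (hH : H.Nonempty) {T : ℕ} (x : Fin T → X) :
    rademacherAt H x ≤ rademacher H T := by
  rw [rademacher_eq]
  exact le_ciSup (f := fun x : Fin T → X => rademacherAt H x)
    ⟨T, by rintro _ ⟨x, rfl⟩; exact rademacherAt_le_card hH x⟩ x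

lemma rademacherAt_nonneg (hH : H.Nonempty) {T : ℕ} (x : Fin T → X) : 0 ≤ rademacherAt H x := by
  obtain ⟨h, hh⟩ := hH
  have h1 : 𝔼 ε : Fin T → ℤˣ, ∑ t, ((ε t : ℤ) : ℝ) * (h (x t) : ℝ)
      = 𝔼 ε : Fin T → ℤˣ, -∑ t, ((ε t : ℤ) : ℝ) * (h (x t) : ℝ) :=
    Fintype.expect_equiv (Equiv.neg _) _ _ fun ε => by simp
  rw [expect_neg_distrib] at h1
  calc (0 : ℝ) = 𝔼 ε : Fin T → ℤˣ, ∑ t, ((ε t : ℤ) : ℝ) * (h (x t) : ℝ) := by linarith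
    _ ≤ _ := expect_le_expect fun ε _ => le_ciSup (bddAbove_signs ε x) ⟨h, hh⟩

lemma rademacher_nonneg (hH : H.Nonempty) (T : ℕ) : 0 ≤ rademacher H T := by
  rw [rademacher_eq]
  exact Real.iSup_nonneg fun x => rademacherAt_nonneg hH x

/-- Given the drawn indices, only the signs remain random, and what is left is L times a Rademacher
average at the drawn features. Repeated draws are harmless because the complexity is a supremum over
all tuples. -/
lemma relax_nil_le [NeZero n]
    (hL : 0 ≤ L) (hH : H.Nonempty) (pool : Fin n → X) (m : ℕ) :
    relax ℓ H L [] pool m ≤ L * rademacher H m := by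
  have hn := hH.to_subtype
  unfold relax
  have he := Fintype.expect_equiv
    (Equiv.arrowProdEquivProdArrow (Fin m) (fun _ => ℤˣ) (fun _ => Fin n))
    (fun w => -mixedERM ℓ H [] L (hallucination pool w))
    (fun p => -mixedERM ℓ H [] L (hallucination pool fun j => (p.1 j, p.2 j))) (fun w => rfl)
  rw [he, ← univ_product_univ, expect_product, expect_comm]
  refine expect_le univ_nonempty fun i _ => ?_
  calc _ ≤ 𝔼 ε : Fin m → ℤˣ, L * ⨆ h : H, ∑ t, (((-ε) t : ℤ) : ℝ) * (h.1 (pool (i t)) : ℝ) := by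
        refine expect_le_expect fun ε _ => ?_
        rw [neg_le]
        refine le_mixedERM hH fun h hh => ?_
        rw [lossSum_nil, zero_add, ← mul_neg]
        refine mul_le_mul_of_nonneg_left ?_ hL
        rw [neg_le]
        refine le_trans (le_of_eq ?_) (le_ciSup (bddAbove_signs (-ε) fun t => pool (i t)) ⟨h, hh⟩)
        simp [signSum, hallucination, List.sum_ofFn]
    _ = L * rademacherAt H fun t => pool (i t) := by
        rw [← mul_expect, rademacherAt]
        congr 1
        exact Fintype.expect_equiv (Equiv.neg _) _ _ fun ε => rfl
    _ ≤ _ := mul_le_mul_of_nonneg_left (rademacherAt_le hH _) hL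

lemma IsConvexLipschitzLoss.relaxAt_sub_le [NeZero n] (hl : IsConvexLipschitzLoss L ℓ)
    (hL : 0 ≤ L) (hH : H.Nonempty) {S S' : List (X × I)} {δ : ℝ}
    (hS : ∀ h ∈ H, |lossSum ℓ h S - lossSum ℓ h S'| ≤ δ) (pool : Fin n → X) (m : ℕ)
    (x : X) : relaxAt ℓ H L S pool m x ≤ relaxAt ℓ H L S' pool m x + δ := by
  unfold relaxAt
  rw [← Fintype.expect_const (ι := Fin m → ℤˣ × Fin n) δ, ← expect_add_distrib]
  refine expect_le_expect fun w _ => ?_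
  have h1 := hl.mixedERM_le_add hH hL (S := S') (S' := S) (δ := δ)
    (Q := (1, x) :: hallucination pool w) (Q' := (1, x) :: hallucination pool w)
    fun h hh => by linarith [(abs_le.1 (hS h hh)).1]
  have h2 := hl.mixedERM_le_add hH hL (S := S') (S' := S) (δ := δ)
    (Q := (-1, x) :: hallucination pool w) (Q' := (-1, x) :: hallucination pool w)
    fun h hh => by linarith [(abs_le.1 (hS h hh)).1]
  linarith

end Relaxation

/-! ### The schedule of blocks -/

/-- State of the block schedule: the current time, the size of the pool of old features, its
prescribed power, the length of the current block and the position in it. -/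
structure Sched where
  time : ℕ
  pool : ℕ
  rate : ℝ
  block : ℕ
  pos : ℕ

open Classical in
/-- One round later. The pool doubles when possible, which also starts a new block. -/
noncomputable def Sched.next (β : ℝ) (τ : Sched) : Sched :=
  if τ.time + 1 < τ.pool + τ.pool then
    { τ with time := τ.time + 1, pos := if τ.pos + 1 < τ.block then τ.pos + 1 else 0 }
  else
    { time := τ.time + 1
      pool := τ.pool + τ.pool
      rate := τ.rate * β
      block := if (τ.block : ℝ) < τ.rate * β then τ.block + τ.block else τ.block
      pos := 0 }

/-- The schedule after `s` rounds. -/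
noncomputable def sched (β : ℝ) : ℕ → Sched
  | 0 => ⟨0, 1, 1, 1, 0⟩
  | s + 1 => (sched β s).next β

/-! ### Uniform distributions and iteration -/

section PMF

variable {Ω α γ δ : Type*} [Fintype α] [Nonempty α] [Fintype γ] [Nonempty γ]

lemma uniform_map_equiv (e : α ≃ γ) (g : γ → δ) :
    (PMF.uniformOfFintype α).map (fun a => g (e a)) = (PMF.uniformOfFintype γ).map g := by
  classical
  ext d
  simp only [PMF.map_apply, tsum_fintype, PMF.uniformOfFintype_apply, Fintype.card_congr e]
  exact Fintype.sum_equiv e _ _ fun a => rfl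

lemma uniform_bind_map (g : α → γ → δ) :
    (PMF.uniformOfFintype α).bind (fun a => (PMF.uniformOfFintype γ).map (g a))
      = (PMF.uniformOfFintype (α × γ)).map (fun p => g p.1 p.2) := by
  classical
  ext d
  simp only [PMF.bind_apply, PMF.map_apply, tsum_fintype, PMF.uniformOfFintype_apply,
    Fintype.card_prod, Fintype.sum_prod_type, Finset.mul_sum, Nat.cast_mul]
  refine Finset.sum_congr rfl fun a _ => Finset.sum_congr rfl fun c _ => ?_
  rw [ENNReal.mul_inv (Or.inr (ENNReal.natCast_ne_top _)) (Or.inl (ENNReal.natCast_ne_top _))]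
  split_ifs <;> simp

lemma uniform_map_of_eq {k K : ℕ} (h : k = K + 1) (f : ℕ → δ) :
    (PMF.uniformOfFintype (Fin (k - 1 + 1))).map (fun i => f i.val)
      = (PMF.uniformOfFintype (Fin (K + 1))).map (fun i => f i.val) := by
  subst h; rfl

lemma iterate_pure (f : Ω → PMF Ω) (Inv : ℕ → Ω → Prop) (n : ℕ)
    (h : ∀ i < n, ∀ c, Inv i c → ∃ c', f c = PMF.pure c' ∧ Inv (i + 1) c') {c : Ω}
    (hc : Inv 0 c) : ∃ c', iterate f n c = PMF.pure c' ∧ Inv n c' := by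
  suffices H : ∀ k i c, i + k = n → Inv i c → ∃ c', iterate f k c = PMF.pure c' ∧ Inv n c' from
    H n 0 c (zero_add n) hc
  intro k
  induction k with
  | zero => rintro i c rfl hc; exact ⟨c, rfl, hc⟩
  | succ k ih =>
    intro i c hi hc
    obtain ⟨c', h1, h2⟩ := h i (by omega) c hc
    obtain ⟨c'', h3, h4⟩ := ih (i + 1) c' (by omega) h2
    exact ⟨c'', by rw [iterate, h1, PMF.pure_bind, h3], h4⟩

/-- The invariant records the list of draws made so far, so the final configuration is a function of
the whole word of draws, and that word is uniform. -/
lemma iterate_uniform (f : Ω → PMF Ω) (Inv : List α → Ω → Prop)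
    (h : ∀ l c, Inv l c → ∃ g : α → Ω, f c = (PMF.uniformOfFintype α).map g ∧
      ∀ a, Inv (l ++ [a]) (g a)) (n : ℕ) (l : List α) (c : Ω) (hc : Inv l c) :
    ∃ G : (Fin n → α) → Ω, iterate f n c = (PMF.uniformOfFintype (Fin n → α)).map G ∧
      ∀ w, Inv (l ++ List.ofFn w) (G w) := by
  induction n generalizing l c with
  | zero =>
    refine ⟨fun _ => c, ?_, fun w => by simpa using hc⟩
    rw [iterate]; exact (PMF.map_const _ c).symm
  | succ n ih =>
    obtain ⟨g, hg, hg'⟩ := h l c hc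
    choose G hG hG' using fun a => ih (l ++ [a]) (g a) (hg' a)
    refine ⟨fun w => G (w 0) (Fin.tail w), ?_, fun w => ?_⟩
    · rw [iterate, hg, PMF.bind_map]
      have : (iterate f n ∘ g) = fun a => (PMF.uniformOfFintype (Fin n → α)).map (G a) :=
        funext hG
      rw [this, uniform_bind_map,
        ← uniform_map_equiv (Fin.consEquiv fun _ : Fin (n + 1) => α)]
      rfl
    · have := hG' (w 0) (Fin.tail w)
      rw [List.append_assoc] at this
      convert this using 2
      simp only [List.ofFn_succ, List.singleton_append]
      rfl

end PMF

/-! ### The program -/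

/-- Instructions one after the other. -/
def instrs : Instr → List Instr → Prog
  | i, [] => .instr i
  | i, j :: l => .seq (.instr i) (instrs j l)

/-- Initialization of the registers of the schedule. -/
noncomputable def initProg (β : ℝ) : Prog :=
  instrs (.natConst 1 1) [.natSub 7 0 1, .natConst 2 2, .natConst 4 1, .natConst 5 1,
    .realConst 1 1, .realConst 2 β]

/-- One step of the schedule. -/
def schedProg : Prog :=
  .seq (instrs (.natAdd 3 3 1) [.natAdd 6 6 1, .natAdd 8 4 4])
    (.ifNatLt 3 8
      -- There is no empty program. A branch that must do nothing writes the scratch register 8,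
      -- which each step of the schedule recomputes before use.
      (.ifNatLt 6 5 (.instr (.natConst 8 0)) (.instr (.natConst 6 0)))
      (.seq (instrs (.natAdd 4 4 4) [.realMul 1 1 2, .realOfNat 3 5, .natConst 6 0])
        (.ifRealLt 3 1 (.instr (.natAdd 5 5 5)) (.instr (.natConst 8 0)))))

/-- Push one labelled pair of the current block. -/
def labelProg : Prog := instrs (.label 3 9) [.pushLabelled 9 3, .natAdd 9 9 1]

/-- Push a random feature of the pool with a random sign. -/
def drawProg : Prog :=
  .seq (.instr (.random 11 4)) (.seq (.instr (.random 12 2))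
    (.ifNatLt 12 1 (.instr (.pushSigned 1 11)) (.instr (.pushSigned (-1) 11))))

/-- The two oracle calls and the prediction. -/
noncomputable def predictProg (L : ℝ) : Prog :=
  instrs (.pushSigned (-1) 7) [.realConst 4 L, .oracle 5 4, .pushSigned 1 7, .pushSigned 1 7,
    .oracle 6 4, .realSub 7 6 5, .realConst 8 (2 * L), .realDiv 0 7 8]

/-- The program. -/
noncomputable def program (β L : ℝ) : Prog :=
  .seq (initProg β) <| .seq (.loop 7 schedProg) <| .seq (.instr (.natSub 9 7 6)) <|
  .seq (.loop 6 labelProg) <| .seq (instrs (.natSub 10 5 6) [.natSub 10 10 1]) <|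
  .seq (.loop 10 drawProg) (predictProg L)

section Execution

variable {X : Type u} {ℓ : ℝ → ℝ → ℝ} {H : Set (X → I)} {β L : ℝ}

/-- The pool of the first `N` features. -/
def poolOf (hist : List (X × I)) (x : X) (N : ℕ) : Fin N → X := fun i => feature hist x i

/-- Natural registers 1 and 2 hold constants, 3 to 6 the schedule after i rounds, and 7 the number
of past rounds. The step bound counts seven initial instructions and the loop entry, then at most
eleven steps per repetition. -/
structure SchedInv (β : ℝ) (s i : ℕ) (c : Config X) : Prop where
  nat1 : c.nat 1 = 1
  nat2 : c.nat 2 = 2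
  nat3 : c.nat 3 = (sched β i).time
  nat4 : c.nat 4 = (sched β i).pool
  nat5 : c.nat 5 = (sched β i).block
  nat6 : c.nat 6 = (sched β i).pos
  nat7 : c.nat 7 = s
  real1 : c.real 1 = (sched β i).rate
  real2 : c.real 2 = β
  labelled : c.labelled = []
  signed : c.signed = []
  calls : c.calls = 0
  steps : c.steps ≤ 8 + 12 * i

lemma exec_initProg (hist : List (X × I)) (x : X) :
    ∃ c, (initProg β).exec ℓ H hist x (Config.init (hist.length + 1)) = PMF.pure c ∧
      SchedInv β hist.length 0 c.tick := by
  simp only [initProg, instrs, Prog.exec, Instr.exec, PMF.pure_bind]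
  refine ⟨_, rfl, ?_⟩
  constructor <;> simp [Config.tick, Config.setNat, Config.setReal, Config.init, sched]

lemma exec_schedProg (hist : List (X × I)) (x : X) {s i : ℕ} {c : Config X}
    (hc : SchedInv β s i c) :
    ∃ c', schedProg.exec ℓ H hist x c.tick = PMF.pure c' ∧ SchedInv β s (i + 1) c' := by
  obtain ⟨h1, h2, h3, h4, h5, h6, h7, h8, h9, h10, h11, h12, h13⟩ := hc
  simp only [schedProg, instrs, Prog.exec, Instr.exec, PMF.pure_bind]
  simp only [Config.tick, Config.setNat, Config.setReal, Function.update_apply]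
  norm_num
  simp only [h1, h3, h4, h5, h6, h8, h9]
  split_ifs with ha hb hb
  all_goals
    refine ⟨_, rfl, ?_⟩
    constructor <;> simp [sched, Sched.next, ha, hb, h1, h2, h4, h5, h7, h8, h9, h10,
      h11, h12]
    omega

structure LabelInv (β : ℝ) (hist : List (X × I)) (j : ℕ) (c : Config X) : Prop where
  nat1 : c.nat 1 = 1
  nat2 : c.nat 2 = 2
  nat4 : c.nat 4 = (sched β hist.length).pool
  nat5 : c.nat 5 = (sched β hist.length).block
  nat6 : c.nat 6 = (sched β hist.length).pos
  nat7 : c.nat 7 = hist.length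
  nat9 : c.nat 9 = hist.length - (sched β hist.length).pos + j
  labelled : c.labelled = (hist.drop (hist.length - (sched β hist.length).pos)).take j
  signed : c.signed = []
  calls : c.calls = 0
  steps : c.steps ≤ 11 + 12 * hist.length + 5 * j

lemma exec_labelProg (hist : List (X × I)) (x : X) {j : ℕ} (hj : j < (sched β hist.length).pos)
    (hpos : (sched β hist.length).pos ≤ hist.length) {c : Config X} (hc : LabelInv β hist j c) :
    ∃ c', labelProg.exec ℓ H hist x c.tick = PMF.pure c' ∧ LabelInv β hist (j + 1) c' := by
  obtain ⟨h1, h2, h4, h5, h6, h7, h9, h10, h11, h12, h13⟩ := hc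
  simp only [labelProg, instrs, Prog.exec, Instr.exec, PMF.pure_bind]
  have hlt : hist.length - (sched β hist.length).pos + j < hist.length := by omega
  refine ⟨_, rfl, ?_⟩
  constructor <;>
    simp [Config.tick, Config.setNat, Config.setReal, h1, h2, h4, h5, h6, h7, h9, h10,
      h11, h12, clamp_coe] <;> try omega
  rw [List.take_add_one, List.getElem?_drop, List.getElem?_eq_getElem hlt]
  simp [feature, pastLabel, hlt]

structure DrawInv (β : ℝ) (hist : List (X × I)) (x : X) {K : ℕ} (l : List (ℤˣ × Fin (K + 1)))
    (c : Config X) : Prop where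
  nat1 : c.nat 1 = 1
  nat2 : c.nat 2 = 2
  nat4 : c.nat 4 = K + 1
  nat7 : c.nat 7 = hist.length
  labelled : c.labelled = hist.drop (hist.length - (sched β hist.length).pos)
  signed : c.signed = l.map fun a => (a.1, poolOf hist x (K + 1) a.2)
  calls : c.calls = 0
  steps : c.steps ≤ 14 + 17 * hist.length + 5 * l.length

/-- The sign encoded by a bit. -/
noncomputable def signEquiv : Fin 2 ≃ ℤˣ :=
  Equiv.ofBijective (fun i => if (i : ℕ) < 1 then 1 else -1) (by decide)

/-- The pool index and the sign bit are independent uniform draws, hence one uniform draw from the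
product, which is reindexed through `signEquiv`. -/
lemma exec_drawProg (hist : List (X × I)) (x : X) {K : ℕ} {l : List (ℤˣ × Fin (K + 1))}
    {c : Config X} (hc : DrawInv β hist x l c) :
    ∃ g : ℤˣ × Fin (K + 1) → Config X,
      drawProg.exec ℓ H hist x c.tick = (PMF.uniformOfFintype _).map g ∧
        ∀ a, DrawInv β hist x (l ++ [a]) (g a) := by
  obtain ⟨h1, h2, h4, h7, h8, h9, h10, h11⟩ := hc
  let g : ℤˣ × Fin (K + 1) → Config X := fun a =>
    { ((c.setNat 11 a.2.val).setNat 12 (signEquiv.symm a.1).val) with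
      steps := c.steps + 5
      signed := c.signed ++ [(a.1, feature hist x a.2)] }
  refine ⟨g, ?_, fun a => ?_⟩
  · rw [← uniform_map_equiv ((Equiv.prodComm _ _).trans (signEquiv.prodCongr (Equiv.refl _))),
      ← uniform_bind_map (fun (i : Fin (K + 1)) (j : Fin 2) =>
        g (((Equiv.prodComm _ _).trans (signEquiv.prodCongr (Equiv.refl _))) (i, j)))]
    have e1 : ∀ c' : Config X, c'.nat 4 = K + 1 →
        Instr.exec ℓ H hist x c' (.random 11 4) =
          (PMF.uniformOfFintype (Fin (K + 1))).map (fun i => c'.setNat 11 i.val) := by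
      intro c' h; exact uniform_map_of_eq h (fun i => c'.setNat 11 i)
    have e2 : ∀ c' : Config X, c'.nat 2 = 2 →
        Instr.exec ℓ H hist x c' (.random 12 2) =
          (PMF.uniformOfFintype (Fin 2)).map (fun i => c'.setNat 12 i.val) := by
      intro c' h; exact uniform_map_of_eq h (fun i => c'.setNat 12 i)
    simp only [drawProg, Prog.exec]
    rw [e1 _ (by simpa [Config.tick] using h4), PMF.bind_map]
    congr 1; ext1 i
    simp only [Function.comp_apply]
    rw [e2 _ (by simpa [Config.tick, Config.setNat] using h2), PMF.bind_map, PMF.map]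
    congr 1; ext1 j
    simp only [Function.comp_apply, Config.tick, Config.setNat, Function.update_apply, h1]
    have hg : g (((Equiv.prodComm _ _).trans (signEquiv.prodCongr (Equiv.refl _))) (i, j)) =
        { ((c.setNat 11 i.val).setNat 12 j.val) with
          steps := c.steps + 5
          signed := c.signed ++ [(signEquiv j, feature hist x i)] } := by simp [g]
    have hj : signEquiv j = if (j : ℕ) < 1 then 1 else -1 := rfl
    rw [hg, hj]
    norm_num
    split_ifs with hlt <;> simp [Instr.exec, Config.setNat]
  · constructor <;> simp [g, Config.setNat, h1, h2, h4, h7, h8, h9, h10, poolOf]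
    omega

lemma exec_predictProg (hL : 0 ≤ L) (hist : List (X × I)) (x : X) {K : ℕ}
    {l : List (ℤˣ × Fin (K + 1))} {c : Config X} (hc : DrawInv β hist x l c) :
    ∃ c', (predictProg L).exec ℓ H hist x c = PMF.pure c' ∧
      c'.real 0 = predict ℓ H L (hist.drop (hist.length - (sched β hist.length).pos))
        (l.map fun a => (a.1, poolOf hist x (K + 1) a.2)) x ∧
      c'.calls = 2 ∧ c'.steps ≤ 23 + 17 * hist.length + 5 * l.length := by
  obtain ⟨h1, h2, h4, h7, h8, h9, h10, h11⟩ := hc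
  simp only [predictProg, instrs, Prog.exec, Instr.exec, PMF.pure_bind]
  refine ⟨_, rfl, ?_, ?_, ?_⟩
  · simp [Config.tick, Config.setReal, h7, h8, h9, feature, predict, abs_of_nonneg hL]
  · simp [Config.tick, Config.setReal, h10]
  · simp [Config.tick, Config.setReal]; omega

/-- The law of the final configuration. -/
lemma run_program (hL : 0 ≤ L) (hist : List (X × I)) (x : X) {K m : ℕ}
    (hK : (sched β hist.length).pool = K + 1)
    (hm : (sched β hist.length).block - (sched β hist.length).pos - 1 = m)
    (hpos : (sched β hist.length).pos ≤ hist.length) :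
    ∃ F : (Fin m → ℤˣ × Fin (K + 1)) → Config X,
      (program β L).run ℓ H hist x = (PMF.uniformOfFintype _).map F ∧
      ∀ w, (F w).real 0 = predict ℓ H L (hist.drop (hist.length - (sched β hist.length).pos))
          (hallucination (poolOf hist x (K + 1)) w) x ∧
        (F w).calls = 2 ∧ (F w).steps ≤ 23 + 17 * hist.length + 5 * m := by
  obtain ⟨c₁, e₁, i₁⟩ := exec_initProg (ℓ := ℓ) (H := H) (β := β) hist x
  obtain ⟨c₂, e₂, i₂⟩ := iterate_pure (fun c => schedProg.exec ℓ H hist x c.tick)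
    (SchedInv β hist.length) hist.length (fun i _ c hc => exec_schedProg hist x hc) i₁
  have e₂' : (Prog.loop 7 schedProg).exec ℓ H hist x c₁ = PMF.pure c₂ := by
    have h7 : c₁.nat 7 = hist.length := i₁.nat7
    rw [Prog.exec, h7, e₂]
  obtain ⟨c₃, e₃, i₃⟩ : ∃ c₃, (Prog.instr (.natSub 9 7 6)).exec ℓ H hist x c₂ = PMF.pure c₃ ∧
      LabelInv β hist 0 c₃.tick := by
    refine ⟨_, rfl, ?_⟩
    obtain ⟨h1, h2, h3, h4, h5, h6, h7, h8, h9, h10, h11, h12, h13⟩ := i₂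
    constructor <;> simp [Config.tick, Config.setNat, *]
    omega
  obtain ⟨c₄, e₄, i₄⟩ := iterate_pure (fun c => labelProg.exec ℓ H hist x c.tick)
    (LabelInv β hist) (sched β hist.length).pos
    (fun i hi c hc => exec_labelProg hist x hi hpos hc) i₃
  have e₄' : (Prog.loop 6 labelProg).exec ℓ H hist x c₃ = PMF.pure c₄ := by
    have h6 : c₃.nat 6 = _ := i₃.nat6
    rw [Prog.exec, h6, e₄]
  obtain ⟨c₅, e₅, i₅, n₅⟩ : ∃ c₅, (instrs (.natSub 10 5 6) [.natSub 10 10 1]).exec ℓ H hist x c₄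
      = PMF.pure c₅ ∧ DrawInv β hist x ([] : List (ℤˣ × Fin (K + 1))) c₅.tick ∧
        c₅.nat 10 = m := by
    simp only [instrs, Prog.exec, Instr.exec, PMF.pure_bind]
    obtain ⟨h1, h2, h4, h5, h6, h7, h8, h9, h10, h11, h12⟩ := i₄
    refine ⟨_, rfl, ?_, ?_⟩
    · constructor <;> simp [Config.tick, Config.setNat, *]
      omega
    · simp [Config.tick, Config.setNat, *]
  obtain ⟨G, e₆, i₆⟩ := iterate_uniform (fun c => drawProg.exec ℓ H hist x c.tick)
    (fun l c => DrawInv β hist x (K := K) l c) (fun l c hc => exec_drawProg hist x hc) m [] _ i₅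
  have e₆' : (Prog.loop 10 drawProg).exec ℓ H hist x c₅
      = (PMF.uniformOfFintype _).map G := by
    rw [Prog.exec, n₅, e₆]
  choose F hF hr hcalls hsteps using fun w => exec_predictProg (ℓ := ℓ) (H := H) hL hist x (i₆ w)
  refine ⟨F, ?_, fun w => ⟨?_, hcalls w, ?_⟩⟩
  · rw [Prog.run, program]
    simp only [Prog.exec, e₁, PMF.pure_bind] at *
    rw [e₂', PMF.pure_bind, e₃, PMF.pure_bind, e₄', PMF.pure_bind, e₅, PMF.pure_bind, e₆',
      PMF.bind_map]
    rw [PMF.map]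
    congr 1
    ext1 w
    exact hF w
  · rw [hr w]; simp [hallucination, Function.comp_def, List.map_ofFn]
  · simpa using hsteps w

end Execution

/-! ### Deviations of empirical averages over the pool -/

section Deviation

variable {X : Type u} [MeasurableSpace X] (μ : Measure X) [IsProbabilityMeasure μ]

/-- The law of an infinite sequence of independent features. -/
noncomputable def featureLaw : Measure (ℕ → X) := Measure.infinitePi fun _ => μ

instance : IsProbabilityMeasure (featureLaw μ) := by unfold featureLaw; infer_instance

lemma measurable_update_prod (i : ℕ) :
    Measurable fun p : (ℕ → X) × X => Function.update p.1 i p.2 := by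
  refine measurable_pi_lambda _ fun j => ?_
  by_cases h : j = i
  · subst h; simpa using measurable_snd
  · simp only [Function.update_of_ne h]
    exact (measurable_pi_apply j).comp measurable_fst

/-- Resampling a coordinate does not change the law. -/
lemma measurePreserving_update (i : ℕ) :
    MeasurePreserving (fun p : (ℕ → X) × X => Function.update p.1 i p.2)
      ((featureLaw μ).prod μ) (featureLaw μ) := by
  refine ⟨measurable_update_prod i, ?_⟩
  have hprob : IsProbabilityMeasure (((featureLaw μ).prod μ).map
      fun p : (ℕ → X) × X => Function.update p.1 i p.2) :=
    Measure.isProbabilityMeasure_map (measurable_update_prod i).aemeasurable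
  refine Measure.eq_infinitePi _ fun s t ht => ?_
  have hms : MeasurableSet (Set.pi (s : Set ℕ) t) :=
    MeasurableSet.pi s.countable_toSet fun j hj => ht j
  rw [Measure.map_apply (measurable_update_prod i) hms]
  by_cases hi : i ∈ s
  · have : (fun p : (ℕ → X) × X => Function.update p.1 i p.2) ⁻¹' Set.pi (s : Set ℕ) t
        = (Set.pi ((s.erase i : Finset ℕ) : Set ℕ) t) ×ˢ t i := by
      ext ⟨ω, v⟩
      simp only [Set.mem_preimage, Set.mem_pi, Finset.mem_coe, Set.mem_prod, Finset.mem_erase]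
      constructor
      · intro h
        refine ⟨fun j hj => by simpa [hj.1] using h j hj.2, by simpa using h i hi⟩
      · rintro ⟨h1, h2⟩ j hj
        by_cases hji : j = i
        · subst hji; simpa using h2
        · simpa [hji] using h1 j ⟨hji, hj⟩
    rw [this, Measure.prod_prod, featureLaw, Measure.infinitePi_pi _ (fun j _ => ht j), mul_comm,
      Finset.mul_prod_erase s (fun j => μ (t j)) hi]
  · have : (fun p : (ℕ → X) × X => Function.update p.1 i p.2) ⁻¹' Set.pi (s : Set ℕ) t
        = (Set.pi (s : Set ℕ) t) ×ˢ Set.univ := by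
      ext ⟨ω, v⟩
      simp only [Set.mem_preimage, Set.mem_pi, Finset.mem_coe, Set.mem_prod, Set.mem_univ,
        and_true]
      refine forall₂_congr fun j hj => ?_
      have hji : j ≠ i := by rintro rfl; exact hi hj
      simp [hji]
    rw [this, Measure.prod_prod, measure_univ, mul_one, featureLaw,
      Measure.infinitePi_pi _ (fun j _ => ht j)]

lemma integral_update (i : ℕ) {F : (ℕ → X) → ℝ} (hF : Integrable F (featureLaw μ)) :
    ∫ x, ∫ ω, F (Function.update ω i x) ∂(featureLaw μ) ∂μ = ∫ ω, F ω ∂(featureLaw μ) := by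
  have h := measurePreserving_update μ i
  rw [← integral_prod_symm (fun p : (ℕ → X) × X => F (Function.update p.1 i p.2))
    (h.integrable_comp_of_integrable hF)]
  have h' := integral_map h.measurable.aemeasurable (f := F) (by rw [h.map_eq]; exact hF.1)
  rw [h.map_eq] at h'
  exact h'.symm

/-- Hoeffding's lemma. Oscillation at most L confines f to an interval of length 2L centred at any
of its values, which gives the variance proxy L². The sharper L²/4 would only improve constants. -/
lemma lintegral_exp_centered_le {f : X → ℝ} (hf : Measurable f) {L : ℝ} (hL : 0 ≤ L)
    (hosc : ∀ x x', f x - f x' ≤ L) (s : ℝ) :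
    ∫⁻ v, ENNReal.ofReal (Real.exp (s * (∫ x, f x ∂μ - f v))) ∂μ
      ≤ ENNReal.ofReal (Real.exp (s ^ 2 * L ^ 2 / 2)) := by
  obtain ⟨x₀⟩ : Nonempty X := nonempty_of_isProbabilityMeasure μ
  have hmem : ∀ᵐ v ∂μ, (fun v => -f v) v ∈ Set.Icc (-f x₀ - L) (-f x₀ + L) :=
    Filter.Eventually.of_forall fun v =>
      ⟨by have := hosc v x₀; simp only; linarith, by have := hosc x₀ v; simp only; linarith⟩
  have hsub := ProbabilityTheory.hasSubgaussianMGF_of_mem_Icc (μ := μ) (X := fun v => -f v)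
    hf.neg.aemeasurable hmem
  have h1 := hsub.mgf_le s
  have hint := hsub.integrable_exp_mul s
  rw [ProbabilityTheory.mgf] at h1
  have he : ∀ v, s * (∫ x, f x ∂μ - f v) = s * (-f v - ∫ x, -f x ∂μ) := by
    intro v; rw [integral_neg]; ring
  simp only [he]
  rw [← ofReal_integral_eq_lintegral_ofReal hint
    (Filter.Eventually.of_forall fun v => (Real.exp_pos _).le)]
  refine ENNReal.ofReal_le_ofReal (h1.trans (le_of_eq ?_))
  congr 1
  push_cast
  rw [Real.norm_eq_abs]
  have : -f x₀ + L - (-f x₀ - L) = 2 * L := by ring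
  rw [this, abs_of_nonneg (by linarith)]; ring

lemma measurable_integral_left {g : X → (ℕ → X) → ℝ} (hg : Measurable (Function.uncurry g)) :
    Measurable fun ω => ∫ x, g x ω ∂μ :=
  (hg.stronglyMeasurable.integral_prod_left (μ := μ)).measurable

lemma measurable_eval_self {g : X → (ℕ → X) → ℝ} (hg : Measurable (Function.uncurry g)) (i : ℕ) :
    Measurable fun ω : ℕ → X => g (ω i) ω :=
  show Measurable (Function.uncurry g ∘ fun ω => (ω i, ω)) from
    hg.comp ((measurable_pi_apply i).prodMk measurable_id)

/-- Coordinates are resampled one at a time. Since g does not see coordinate i, only the i-th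
summand depends on the new value, and integrating it out costs one factor from Hoeffding's lemma.
The other coordinates of ω, on which g may depend, stay fixed meanwhile. -/
lemma lintegral_exp_sum_centered_le {L : ℝ} (hL : 0 ≤ L) {g : X → (ℕ → X) → ℝ}
    (hg : Measurable (Function.uncurry g)) (hosc : ∀ x x' ω, g x ω - g x' ω ≤ L) (s : ℝ)
    (U : Finset ℕ) (hinv : ∀ i ∈ U, ∀ x ω v, g x (Function.update ω i v) = g x ω) :
    ∫⁻ ω, ENNReal.ofReal (Real.exp (s * ∑ i ∈ U, (∫ x, g x ω ∂μ - g (ω i) ω))) ∂(featureLaw μ)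
      ≤ ENNReal.ofReal (Real.exp (U.card * (s ^ 2 * L ^ 2 / 2))) := by
  induction U using Finset.induction_on with
  | empty => simp
  | insert i U hi ih =>
    have hmeas : ∀ V : Finset ℕ, Measurable fun ω : ℕ → X =>
        ENNReal.ofReal (Real.exp (s * ∑ i ∈ V, (∫ x, g x ω ∂μ - g (ω i) ω))) := fun V => by
      refine ENNReal.measurable_ofReal.comp (Real.measurable_exp.comp (Measurable.const_mul ?_ s))
      exact Finset.measurable_sum _ fun i _ =>
        (measurable_integral_left μ hg).sub (measurable_eval_self hg i)
    have h := measurePreserving_update μ i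
    rw [← h.lintegral_comp (hmeas _), lintegral_prod]
    swap
    · exact ((hmeas (insert i U)).comp h.measurable).aemeasurable
    have hstep : ∀ ω : ℕ → X, ∫⁻ v, ENNReal.ofReal (Real.exp (s * ∑ j ∈ insert i U,
          (∫ x, g x (Function.update ω i v) ∂μ
            - g (Function.update ω i v j) (Function.update ω i v)))) ∂μ
        ≤ ENNReal.ofReal (Real.exp (s * ∑ j ∈ U, (∫ x, g x ω ∂μ - g (ω j) ω)))
          * ENNReal.ofReal (Real.exp (s ^ 2 * L ^ 2 / 2)) := by
      intro ω
      have e : ∀ v, ENNReal.ofReal (Real.exp (s * ∑ j ∈ insert i U,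
          (∫ x, g x (Function.update ω i v) ∂μ
            - g (Function.update ω i v j) (Function.update ω i v))))
          = ENNReal.ofReal (Real.exp (s * ∑ j ∈ U, (∫ x, g x ω ∂μ - g (ω j) ω)))
            * ENNReal.ofReal (Real.exp (s * (∫ x, g x ω ∂μ - g v ω))) := by
        intro v
        rw [← ENNReal.ofReal_mul (Real.exp_pos _).le, ← Real.exp_add, sum_insert hi, mul_add,
          add_comm]
        simp only [hinv i (mem_insert_self i U), Function.update_self]
        congr 4
        refine sum_congr rfl fun j hj => ?_
        have : j ≠ i := by rintro rfl; exact hi hj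
        simp [this]
      simp only [e]
      have hgω : Measurable fun x => g x ω := hg.comp (measurable_id.prodMk measurable_const)
      rw [lintegral_const_mul]
      · exact mul_le_mul_right (lintegral_exp_centered_le μ hgω hL (fun x x' => hosc x x' ω) s) _
      · exact ENNReal.measurable_ofReal.comp (Real.measurable_exp.comp
          ((hgω.const_sub _).const_mul s))
    refine (lintegral_mono hstep).trans ?_
    rw [lintegral_mul_const _ (hmeas U)]
    refine (mul_le_mul_left (ih fun j hj => hinv j (mem_insert_of_mem hj)) _).trans ?_
    rw [← ENNReal.ofReal_mul (Real.exp_pos _).le, ← Real.exp_add, card_insert_of_notMem hi]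
    refine le_of_eq ?_
    congr 2; push_cast; ring

/-- A function of the features that is dominated by one of finitely many deviations, each of them
an average over random index tuples, has a small mean. -/
lemma integral_deviation_le {Y : Type*} [Fintype Y] [Nonempty Y] {m N : ℕ} [NeZero N]
    {L C s δ : ℝ} (hL : 0 ≤ L) (hs : 0 < s)
    (g : Y → (Fin m → ℤˣ × Fin N) → X → (ℕ → X) → ℝ)
    (hg : ∀ y w, Measurable (Function.uncurry (g y w))) (hC : ∀ y w x ω, |g y w x ω| ≤ C)
    (hosc : ∀ y w x x' ω, g y w x ω - g y w x' ω ≤ L)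
    (hinv : ∀ y w (i : Fin N), (∀ j, (w j).2 ≠ i) → ∀ x ω v,
      g y w x (Function.update ω i v) = g y w x ω)
    {Z : (ℕ → X) → ℝ} (hZi : Integrable Z (featureLaw μ))
    (hZ : ∀ ω, ∃ y, Z ω ≤ (𝔼 w, (∫ x, g y w x ω ∂μ - 𝔼 i : Fin N, g y w (ω i) ω)) + δ) :
    ∫ ω, Z ω ∂(featureLaw μ)
      ≤ δ + L * m / N + Real.log (Fintype.card Y) / s + s * L ^ 2 / (2 * N) := by
  have hN : (0 : ℝ) < N := by exact_mod_cast Nat.pos_of_ne_zero (NeZero.ne N)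
  have hcard : (0 : ℝ) < Fintype.card Y := by exact_mod_cast Fintype.card_pos
  have hgω : ∀ y w ω, Measurable fun x => g y w x ω := fun y w ω =>
    (hg y w).comp (measurable_id.prodMk measurable_const)
  have hgi : ∀ y w ω, Integrable (fun x => g y w x ω) μ := fun y w ω =>
    Integrable.of_bound (hgω y w ω).aestronglyMeasurable C
      (Filter.Eventually.of_forall fun x => hC y w x ω)
  -- The pool indices left untouched by the draw w. Only these enter the exponential moment. The
  -- others number at most m, and each contributes at most L.
  let U : (Fin m → ℤˣ × Fin N) → Finset (Fin N) := fun w => univ.filter fun i => ∀ j, (w j).2 ≠ i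
  let K : Y → (Fin m → ℤˣ × Fin N) → (ℕ → X) → ℝ := fun y w ω =>
    ∑ i ∈ U w, (∫ x, g y w x ω ∂μ - g y w (ω i) ω)
  have hKle : ∀ y w ω, ∫ x, g y w x ω ∂μ - 𝔼 i : Fin N, g y w (ω i) ω
      ≤ L * m / N + (N : ℝ)⁻¹ * K y w ω := by
    intro y w ω
    have h1 : ∫ x, g y w x ω ∂μ - 𝔼 i : Fin N, g y w (ω i) ω
        = (N : ℝ)⁻¹ * ∑ i : Fin N, (∫ x, g y w x ω ∂μ - g y w (ω i) ω) := by
      rw [Fintype.expect_eq_sum_div_card, sum_sub_distrib]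
      simp; field_simp
    have h2 : ∑ i ∈ univ.filter (fun i : Fin N => ¬ ∀ j, (w j).2 ≠ i),
        (∫ x, g y w x ω ∂μ - g y w (ω i) ω) ≤ m * L := by
      have hle : ∀ i ∈ univ.filter (fun i : Fin N => ¬ ∀ j, (w j).2 ≠ i),
          ∫ x, g y w x ω ∂μ - g y w (ω i) ω ≤ L := fun i _ => by
        have : ∫ x, g y w x ω ∂μ ≤ ∫ x, (g y w (ω i) ω + L) ∂μ :=
          integral_mono (hgi y w ω) (integrable_const _) fun x => by
            have := hosc y w x (ω i) ω; simp only; linarith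
        simp at this; linarith
      refine (sum_le_card_nsmul _ _ L hle).trans ?_
      rw [nsmul_eq_mul]
      refine mul_le_mul_of_nonneg_right ?_ hL
      have hsub : univ.filter (fun i : Fin N => ¬ ∀ j, (w j).2 ≠ i)
          ⊆ univ.image fun j => (w j).2 := by
        intro i hi
        simp only [mem_filter, mem_univ, true_and, not_forall, not_not] at hi
        simpa using hi
      exact_mod_cast (card_le_card hsub).trans (card_image_le.trans (by simp))
    rw [h1, ← sum_filter_add_sum_filter_not univ (fun i : Fin N => ∀ j, (w j).2 ≠ i), mul_add,
      add_comm]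
    refine add_le_add ?_ le_rfl
    rw [div_eq_inv_mul, mul_comm L]
    exact mul_le_mul_of_nonneg_left h2 (by positivity)
  have hexp : ∀ y w, ∫⁻ ω, ENNReal.ofReal (Real.exp (s * ((N : ℝ)⁻¹ * K y w ω))) ∂(featureLaw μ)
      ≤ ENNReal.ofReal (Real.exp (s ^ 2 * L ^ 2 / (2 * N))) := by
    intro y w
    have h := lintegral_exp_sum_centered_le μ hL (hg y w) (hosc y w) (s * (N : ℝ)⁻¹)
      ((U w).map Fin.valEmbedding) (by
        intro i hi
        simp only [mem_map, Fin.valEmbedding_apply] at hi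
        obtain ⟨k, hk, rfl⟩ := hi
        exact hinv y w k (by simpa [U] using hk))
    simp only [sum_map, Fin.valEmbedding_apply, card_map] at h
    simp only [K, ← mul_assoc]
    refine h.trans (ENNReal.ofReal_le_ofReal (Real.exp_le_exp.2 ?_))
    have hc : ((U w).card : ℝ) ≤ N := by
      exact_mod_cast (card_le_univ _).trans (by simp)
    calc ((U w).card : ℝ) * ((s * (N : ℝ)⁻¹) ^ 2 * L ^ 2 / 2)
        ≤ N * ((s * (N : ℝ)⁻¹) ^ 2 * L ^ 2 / 2) :=
          mul_le_mul_of_nonneg_right hc (by positivity)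
      _ = _ := by field_simp
  have hKm : ∀ y w, Measurable (K y w) := fun y w =>
    Finset.measurable_sum _ fun i _ =>
      (measurable_integral_left μ (hg y w)).sub (measurable_eval_self (hg y w) i)
  have hexpi : ∀ y w, Integrable (fun ω => Real.exp (s * ((N : ℝ)⁻¹ * K y w ω)))
      (featureLaw μ) := by
    intro y w
    have hm : Measurable fun ω => Real.exp (s * ((N : ℝ)⁻¹ * K y w ω)) :=
      Real.measurable_exp.comp (((hKm y w).const_mul _).const_mul _)
    refine ⟨hm.aestronglyMeasurable, ?_⟩
    rw [hasFiniteIntegral_iff_ofReal (Filter.Eventually.of_forall fun ω => (Real.exp_pos _).le)]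
    exact (hexp y w).trans_lt ENNReal.ofReal_lt_top
  have hexp' : ∀ y w, ∫ ω, Real.exp (s * ((N : ℝ)⁻¹ * K y w ω)) ∂(featureLaw μ)
      ≤ Real.exp (s ^ 2 * L ^ 2 / (2 * N)) := by
    intro y w
    rw [integral_eq_lintegral_of_nonneg_ae
      (Filter.Eventually.of_forall fun ω => (Real.exp_pos _).le) (hexpi y w).1]
    exact ENNReal.toReal_le_of_le_ofReal (Real.exp_pos _).le (hexp y w)
  -- c bounds the logarithm of the sum over y of the exponential moments. The tangent inequality u ≤
  -- e^(u − c) + c − 1 then plays the role of Jensen's inequality. Being linear in the exponential,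
  -- it commutes with the averages over w and ω.
  set c : ℝ := Real.log (Fintype.card Y) + s ^ 2 * L ^ 2 / (2 * N) with hc
  have hpt : ∀ ω, Z ω ≤ δ + L * m / N + s⁻¹ * (Real.exp (-c) *
      (∑ y, 𝔼 w, Real.exp (s * ((N : ℝ)⁻¹ * K y w ω))) + c - 1) := by
    intro ω
    obtain ⟨y, hy⟩ := hZ ω
    have h1 : 𝔼 w, (∫ x, g y w x ω ∂μ - 𝔼 i : Fin N, g y w (ω i) ω)
        ≤ L * m / N + 𝔼 w, (N : ℝ)⁻¹ * K y w ω := by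
      rw [← Fintype.expect_const (ι := Fin m → ℤˣ × Fin N) (L * m / N), ← expect_add_distrib]
      exact expect_le_expect fun w _ => hKle y w ω
    have h2 : ∀ w, (N : ℝ)⁻¹ * K y w ω
        ≤ s⁻¹ * (Real.exp (-c) * Real.exp (s * ((N : ℝ)⁻¹ * K y w ω)) + c - 1) := by
      intro w
      rw [← Real.exp_add]
      have := Real.add_one_le_exp (-c + s * ((N : ℝ)⁻¹ * K y w ω))
      calc (N : ℝ)⁻¹ * K y w ω = s⁻¹ * (s * ((N : ℝ)⁻¹ * K y w ω)) := by field_simp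
        _ ≤ _ := mul_le_mul_of_nonneg_left (by linarith) (by positivity)
    have h3 : 𝔼 w, (N : ℝ)⁻¹ * K y w ω ≤ s⁻¹ * (Real.exp (-c) *
        (𝔼 w, Real.exp (s * ((N : ℝ)⁻¹ * K y w ω))) + c - 1) := by
      refine (expect_le_expect fun w _ => h2 w).trans (le_of_eq ?_)
      rw [← mul_expect, expect_sub_distrib, expect_add_distrib, ← mul_expect,
        Fintype.expect_const, Fintype.expect_const]
    have h4 : 𝔼 w, Real.exp (s * ((N : ℝ)⁻¹ * K y w ω))
        ≤ ∑ y, 𝔼 w, Real.exp (s * ((N : ℝ)⁻¹ * K y w ω)) :=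
      single_le_sum (f := fun y => 𝔼 w, Real.exp (s * ((N : ℝ)⁻¹ * K y w ω)))
        (fun y _ => expect_nonneg fun w _ => (Real.exp_pos _).le) (mem_univ y)
    have h5 : s⁻¹ * (Real.exp (-c) * (𝔼 w, Real.exp (s * ((N : ℝ)⁻¹ * K y w ω))) + c - 1)
        ≤ s⁻¹ * (Real.exp (-c) * (∑ y, 𝔼 w, Real.exp (s * ((N : ℝ)⁻¹ * K y w ω))) + c - 1) := by
      refine mul_le_mul_of_nonneg_left ?_ (by positivity)
      have := mul_le_mul_of_nonneg_left h4 (Real.exp_pos (-c)).le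
      linarith
    linarith
  have hsum : ∀ y, Integrable (fun ω => 𝔼 w, Real.exp (s * ((N : ℝ)⁻¹ * K y w ω)))
      (featureLaw μ) := by
    intro y
    simp only [Fintype.expect_eq_sum_div_card]
    exact (integrable_finsetSum _ fun w _ => hexpi y w).div_const _
  have hsum' : ∀ y, ∫ ω, 𝔼 w, Real.exp (s * ((N : ℝ)⁻¹ * K y w ω)) ∂(featureLaw μ)
      ≤ Real.exp (s ^ 2 * L ^ 2 / (2 * N)) := by
    intro y
    simp only [Fintype.expect_eq_sum_div_card]
    rw [integral_div, integral_finsetSum _ fun w _ => hexpi y w, ← Fintype.expect_eq_sum_div_card]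
    exact expect_le univ_nonempty fun w _ => hexp' y w
  have hS := integrable_finsetSum univ fun y _ => hsum y
  have hS₁ := hS.const_mul (Real.exp (-c))
  have hS₂ := hS₁.add (integrable_const c)
  have hS₃ := hS₂.sub (integrable_const (1 : ℝ))
  have hS₄ := hS₃.const_mul s⁻¹
  have hI := (integrable_const (δ + L * m / N)).add hS₄
  calc ∫ ω, Z ω ∂(featureLaw μ) ≤ _ := integral_mono hZi hI hpt
    _ = δ + L * m / N + s⁻¹ * (Real.exp (-c) *
        (∑ y, ∫ ω, 𝔼 w, Real.exp (s * ((N : ℝ)⁻¹ * K y w ω)) ∂(featureLaw μ)) + c - 1) := by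
      rw [integral_add' (integrable_const _) hS₄, integral_const_mul,
        integral_sub' hS₂ (integrable_const _), integral_add' hS₁ (integrable_const _),
        integral_const_mul, integral_finsetSum _ fun y _ => hsum y]
      simp
    _ ≤ δ + L * m / N + s⁻¹ * (1 + c - 1) := by
      have hone : Real.exp (-c) *
          (∑ y, ∫ ω, 𝔼 w, Real.exp (s * ((N : ℝ)⁻¹ * K y w ω)) ∂(featureLaw μ)) ≤ 1 := by
        calc _ ≤ Real.exp (-c) * (∑ y : Y, Real.exp (s ^ 2 * L ^ 2 / (2 * N))) :=
              mul_le_mul_of_nonneg_left (sum_le_sum fun y _ => hsum' y) (Real.exp_pos _).le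
          _ = 1 := by
              rw [sum_const, card_univ, nsmul_eq_mul, hc, neg_add, Real.exp_add, Real.exp_neg,
                Real.exp_neg, Real.exp_log hcard]
              have := (Real.exp_pos (s ^ 2 * L ^ 2 / (2 * N))).ne'
              field_simp
      have : 0 < s⁻¹ := by positivity
      nlinarith
    _ = _ := by rw [hc]; field_simp; ring

end Deviation

/-! ### Invariants of the schedule -/

section Schedule

/-- The invariants of the schedule with exponent `a`. -/
structure SchedSpec (a : ℝ) (s : ℕ) (τ : Sched) : Prop where
  time : τ.time = s
  pool_pos : 1 ≤ τ.pool
  lt_pool : s < 2 * τ.pool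
  rate : τ.rate = (τ.pool : ℝ) ^ a
  rate_le : τ.rate ≤ τ.block
  block_le : (τ.block : ℝ) ≤ 2 * τ.rate
  block_pos : 1 ≤ τ.block
  block_le_pool : τ.block ≤ τ.pool
  pos_lt : τ.pos < τ.block
  pos_le : τ.pos ≤ s
  pool_le : τ.pool + τ.pos ≤ max s 1
  dvd_pool : τ.block ∣ τ.pool
  dvd_start : τ.block ∣ s - τ.pos

variable {a : ℝ}

/-- The block length always divides the pool size and the starting time of the block, so a doubling
of the pool never interrupts a block. The alternative in the conclusion records this: a round either
continues its block with unchanged parameters or completes it. -/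
lemma schedSpec_next (ha : 0 ≤ a) (ha1 : a ≤ 1) {s : ℕ} {τ : Sched} (h : SchedSpec a s τ) :
    SchedSpec a (s + 1) (τ.next (2 ^ a)) ∧
      ((τ.pos + 1 < τ.block ∧ (τ.next (2 ^ a)).pos = τ.pos + 1 ∧
          (τ.next (2 ^ a)).pool = τ.pool ∧ (τ.next (2 ^ a)).block = τ.block) ∨
        (τ.pos + 1 = τ.block ∧ (τ.next (2 ^ a)).pos = 0)) := by
  obtain ⟨h1, h2, h3, h4, h5, h6, h7, h8, h9, h10, h11, h12, h13⟩ := h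
  by_cases hc : τ.time + 1 < τ.pool + τ.pool
  · by_cases hp : τ.pos + 1 < τ.block
    · have e : τ.next (2 ^ a) = ⟨τ.time + 1, τ.pool, τ.rate, τ.block, τ.pos + 1⟩ := by
        simp [Sched.next, hc, hp]
      rw [e]
      refine ⟨⟨by simp [h1], h2, by simp only; omega, h4, h5, h6, h7, h8, hp, by simp only; omega,
        ?_, h12, ?_⟩, Or.inl ⟨hp, rfl, rfl, rfl⟩⟩
      · simp only; omega
      · simp only
        rwa [show s + 1 - (τ.pos + 1) = s - τ.pos by omega]
    · have e : τ.next (2 ^ a) = ⟨τ.time + 1, τ.pool, τ.rate, τ.block, 0⟩ := by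
        simp [Sched.next, hc, hp]
      have hb : τ.pos + 1 = τ.block := by omega
      rw [e]
      refine ⟨⟨by simp [h1], h2, by simp only; omega, h4, h5, h6, h7, h8, h7, by simp,
        ?_, h12, ?_⟩, Or.inr ⟨hb, rfl⟩⟩
      · simp only; omega
      · simp only
        rw [show s + 1 - 0 = (s - τ.pos) + τ.block by omega]
        exact (Nat.dvd_add_self_right).2 h13
  -- The pool doubles exactly at time 2·pool, a multiple of the block length. The block begun at s −
  -- pos therefore ends there too.
  · have hs2 : s + 1 = 2 * τ.pool := by omega
    have hb : τ.pos + 1 = τ.block := by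
      have hd : τ.block ∣ τ.pos + 1 := by
        have hd2 : τ.block ∣ s + 1 := hs2 ▸ h12.mul_left 2
        have : s + 1 = (s - τ.pos) + (τ.pos + 1) := by omega
        rw [this] at hd2
        exact (Nat.dvd_add_right h13).1 hd2
      have := Nat.le_of_dvd (by omega) hd
      omega
    -- The rate grows by a factor between 1 and 2, so at most one doubling of the block restores
    -- rate ≤ block ≤ 2·rate.
    have hβ : (2 : ℝ) ^ a ≤ 2 := by
      calc (2 : ℝ) ^ a ≤ 2 ^ (1 : ℝ) := Real.rpow_le_rpow_of_exponent_le (by norm_num) ha1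
        _ = 2 := by simp
    have hβ1 : (1 : ℝ) ≤ 2 ^ a := Real.one_le_rpow (by norm_num) ha
    have hr0 : 0 < τ.rate := by
      rw [h4]; exact Real.rpow_pos_of_pos (by exact_mod_cast h2) _
    have hrate : τ.rate * 2 ^ a = ((τ.pool + τ.pool : ℕ) : ℝ) ^ a := by
      rw [h4, ← Real.mul_rpow (by positivity) (by norm_num)]; push_cast; ring_nf
    refine ⟨?_, Or.inr ⟨hb, by simp [Sched.next, hc]⟩⟩
    by_cases hB : (τ.block : ℝ) < τ.rate * 2 ^ a
    · have e : τ.next (2 ^ a)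
          = ⟨τ.time + 1, τ.pool + τ.pool, τ.rate * 2 ^ a, τ.block + τ.block, 0⟩ := by
        simp [Sched.next, hc, hB]
      rw [e]
      refine ⟨by simp [h1], by simp only; omega, by simp only; omega, hrate, ?_, ?_,
        by simp only; omega, by simp only; omega, by simp only; omega, by simp,
        by simp only; omega, ?_, ?_⟩
      · simp only; push_cast; nlinarith
      · simp only; push_cast; linarith
      · simp only; rw [← two_mul, ← two_mul]; exact Nat.mul_dvd_mul_left 2 h12
      · simp only; rw [← two_mul, show s + 1 - 0 = 2 * τ.pool by omega]
        exact Nat.mul_dvd_mul_left 2 h12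
    · have e : τ.next (2 ^ a)
          = ⟨τ.time + 1, τ.pool + τ.pool, τ.rate * 2 ^ a, τ.block, 0⟩ := by
        simp [Sched.next, hc, hB]
      rw [e]
      refine ⟨by simp [h1], by simp only; omega, by simp only; omega, hrate, not_lt.1 hB, ?_,
        h7, by simp only; omega, h7, by simp,
        by simp only; omega, (Nat.dvd_add_right h12).2 h12, ?_⟩
      · simp only; nlinarith
      · simp only; rw [show s + 1 - 0 = 2 * τ.pool by omega]
        exact h12.mul_left 2

lemma schedSpec (ha : 0 ≤ a) (ha1 : a ≤ 1) (s : ℕ) : SchedSpec a s (sched (2 ^ a) s) := by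
  induction s with
  | zero => constructor <;> simp [sched]
  | succ s ih => exact (schedSpec_next ha ha1 ih).1

lemma sched_succ (ha : 0 ≤ a) (ha1 : a ≤ 1) (s : ℕ) :
    ((sched (2 ^ a) s).pos + 1 < (sched (2 ^ a) s).block ∧
        (sched (2 ^ a) (s + 1)).pos = (sched (2 ^ a) s).pos + 1 ∧
        (sched (2 ^ a) (s + 1)).pool = (sched (2 ^ a) s).pool ∧
        (sched (2 ^ a) (s + 1)).block = (sched (2 ^ a) s).block) ∨
      ((sched (2 ^ a) s).pos + 1 = (sched (2 ^ a) s).block ∧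
        (sched (2 ^ a) (s + 1)).pos = 0) :=
  (schedSpec_next ha ha1 (schedSpec ha ha1 s)).2

end Schedule

/-! ### Potential functions for the game -/

section Game

variable {X : Type u} {ℓ : ℝ → ℝ → ℝ} {H : Set (X → I)} {L : ℝ}

lemma upperExp_le {Ω : Type*} [MeasurableSpace Ω] {ν : Measure Ω} {f : Ω → EReal} {g : Ω → ℝ}
    (hg : Integrable g ν) (h : ∀ ω, f ω ≤ (g ω : EReal)) :
    upperExp ν f ≤ ((∫ ω, g ω ∂ν : ℝ) : EReal) :=
  iInf₂_le g ⟨hg, h⟩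

/-- The sequence `ω` with its first entries replaced by those of `l`. -/
def splice (l : List X) (ω : ℕ → X) : ℕ → X := fun n => l.getD n (ω n)

lemma splice_nil (ω : ℕ → X) : splice [] ω = ω := by ext; simp [splice]

/-- Revealing the next feature amounts to resampling one coordinate of ω, an operation that
preserves `featureLaw`. -/
lemma splice_snoc (l : List X) (x : X) (ω : ℕ → X) :
    splice (l ++ [x]) ω = splice l (Function.update ω l.length x) := by
  ext n
  simp only [splice, List.getD_eq_getElem?_getD]
  rcases lt_trichotomy n l.length with h | rfl | h
  · simp [h, List.getElem?_append_left]
  · simp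
  · rw [List.getElem?_eq_none (by simp; omega), List.getElem?_eq_none (by omega)]
    simp [Function.update_of_ne (ne_of_gt h)]

variable [MeasurableSpace X]

lemma measurable_splice (l : List X) : Measurable (splice l) := by
  refine measurable_pi_lambda _ fun n => ?_
  by_cases h : n < l.length
  · simp only [splice, List.getD_eq_getElem _ _ h]; exact measurable_const
  · simp only [splice, List.getD_eq_default _ _ (not_lt.1 h)]; exact measurable_pi_apply n

/-- Bound on the value of the game from a relaxation whose increments are dominated by functions of
the features alone. -/
lemma gameValue_le_of_step {Φ : PredictionRule X} (μ : Measure X) [IsProbabilityMeasure μ]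
    {T : ℕ} (R : List (X × I) → ℝ) (cost : ℕ → (ℕ → X) → ℝ) {C : ℕ → ℝ}
    (hcm : ∀ s, Measurable (cost s)) (hcb : ∀ s ω, |cost s ω| ≤ C s)
    (hint : ∀ (hist : List (X × I)) x (y : I), Integrable (fun z : I => ℓ z y)
      (Φ hist x : Measure I))
    (hterm : ∀ hist : List (X × I), hist.length = T →
      -(⨅ h : H, (hist.map fun p => ℓ (h.1 p.1) p.2).sum) ≤ R hist)
    (hstep : ∀ hist : List (X × I), hist.length < T → ∃ f : X → ℝ, Integrable f μ ∧
      (∀ (x : X) (y : I), ∫ z, ℓ z y ∂(Φ hist x : Measure I) + R (hist ++ [(x, y)]) ≤ f x) ∧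
      ∀ ω, ∫ x, f x ∂μ ≤ R hist + cost hist.length (splice (hist.map Prod.fst) ω)) :
    gameValue ℓ H Φ μ T [] 0
      ≤ ((R [] + ∑ s ∈ range T, ∫ ω, cost s ω ∂(featureLaw μ) : ℝ) : EReal) := by
  have hci : ∀ s l, Integrable (fun ω => cost s (splice l ω)) (featureLaw μ) := fun s l =>
    Integrable.of_bound ((hcm s).comp (measurable_splice l)).aestronglyMeasurable (C s)
      (Filter.Eventually.of_forall fun ω => hcb s _)
  -- Backward induction: the past features are frozen in the first coordinates, and the future ones
  -- are supplied by ω. The bound does not involve future labels.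
  suffices key : ∀ n (hist : List (X × I)) (s : ℝ), hist.length + n = T →
      gameValue ℓ H Φ μ n hist s ≤ ((s + R hist + ∫ ω, ∑ u ∈ Ico hist.length T,
        cost u (splice (hist.map Prod.fst) ω) ∂(featureLaw μ) : ℝ) : EReal) by
    refine (key T [] 0 (by simp)).trans (le_of_eq ?_)
    simp only [List.map_nil, splice_nil, List.length_nil, zero_add, ← range_eq_Ico]
    rw [integral_finsetSum _ fun s _ => by simpa [splice_nil] using hci s []]
  intro n
  induction n with
  | zero =>
    intro hist s hT
    simp only [add_zero] at hT
    simp only [gameValue, ← hT, Ico_self, sum_empty, integral_zero, add_zero]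
    exact_mod_cast (by linarith [hterm hist hT])
  | succ n ih =>
    intro hist s hT
    obtain ⟨f, hf, hfx, hfω⟩ := hstep hist (by omega)
    set F : (ℕ → X) → ℝ := fun ω => ∑ u ∈ Ico (hist.length + 1) T,
      cost u (splice (hist.map Prod.fst) ω) with hF
    have hFi : Integrable F (featureLaw μ) := integrable_finsetSum _ fun u _ => hci u _
    have hGi : Integrable (fun x => ∫ ω, F (Function.update ω hist.length x) ∂(featureLaw μ)) μ :=
      ((measurePreserving_update μ
        hist.length).integrable_comp_of_integrable hFi).integral_prod_right
    have hmaj : ∀ x, (⨆ y : I, upperExp (Φ hist x : Measure I) fun z =>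
        gameValue ℓ H Φ μ n (hist ++ [(x, y)]) (s + ℓ z y))
        ≤ ((s + f x + ∫ ω, F (Function.update ω hist.length x) ∂(featureLaw μ) : ℝ) : EReal) := by
      intro x
      refine iSup_le fun y => ?_
      have hFx : ∫ ω, ∑ u ∈ Ico (hist ++ [(x, y)]).length T,
          cost u (splice ((hist ++ [(x, y)]).map Prod.fst) ω) ∂(featureLaw μ)
          = ∫ ω, F (Function.update ω hist.length x) ∂(featureLaw μ) := by
        simp [hF, splice_snoc]
      have h1 : ∀ z : I, gameValue ℓ H Φ μ n (hist ++ [(x, y)]) (s + ℓ z y)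
          ≤ ((ℓ z y + (s + R (hist ++ [(x, y)])
            + ∫ ω, F (Function.update ω hist.length x) ∂(featureLaw μ)) : ℝ) : EReal) := by
        intro z
        refine (ih (hist ++ [(x, y)]) (s + ℓ z y) (by simp; omega)).trans (le_of_eq ?_)
        rw [hFx]; congr 1; ring
      refine (upperExp_le ((hint hist x y).add (integrable_const _)) h1).trans ?_
      have h2 := hfx x y
      rw [EReal.coe_le_coe_iff, integral_add' (hint hist x y) (integrable_const _), integral_const]
      simp only [probReal_univ, one_smul]
      linarith
    rw [gameValue]
    refine (upperExp_le (((integrable_const s).add hf).add hGi) hmaj).trans ?_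
    rw [EReal.coe_le_coe_iff, integral_add' ((integrable_const s).add hf) hGi,
      integral_add' (integrable_const s) hf, integral_update μ _ hFi]
    -- The bound on the increment holds for every continuation ω, hence also after averaging over ω.
    have h3 : ∫ x, f x ∂μ
        ≤ R hist + ∫ ω, cost hist.length (splice (hist.map Prod.fst) ω) ∂(featureLaw μ) := by
      have := integral_mono (μ := featureLaw μ) (integrable_const (∫ x, f x ∂μ))
        ((integrable_const (R hist)).add (hci hist.length (hist.map Prod.fst))) hfω
      rw [integral_add' (integrable_const _) (hci _ _)] at this
      simpa using this
    have h4 : ∫ ω, ∑ u ∈ Ico hist.length T, cost u (splice (hist.map Prod.fst) ω) ∂(featureLaw μ)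
        = ∫ ω, cost hist.length (splice (hist.map Prod.fst) ω) ∂(featureLaw μ)
          + ∫ ω, F ω ∂(featureLaw μ) := by
      rw [← integral_add (hci _ _) hFi]
      congr 1; ext ω
      rw [sum_eq_sum_Ico_succ_bot (by omega : hist.length < T)]
    rw [h4]
    simp only [integral_const, probReal_univ, one_smul]
    linarith

end Game

/-! ### The law of the predictions -/

section Rule

variable {X : Type u} {ℓ : ℝ → ℝ → ℝ} {H : Set (X → I)} {L β : ℝ}

lemma IsConvexLipschitzLoss.continuous_left (hl : IsConvexLipschitzLoss L ℓ) (y : I) :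
    Continuous fun z : I => ℓ z y := by
  refine (LipschitzWith.of_dist_le_mul (K := L.toNNReal) fun a b => ?_).continuous
  rw [Real.dist_eq, Subtype.dist_eq, Real.dist_eq]
  refine (hl.lipschitz_left a b y).trans ?_
  exact mul_le_mul_of_nonneg_right (Real.le_coe_toNNReal L) (abs_nonneg _)

lemma IsConvexLipschitzLoss.integrable_left (hl : IsConvexLipschitzLoss L ℓ) (ν : Measure I)
    [IsFiniteMeasure ν] (y : I) : Integrable (fun z : I => ℓ z y) ν := by
  obtain ⟨C, hC⟩ := isCompact_univ.exists_bound_of_continuousOn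
    (hl.continuous_left y).continuousOn
  exact Integrable.of_bound (hl.continuous_left y).measurable.aestronglyMeasurable C
    (Filter.Eventually.of_forall fun z => hC z (Set.mem_univ z))

lemma integral_uniform_map {α : Type*} [Fintype α] [Nonempty α] (F : α → I) {f : I → ℝ}
    (hf : Continuous f) :
    ∫ z, f z ∂((PMF.uniformOfFintype α).map F).toMeasure = 𝔼 a, f (F a) := by
  let : MeasurableSpace α := ⊤
  have : MeasurableSingletonClass α := ⟨fun _ => trivial⟩
  have hF : Measurable F := fun _ _ => trivial
  rw [← PMF.toMeasure_map _ _ hF, integral_map hF.aemeasurable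
    hf.measurable.aestronglyMeasurable, PMF.integral_eq_sum, Fintype.expect_eq_sum_div_card,
    Finset.sum_div]
  refine sum_congr rfl fun a _ => ?_
  simp [div_eq_inv_mul]

lemma IsConvexLipschitzLoss.integral_rule (hl : IsConvexLipschitzLoss L ℓ) (hL : 0 ≤ L)
    (hist : List (X × I)) (x : X) (y : I) {N m : ℕ} (hN : (sched β hist.length).pool = N)
    (hN1 : 1 ≤ N) (hm : (sched β hist.length).block - (sched β hist.length).pos - 1 = m)
    (hpos : (sched β hist.length).pos ≤ hist.length) :
    ∫ z, ℓ z y ∂((program β L).rule ℓ H hist x : Measure I)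
      = 𝔼 w : Fin m → ℤˣ × Fin N, ℓ (clamp (predict ℓ H L
          (hist.drop (hist.length - (sched β hist.length).pos))
          (hallucination (poolOf hist x N) w) x)) y := by
  obtain ⟨K, rfl⟩ : ∃ K, N = K + 1 := ⟨N - 1, by omega⟩
  obtain ⟨F, hF, hF'⟩ := run_program (ℓ := ℓ) (H := H) hL hist x hN hm hpos
  have e : ((program β L).rule ℓ H hist x : Measure I)
      = ((PMF.uniformOfFintype _).map fun w => clamp ((F w).real 0)).toMeasure := by
    simp only [Prog.rule, ProbabilityMeasure.coe_mk]
    rw [hF, PMF.map_comp]; rfl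
  rw [e, integral_uniform_map _ (hl.continuous_left y)]
  exact expect_congr rfl fun w _ => by rw [(hF' w).1]

end Rule

/-! ### The potential -/

section Potential

variable {X : Type u} {ℓ : ℝ → ℝ → ℝ} {H : Set (X → I)} {L a : ℝ}

/-- The part of the history that belongs to the current block. -/
noncomputable def blockOf (a : ℝ) (hist : List (X × I)) : List (X × I) :=
  hist.drop (hist.length - (sched (2 ^ a) hist.length).pos)

/-- Minus the sum of the smallest losses on the completed blocks. -/
noncomputable def closedValue (ℓ : ℝ → ℝ → ℝ) (H : Set (X → I)) (L a : ℝ)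
    (hist : List (X × I)) : ℝ :=
  ∑ s ∈ range hist.length, if (sched (2 ^ a) (s + 1)).pos = 0 then
    -mixedERM ℓ H ((hist.take (s + 1)).drop (s - (sched (2 ^ a) s).pos)) L [] else 0

/-- The potential of a history: completed blocks contribute minus their smallest loss, the current
block contributes its relaxation. -/
noncomputable def potential (ℓ : ℝ → ℝ → ℝ) (H : Set (X → I)) (L a : ℝ) (x₀ : X)
    (hist : List (X × I)) : ℝ :=
  closedValue ℓ H L a hist + if (sched (2 ^ a) hist.length).pos = 0 then 0 else
    relax ℓ H L (blockOf a hist) (poolOf hist x₀ (sched (2 ^ a) hist.length).pool)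
      ((sched (2 ^ a) hist.length).block - (sched (2 ^ a) hist.length).pos)

lemma blockOf_of_pos_eq_zero {hist : List (X × I)} (h : (sched (2 ^ a) hist.length).pos = 0) :
    blockOf a hist = [] := by simp [blockOf, h]

lemma blockOf_snoc {hist : List (X × I)} {p : X × I}
    (h : (sched (2 ^ a) (hist.length + 1)).pos = (sched (2 ^ a) hist.length).pos + 1) :
    blockOf a (hist ++ [p]) = blockOf a hist ++ [p] := by
  simp only [blockOf, List.length_append, List.length_singleton, h, Nat.add_sub_add_right]
  exact List.drop_append_of_le_length (Nat.sub_le _ _)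

lemma closedValue_snoc (hist : List (X × I)) (p : X × I) :
    closedValue ℓ H L a (hist ++ [p]) = closedValue ℓ H L a hist +
      if (sched (2 ^ a) (hist.length + 1)).pos = 0 then
        -mixedERM ℓ H (blockOf a hist ++ [p]) L [] else 0 := by
  simp only [closedValue, List.length_append, List.length_singleton, sum_range_succ]
  congr 1
  · refine sum_congr rfl fun s hs => ?_
    rw [List.take_append_of_le_length (by simpa using hs)]
  · rw [List.take_of_length_le (by simp), List.drop_append_of_le_length (Nat.sub_le _ _)]
    rfl

/-- On each completed block a fixed hypothesis loses at least the minimum of that block. The oracle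
with an empty signed sample supplies these minima. -/
lemma IsConvexLipschitzLoss.lossSum_ge (hl : IsConvexLipschitzLoss L ℓ) (hL : 0 ≤ L)
    (ha : 0 ≤ a) (ha1 : a ≤ 1) {h : X → I} (hh : h ∈ H) (hist : List (X × I)) :
    -closedValue ℓ H L a hist + lossSum ℓ h (blockOf a hist) ≤ lossSum ℓ h hist := by
  induction hist using List.reverseRecOn with
  | nil => simp [closedValue, blockOf, lossSum]
  | append_singleton hist p ih =>
    rw [closedValue_snoc, lossSum_append _ hist]
    rcases sched_succ ha ha1 hist.length with ⟨_, h2, -⟩ | ⟨_, h2⟩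
    · rw [blockOf_snoc h2, lossSum_append, if_neg (by omega)]
      linarith
    · rw [blockOf_of_pos_eq_zero (hist := hist ++ [p]) (by simpa using h2), if_pos h2, lossSum_nil]
      have := hl.mixedERM_le hL hh (blockOf a hist ++ [p]) []
      rw [lossSum_append, signSum_nil] at this
      linarith

lemma IsConvexLipschitzLoss.neg_le_potential (hl : IsConvexLipschitzLoss L ℓ) (hL : 0 ≤ L)
    (hH : H.Nonempty) (ha : 0 ≤ a) (ha1 : a ≤ 1) (x₀ : X) (hist : List (X × I)) :
    -(⨅ h : H, (hist.map fun p => ℓ (h.1 p.1) p.2).sum) ≤ potential ℓ H L a x₀ hist := by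
  have := hH.to_subtype
  rw [neg_le]
  refine le_ciInf fun h => ?_
  change _ ≤ lossSum ℓ h.1 hist
  have h1 := hl.lossSum_ge hL ha ha1 h.2 hist
  unfold potential
  split_ifs with h0
  · rw [blockOf_of_pos_eq_zero h0, lossSum_nil] at h1; linarith
  · have : NeZero (sched (2 ^ a) hist.length).pool :=
      ⟨by have := (schedSpec ha ha1 hist.length).pool_pos; omega⟩
    have h2 := hl.neg_mixedERM_le_relax hL hH (blockOf a hist)
      (poolOf hist x₀ (sched (2 ^ a) hist.length).pool)
      ((sched (2 ^ a) hist.length).block - (sched (2 ^ a) hist.length).pos)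
    have h3 := hl.mixedERM_le hL h.2 (blockOf a hist) []
    rw [signSum_nil] at h3
    linarith

/-- Once all pool features lie in the past the pool is frozen, and the default value of `feature` is
never consulted. -/
lemma poolOf_eq {hist : List (X × I)} {N : ℕ} (hN : N ≤ hist.length) (x x' : X)
    (l : List (X × I)) : poolOf (hist ++ l) x N = poolOf hist x' N := by
  ext i
  have hi : (i : ℕ) < hist.length := i.2.trans_le hN
  simp [poolOf, feature, hi, List.getElem?_append_left, List.getD_eq_getElem?_getD]

/-- While the block continues, the new pair joins the sample in exchange for one hallucination. When
it ends, the relaxation is traded for the true minimum of the block by `neg_mixedERM_le_relax`. -/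
lemma IsConvexLipschitzLoss.predict_add_potential_le (hl : IsConvexLipschitzLoss L ℓ)
    (hL : 0 ≤ L) (hH : H.Nonempty) (ha : 0 ≤ a) (ha1 : a ≤ 1) (x₀ : X) (hist : List (X × I))
    (x : X) (y : I) :
    (𝔼 w : Fin ((sched (2 ^ a) hist.length).block - (sched (2 ^ a) hist.length).pos - 1)
        → ℤˣ × Fin (sched (2 ^ a) hist.length).pool, ℓ (clamp (predict ℓ H L (blockOf a hist)
          (hallucination (poolOf hist x (sched (2 ^ a) hist.length).pool) w) x)) y)
      + potential ℓ H L a x₀ (hist ++ [(x, y)])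
      ≤ closedValue ℓ H L a hist + relaxAt ℓ H L (blockOf a hist)
        (poolOf hist x (sched (2 ^ a) hist.length).pool)
        ((sched (2 ^ a) hist.length).block - (sched (2 ^ a) hist.length).pos - 1) x := by
  have hs := schedSpec ha ha1 hist.length
  have : NeZero (sched (2 ^ a) hist.length).pool := ⟨by have := hs.pool_pos; omega⟩
  have key := hl.expect_predict_add_relax_le hL hH (blockOf a hist)
    (poolOf hist x (sched (2 ^ a) hist.length).pool)
    ((sched (2 ^ a) hist.length).block - (sched (2 ^ a) hist.length).pos - 1) x y
  suffices h : potential ℓ H L a x₀ (hist ++ [(x, y)]) ≤ closedValue ℓ H L a hist +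
      relax ℓ H L (blockOf a hist ++ [(x, y)]) (poolOf hist x (sched (2 ^ a) hist.length).pool)
        ((sched (2 ^ a) hist.length).block - (sched (2 ^ a) hist.length).pos - 1) by linarith
  have hlen : (hist ++ [(x, y)]).length = hist.length + 1 := by simp
  rw [potential, closedValue_snoc, hlen]
  rcases sched_succ ha ha1 hist.length with ⟨h1, h2, h3, h4⟩ | ⟨h1, h2⟩
  · have hN : (sched (2 ^ a) hist.length).pool ≤ hist.length := by
      have h5 := hs.pool_le
      have h6 := hs.block_le_pool
      omega
    rw [if_neg (by omega), if_neg (by omega), blockOf_snoc h2, h2, h3, h4, poolOf_eq hN x₀ x,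
      Nat.sub_sub]
    linarith
  · rw [if_pos h2, if_pos h2]
    have := hl.neg_mixedERM_le_relax hL hH (blockOf a hist ++ [(x, y)])
      (poolOf hist x (sched (2 ^ a) hist.length).pool)
      ((sched (2 ^ a) hist.length).block - (sched (2 ^ a) hist.length).pos - 1)
    linarith

end Potential

/-! ### The deviation terms -/

section DeviationTerm

variable {X : Type u} {ℓ : ℝ → ℝ → ℝ} {H : Set (X → I)} {L : ℝ}

/-- A label of the grid with mesh `1 / N`. -/
noncomputable def gridLabel (N : ℕ) (g : Fin (N + 1)) : I :=
  ⟨(g : ℝ) / N, by positivity,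
    div_le_one_of_le₀ (by exact_mod_cast Nat.lt_succ_iff.1 g.2) (by positivity)⟩

lemma exists_gridLabel {N : ℕ} (hN : 1 ≤ N) (y : I) :
    ∃ g : Fin (N + 1), |(y : ℝ) - gridLabel N g| ≤ 1 / N := by
  have hN' : (0 : ℝ) < N := by exact_mod_cast hN
  have hy : 0 ≤ (y : ℝ) * N := mul_nonneg y.2.1 hN'.le
  have h1 := Nat.floor_le hy
  have h2 := Nat.lt_floor_add_one ((y : ℝ) * N)
  have h3 : ⌊(y : ℝ) * N⌋₊ < N + 1 := by
    rw [Nat.lt_succ_iff]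
    exact Nat.floor_le_of_le (by nlinarith [y.2.2])
  refine ⟨⟨_, h3⟩, ?_⟩
  simp only [gridLabel]
  rw [abs_le]
  constructor
  · have : (⌊(y : ℝ) * N⌋₊ : ℝ) / N ≤ y := by rwa [div_le_iff₀ hN']
    have : (0 : ℝ) ≤ 1 / N := by positivity
    linarith
  · rw [sub_le_iff_le_add, ← add_div, le_div_iff₀ hN']; linarith

/-- The labelled sample formed by the features `ω b, ω (b + 1), …` with the labels `y`. -/
def sampleAt (b : ℕ) (ω : ℕ → X) {r : ℕ} (y : Fin r → I) : List (X × I) :=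
  List.ofFn fun i => (ω (b + i), y i)

/-- The summand of `relaxAt`. -/
noncomputable def relaxTerm (ℓ : ℝ → ℝ → ℝ) (H : Set (X → I)) (L : ℝ) (b N : ℕ) {r m : ℕ}
    (y : Fin r → I) (w : Fin m → ℤˣ × Fin N) (x : X) (ω : ℕ → X) : ℝ :=
  (-mixedERM ℓ H (sampleAt b ω y) L ((1, x) :: hallucination (fun i : Fin N => ω i) w)
    - mixedERM ℓ H (sampleAt b ω y) L ((-1, x) :: hallucination (fun i : Fin N => ω i) w)) / 2

lemma relaxAt_eq (b N : ℕ) {r : ℕ} (m : ℕ) (y : Fin r → I) (x : X) (ω : ℕ → X) :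
    relaxAt ℓ H L (sampleAt b ω y) (fun i : Fin N => ω i) m x
      = 𝔼 w : Fin m → ℤˣ × Fin N, relaxTerm ℓ H L b N y w x ω := rfl

/-- With labels, signs and indices fixed, the term is a combination of two oracle values at
coordinates of (x, ω). All measurability used later comes from here. -/
lemma MeasurableERM.measurable_relaxTerm [MeasurableSpace X] (hM : MeasurableERM ℓ H)
    (hL : 0 ≤ L) (b N : ℕ) {r m : ℕ} (y : Fin r → I) (w : Fin m → ℤˣ × Fin N) :
    Measurable (Function.uncurry (relaxTerm ℓ H L b N y w)) := by
  have key : ∀ e : ℤˣ, Measurable fun p : X × (ℕ → X) => mixedERM ℓ H (sampleAt b p.2 y) L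
      ((e, p.1) :: hallucination (fun i : Fin N => p.2 i) w) := by
    intro e
    have hm : Measurable fun p : X × (ℕ → X) => ((fun i : Fin r => p.2 (b + i)),
        (Fin.cons p.1 fun j => p.2 (w j).2 : Fin (m + 1) → X)) := by
      refine Measurable.prodMk ?_ ?_
      · exact measurable_pi_lambda _ fun i => (measurable_pi_apply _).comp measurable_snd
      · refine measurable_pi_lambda _ fun j => ?_
        refine Fin.cases ?_ (fun j => ?_) j
        · simpa using measurable_fst
        · simp only [Fin.cons_succ]
          exact (measurable_pi_apply _).comp measurable_snd
    have := (hM r (m + 1) y L (Fin.cons e fun j => (w j).1) hL).comp hm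
    convert this using 1
    ext p
    simp [sampleAt, hallucination, List.ofFn_succ]
  exact (((key 1).neg.sub (key (-1))).div_const 2)

lemma IsConvexLipschitzLoss.relaxTerm_sub_le (hl : IsConvexLipschitzLoss L ℓ) (hL : 0 ≤ L)
    (hH : H.Nonempty) (b N : ℕ) {r m : ℕ} (y : Fin r → I) (w : Fin m → ℤˣ × Fin N) (x x' : X)
    (ω : ℕ → X) : relaxTerm ℓ H L b N y w x ω - relaxTerm ℓ H L b N y w x' ω ≤ L := by
  have key : ∀ e : ℤˣ, mixedERM ℓ H (sampleAt b ω y) L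
        ((e, x') :: hallucination (fun i : Fin N => ω i) w)
      ≤ mixedERM ℓ H (sampleAt b ω y) L
        ((e, x) :: hallucination (fun i : Fin N => ω i) w) + L := by
    intro e
    refine hl.mixedERM_le_add hH hL fun h _ => ?_
    rw [signSum_cons, signSum_cons]
    have h1 : |((e : ℤ) : ℝ) * ((h x' : ℝ) - h x)| ≤ 1 := by
      rw [abs_mul, abs_sign, one_mul, abs_le]
      have := (h x).2; have := (h x').2
      simp only [Set.mem_Icc] at *
      constructor <;> linarith
    nlinarith [(abs_le.1 h1).2]
  have h1 := key 1
  have h2 := key (-1)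
  unfold relaxTerm
  linarith

lemma IsConvexLipschitzLoss.abs_relaxTerm_le (hl : IsConvexLipschitzLoss L ℓ) (hL : 0 ≤ L)
    (hH : H.Nonempty) (b N : ℕ) {r m : ℕ} (y : Fin r → I) (w : Fin m → ℤˣ × Fin N) (x : X)
    (ω : ℕ → X) :
    |relaxTerm ℓ H L b N y w x ω| ≤ (ℓ 0 0 + 2 * L) * r + L * (m + 1) := by
  have key : ∀ e : ℤˣ, |mixedERM ℓ H (sampleAt b ω y) L
      ((e, x) :: hallucination (fun i : Fin N => ω i) w)| ≤ (ℓ 0 0 + 2 * L) * r + L * (m + 1) := by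
    intro e
    have := hl.abs_mixedERM_le hL hH (sampleAt b ω y)
      ((e, x) :: hallucination (fun i : Fin N => ω i) w)
    simpa [sampleAt, hallucination] using this
  have h1 := abs_le.1 (key 1)
  have h2 := abs_le.1 (key (-1))
  unfold relaxTerm
  rw [abs_le]
  constructor <;> linarith

/-- The block starts at b ≥ N, so coordinate i can enter only through the draw, which avoids it.
This is the independence behind the concentration. -/
lemma relaxTerm_update {b N : ℕ} (hb : N ≤ b) {r m : ℕ} (y : Fin r → I)
    (w : Fin m → ℤˣ × Fin N) (i : Fin N) (hi : ∀ j, (w j).2 ≠ i) (x : X) (ω : ℕ → X) (v : X) :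
    relaxTerm ℓ H L b N y w x (Function.update ω i v) = relaxTerm ℓ H L b N y w x ω := by
  have h1 : sampleAt b (Function.update ω i v) y = sampleAt b ω y := by
    unfold sampleAt
    congr 1; ext1 j
    rw [Function.update_of_ne (by have := i.2; omega)]
  have h2 : hallucination (fun k : Fin N => Function.update ω (i : ℕ) v k) w
      = hallucination (fun k : Fin N => ω k) w := by
    unfold hallucination
    congr 1; ext1 j
    simp only
    rw [Function.update_of_ne (fun h => hi j (Fin.ext h))]
  unfold relaxTerm
  rw [h1, h2]

variable [MeasurableSpace X] (μ : Measure X) [IsProbabilityMeasure μ]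

/-- The deviation of the pool average of the relaxation from its expectation. -/
noncomputable def deviation (ℓ : ℝ → ℝ → ℝ) (H : Set (X → I)) (L : ℝ) (b N : ℕ) {r : ℕ} (m : ℕ)
    (y : Fin r → I) (ω : ℕ → X) : ℝ :=
  ∫ x, relaxAt ℓ H L (sampleAt b ω y) (fun i : Fin N => ω i) m x ∂μ
    - 𝔼 i : Fin N, relaxAt ℓ H L (sampleAt b ω y) (fun i : Fin N => ω i) m (ω i)

/-- The largest deviation over all labels of the grid, plus the error of rounding. -/
noncomputable def deviationSup (ℓ : ℝ → ℝ → ℝ) (H : Set (X → I)) (L : ℝ) (b N r m : ℕ)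
    (ω : ℕ → X) : ℝ :=
  univ.sup' univ_nonempty (fun y : Fin r → Fin (N + 1) =>
    deviation μ ℓ H L b N m (fun i => gridLabel N (y i)) ω) + 2 * L * r / N

lemma IsConvexLipschitzLoss.integrable_relaxTerm (hl : IsConvexLipschitzLoss L ℓ) (hL : 0 ≤ L)
    (hH : H.Nonempty) (hM : MeasurableERM ℓ H) (b N : ℕ) {r m : ℕ} (y : Fin r → I)
    (w : Fin m → ℤˣ × Fin N) (ω : ℕ → X) :
    Integrable (fun x => relaxTerm ℓ H L b N y w x ω) μ :=
  Integrable.of_bound ((hM.measurable_relaxTerm hL b N y w).comp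
    (measurable_id.prodMk measurable_const)).aestronglyMeasurable _
    (Filter.Eventually.of_forall fun x => hl.abs_relaxTerm_le hL hH b N y w x ω)

lemma IsConvexLipschitzLoss.integrable_relaxAt (hl : IsConvexLipschitzLoss L ℓ) (hL : 0 ≤ L)
    (hH : H.Nonempty) (hM : MeasurableERM ℓ H) (b N : ℕ) {r : ℕ} (m : ℕ) (y : Fin r → I)
    (ω : ℕ → X) :
    Integrable (fun x => relaxAt ℓ H L (sampleAt b ω y) (fun i : Fin N => ω i) m x) μ := by
  simp only [relaxAt_eq, Fintype.expect_eq_sum_div_card]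
  exact (integrable_finsetSum _ fun w _ =>
    hl.integrable_relaxTerm μ hL hH hM b N y w ω).div_const _

lemma IsConvexLipschitzLoss.deviation_eq (hl : IsConvexLipschitzLoss L ℓ) (hL : 0 ≤ L)
    (hH : H.Nonempty) (hM : MeasurableERM ℓ H) (b N : ℕ) {r : ℕ} (m : ℕ) (y : Fin r → I)
    (ω : ℕ → X) :
    deviation μ ℓ H L b N m y ω = 𝔼 w : Fin m → ℤˣ × Fin N,
      (∫ x, relaxTerm ℓ H L b N y w x ω ∂μ - 𝔼 i : Fin N, relaxTerm ℓ H L b N y w (ω i) ω) := by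
  unfold deviation
  simp only [relaxAt_eq]
  rw [expect_sub_distrib, expect_comm]
  congr 1
  simp only [Fintype.expect_eq_sum_div_card]
  rw [integral_div, integral_finsetSum _ fun w _ => hl.integrable_relaxTerm μ hL hH hM b N y w ω]

lemma IsConvexLipschitzLoss.measurable_deviation (hl : IsConvexLipschitzLoss L ℓ) (hL : 0 ≤ L)
    (hH : H.Nonempty) (hM : MeasurableERM ℓ H) (b N : ℕ) {r : ℕ} (m : ℕ) (y : Fin r → I) :
    Measurable (deviation μ ℓ H L b N m y) := by
  have : deviation μ ℓ H L b N m y = fun ω => _ :=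
    funext fun ω => hl.deviation_eq μ hL hH hM b N m y ω
  rw [this]
  simp only [Fintype.expect_eq_sum_div_card]
  refine (Finset.measurable_sum _ fun w _ => ?_).div_const _
  refine (measurable_integral_left μ (hM.measurable_relaxTerm hL b N y w)).sub ?_
  refine (Finset.measurable_sum _ fun i _ => ?_).div_const _
  exact measurable_eval_self (hM.measurable_relaxTerm hL b N y w) (i : ℕ)

lemma IsConvexLipschitzLoss.abs_deviation_le (hl : IsConvexLipschitzLoss L ℓ) (hL : 0 ≤ L)
    (hH : H.Nonempty) (hM : MeasurableERM ℓ H) (b N : ℕ) [NeZero N] {r : ℕ} (m : ℕ)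
    (y : Fin r → I) (ω : ℕ → X) : |deviation μ ℓ H L b N m y ω| ≤ L := by
  have hi := fun w : Fin m → ℤˣ × Fin N => hl.integrable_relaxTerm μ hL hH hM b N y w ω
  rw [hl.deviation_eq μ hL hH hM]
  have h1 : ∀ (w : Fin m → ℤˣ × Fin N) (z : X),
      |∫ x, relaxTerm ℓ H L b N y w x ω ∂μ - relaxTerm ℓ H L b N y w z ω| ≤ L := by
    intro w z
    have u := integral_mono (hi w) (integrable_const (relaxTerm ℓ H L b N y w z ω + L))
      fun x => by have := hl.relaxTerm_sub_le hL hH b N y w x z ω; simp only; linarith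
    have v := integral_mono (integrable_const (relaxTerm ℓ H L b N y w z ω - L)) (hi w)
      fun x => by have := hl.relaxTerm_sub_le hL hH b N y w z x ω; simp only; linarith
    simp only [integral_const, probReal_univ, one_smul] at u v
    rw [abs_le]; constructor <;> linarith
  refine (abs_expect_le _ _).trans (expect_le univ_nonempty fun w _ => ?_)
  rw [← Fintype.expect_const (ι := Fin N) (∫ x, relaxTerm ℓ H L b N y w x ω ∂μ),
    ← expect_sub_distrib]
  exact (abs_expect_le _ _).trans (expect_le univ_nonempty fun i _ => h1 w (ω i))

lemma IsConvexLipschitzLoss.measurable_deviationSup (hl : IsConvexLipschitzLoss L ℓ) (hL : 0 ≤ L)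
    (hH : H.Nonempty) (hM : MeasurableERM ℓ H) (b N r m : ℕ) :
    Measurable (deviationSup μ ℓ H L b N r m) := by
  refine Measurable.add_const ?_ _
  have := Finset.measurable_sup' (s := univ) univ_nonempty
    (f := fun y : Fin r → Fin (N + 1) => deviation μ ℓ H L b N m (fun i => gridLabel N (y i)))
    fun y _ => hl.measurable_deviation μ hL hH hM b N m _
  convert this using 1
  ext ω
  rw [Finset.sup'_apply]

lemma IsConvexLipschitzLoss.abs_deviationSup_le (hl : IsConvexLipschitzLoss L ℓ) (hL : 0 ≤ L)
    (hH : H.Nonempty) (hM : MeasurableERM ℓ H) (b N r m : ℕ) [NeZero N] (ω : ℕ → X) :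
    |deviationSup μ ℓ H L b N r m ω| ≤ L + 2 * L * r / N := by
  have h := fun y : Fin r → Fin (N + 1) =>
    abs_le.1 (hl.abs_deviation_le μ hL hH hM b N m (fun i => gridLabel N (y i)) ω)
  refine (abs_add_le _ _).trans (add_le_add ?_ (le_of_eq (abs_of_nonneg (by positivity))))
  rw [abs_le]
  constructor
  · exact (h fun _ => 0).1.trans (le_sup' (fun y : Fin r → Fin (N + 1) =>
      deviation μ ℓ H L b N m (fun i => gridLabel N (y i)) ω) (mem_univ fun _ => 0))
  · exact sup'_le _ _ fun y _ => (h y).2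

/-- Rounding r labels moves every cumulative loss by at most L r / N. This error occurs once in the
integral and once in the pool average, hence the term 2 L r / N. -/
lemma IsConvexLipschitzLoss.deviation_le_deviationSup (hl : IsConvexLipschitzLoss L ℓ)
    (hL : 0 ≤ L) (hH : H.Nonempty) (hM : MeasurableERM ℓ H) (b N : ℕ) [NeZero N] {r : ℕ} (m : ℕ)
    (y : Fin r → I) (ω : ℕ → X) :
    deviation μ ℓ H L b N m y ω ≤ deviationSup μ ℓ H L b N r m ω := by
  choose g hg using fun i => exists_gridLabel (Nat.one_le_iff_ne_zero.2 (NeZero.ne N)) (y i)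
  have hS : ∀ h ∈ H, |lossSum ℓ h (sampleAt b ω y)
      - lossSum ℓ h (sampleAt b ω fun i => gridLabel N (g i))| ≤ L * r / N := by
    intro h _
    simp only [lossSum, sampleAt, List.map_ofFn, List.sum_ofFn, Function.comp_apply]
    rw [← sum_sub_distrib]
    refine (abs_sum_le_sum_abs _ _).trans ?_
    refine (sum_le_card_nsmul _ _ (L * (1 / N)) fun i _ => ?_).trans (le_of_eq ?_)
    · exact (hl.lipschitz_right _ _ _).trans (mul_le_mul_of_nonneg_left (hg i) hL)
    · simp; ring
  have hS' : ∀ h ∈ H, |lossSum ℓ h (sampleAt b ω fun i => gridLabel N (g i))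
      - lossSum ℓ h (sampleAt b ω y)| ≤ L * r / N := fun h hh => by
    rw [abs_sub_comm]; exact hS h hh
  have h1 : deviation μ ℓ H L b N m y ω
      ≤ deviation μ ℓ H L b N m (fun i => gridLabel N (g i)) ω + 2 * L * r / N := by
    unfold deviation
    have u := integral_mono (hl.integrable_relaxAt μ hL hH hM b N m y ω)
      ((hl.integrable_relaxAt μ hL hH hM b N m (fun i => gridLabel N (g i)) ω).add
        (integrable_const (L * r / N)))
      fun x => hl.relaxAt_sub_le hL hH hS (fun i : Fin N => ω i) m x
    rw [integral_add' (hl.integrable_relaxAt μ hL hH hM b N m _ ω) (integrable_const _)] at u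
    simp only [integral_const, probReal_univ, one_smul] at u
    have v : 𝔼 i : Fin N, relaxAt ℓ H L (sampleAt b ω fun i => gridLabel N (g i))
          (fun i : Fin N => ω i) m (ω i)
        ≤ (𝔼 i : Fin N, relaxAt ℓ H L (sampleAt b ω y) (fun i : Fin N => ω i) m (ω i))
          + L * r / N := by
      rw [← Fintype.expect_const (ι := Fin N) (L * r / N), ← expect_add_distrib]
      exact expect_le_expect fun i _ => hl.relaxAt_sub_le hL hH hS' (fun i : Fin N => ω i) m (ω i)
    have e : 2 * L * r / N = L * r / N + L * r / N := by ring
    linarith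
  refine h1.trans (add_le_add ?_ le_rfl)
  exact le_sup' (fun y : Fin r → Fin (N + 1) =>
    deviation μ ℓ H L b N m (fun i => gridLabel N (y i)) ω) (mem_univ g)

/-- The (N + 1)^r grid labellings produce the entropy term. The parameter s stays free and is chosen
once the block length is known. -/
lemma IsConvexLipschitzLoss.integral_deviationSup_le (hl : IsConvexLipschitzLoss L ℓ)
    (hL : 0 ≤ L) (hH : H.Nonempty) (hM : MeasurableERM ℓ H) {b N : ℕ} [NeZero N] (hb : N ≤ b)
    (r m : ℕ) {s : ℝ} (hs : 0 < s) :
    ∫ ω, deviationSup μ ℓ H L b N r m ω ∂(featureLaw μ)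
      ≤ 2 * L * r / N + L * m / N + r * Real.log (N + 1) / s + s * L ^ 2 / (2 * N) := by
  have h := integral_deviation_le μ (Y := Fin r → Fin (N + 1)) hL hs
    (fun y (w : Fin m → ℤˣ × Fin N) => relaxTerm ℓ H L b N (fun i => gridLabel N (y i)) w)
    (fun y w => hM.measurable_relaxTerm hL b N _ w)
    (fun y w x ω => hl.abs_relaxTerm_le hL hH b N _ w x ω)
    (fun y w x x' ω => hl.relaxTerm_sub_le hL hH b N _ w x x' ω)
    (fun y w i hi x ω v => relaxTerm_update hb _ w i hi x ω v)
    (Z := deviationSup μ ℓ H L b N r m) (δ := 2 * L * r / N)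
    (Integrable.of_bound (hl.measurable_deviationSup μ hL hH hM b N r m).aestronglyMeasurable _
      (Filter.Eventually.of_forall fun ω => hl.abs_deviationSup_le μ hL hH hM b N r m ω))
    (fun ω => by
      obtain ⟨y, -, hy⟩ := exists_mem_eq_sup' univ_nonempty (fun y : Fin r → Fin (N + 1) =>
        deviation μ ℓ H L b N m (fun i => gridLabel N (y i)) ω)
      refine ⟨y, ?_⟩
      rw [deviationSup, hy, hl.deviation_eq μ hL hH hM])
  refine h.trans (le_of_eq ?_)
  simp [Real.log_pow]

end DeviationTerm

/-! ### The regret of the program -/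

section Regret

variable {X : Type u} {ℓ : ℝ → ℝ → ℝ} {H : Set (X → I)} {L a : ℝ}

lemma blockOf_eq_sampleAt (ha : 0 ≤ a) (ha1 : a ≤ 1) (hist : List (X × I)) (ω : ℕ → X) :
    ∃ y : Fin (sched (2 ^ a) hist.length).pos → I, blockOf a hist
      = sampleAt (hist.length - (sched (2 ^ a) hist.length).pos)
        (splice (hist.map Prod.fst) ω) y := by
  have hp := (schedSpec ha ha1 hist.length).pos_le
  refine ⟨fun i => (hist[hist.length - (sched (2 ^ a) hist.length).pos + i]'(by
    have := i.2; omega)).2, ?_⟩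
  refine List.ext_getElem ?_ fun n h1 h2 => ?_
  · simp [blockOf, sampleAt]; omega
  · simp only [sampleAt, List.length_ofFn] at h2
    have hlt : hist.length - (sched (2 ^ a) hist.length).pos + n < hist.length := by omega
    simp [blockOf, sampleAt, splice, hlt]

lemma poolOf_eq_splice {hist : List (X × I)} {N : ℕ} (hN : N ≤ hist.length) (x : X)
    (ω : ℕ → X) : poolOf hist x N = fun i : Fin N => splice (hist.map Prod.fst) ω i := by
  ext1 i
  have hi : (i : ℕ) < hist.length := i.2.trans_le hN
  simp [poolOf, feature, splice, hi]

variable [MeasurableSpace X]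

/-- Upper bound on the increments of the potential, as a function of the features. -/
noncomputable def roundCost (μ : Measure X) (ℓ : ℝ → ℝ → ℝ) (H : Set (X → I)) (L a : ℝ) (s : ℕ)
    (ω : ℕ → X) : ℝ :=
  (if (sched (2 ^ a) s).pos = 0 then L * rademacher H (sched (2 ^ a) s).block else 0) +
    if s = 0 then L else deviationSup μ ℓ H L (s - (sched (2 ^ a) s).pos) (sched (2 ^ a) s).pool
      (sched (2 ^ a) s).pos ((sched (2 ^ a) s).block - (sched (2 ^ a) s).pos - 1) ω

variable (μ : Measure X) [IsProbabilityMeasure μ]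

lemma IsConvexLipschitzLoss.measurable_roundCost (hl : IsConvexLipschitzLoss L ℓ) (hL : 0 ≤ L)
    (hH : H.Nonempty) (hM : MeasurableERM ℓ H) (s : ℕ) : Measurable (roundCost μ ℓ H L a s) := by
  unfold roundCost
  refine Measurable.const_add ?_ _
  split_ifs with h
  · exact measurable_const
  · exact hl.measurable_deviationSup μ hL hH hM _ _ _ _

lemma IsConvexLipschitzLoss.exists_bound_roundCost (hl : IsConvexLipschitzLoss L ℓ) (hL : 0 ≤ L)
    (hH : H.Nonempty) (hM : MeasurableERM ℓ H) (ha : 0 ≤ a) (ha1 : a ≤ 1) (s : ℕ) :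
    ∃ C, ∀ ω, |roundCost μ ℓ H L a s ω| ≤ C := by
  have : NeZero (sched (2 ^ a) s).pool :=
    ⟨by have := (schedSpec ha ha1 s).pool_pos; omega⟩
  refine ⟨|if (sched (2 ^ a) s).pos = 0 then L * rademacher H (sched (2 ^ a) s).block else 0| +
    max |L| (L + 2 * L * (sched (2 ^ a) s).pos / (sched (2 ^ a) s).pool),
    fun ω => (abs_add_le _ _).trans (add_le_add le_rfl ?_)⟩
  split_ifs
  · exact le_max_left _ _
  · exact (hl.abs_deviationSup_le μ hL hH hM _ _ _ _ ω).trans (le_max_right _ _)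

/-- The mean of `relaxAt` at a fresh feature exceeds its pool average by the deviation, and by
`relax_succ` the pool average is the current relaxation. Inside a block that relaxation is part of
the potential. At the start of a block it is not yet counted, and the Rademacher complexity pays for
it. -/
lemma IsConvexLipschitzLoss.gameValue_le_sum (hl : IsConvexLipschitzLoss L ℓ) (hL : 0 ≤ L)
    (hH : H.Nonempty) (hM : MeasurableERM ℓ H) (ha : 0 ≤ a) (ha1 : a ≤ 1) (T : ℕ) :
    gameValue ℓ H ((program (2 ^ a) L).rule ℓ H) μ T [] 0
      ≤ ((∑ s ∈ range T, ∫ ω, roundCost μ ℓ H L a s ω ∂(featureLaw μ) : ℝ) : EReal) := by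
  obtain ⟨x₀⟩ : Nonempty X := nonempty_of_isProbabilityMeasure μ
  choose C hC using hl.exists_bound_roundCost μ hL hH hM ha ha1
  have h0 : potential ℓ H L a x₀ [] = 0 := by simp [potential, closedValue, sched]
  have key := gameValue_le_of_step (Φ := (program (2 ^ a) L).rule ℓ H) μ (T := T)
    (potential ℓ H L a x₀) (roundCost μ ℓ H L a) (C := C)
    (hl.measurable_roundCost μ hL hH hM) hC (fun hist x y => hl.integrable_left _ y)
    (fun hist _ => hl.neg_le_potential hL hH ha ha1 x₀ hist) ?_
  · rwa [h0, zero_add] at key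
  intro hist hT
  have hs := schedSpec ha ha1 hist.length
  have : NeZero (sched (2 ^ a) hist.length).pool := ⟨by have := hs.pool_pos; omega⟩
  have hstep : ∀ (x : X) (y : I),
      ∫ z, ℓ z y ∂((program (2 ^ a) L).rule ℓ H hist x : Measure I)
        + potential ℓ H L a x₀ (hist ++ [(x, y)])
      ≤ closedValue ℓ H L a hist + relaxAt ℓ H L (blockOf a hist)
        (poolOf hist x (sched (2 ^ a) hist.length).pool)
        ((sched (2 ^ a) hist.length).block - (sched (2 ^ a) hist.length).pos - 1) x := by
    intro x y
    rw [hl.integral_rule hL hist x y rfl hs.pool_pos rfl hs.pos_le]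
    exact hl.predict_add_potential_le hL hH ha ha1 x₀ hist x y
  -- In the first round no old feature exists and the one slot of the pool falls back on the current
  -- feature, so the trivial cost L is charged.
  rcases Nat.eq_zero_or_pos hist.length with hlen | hlen
  · obtain rfl := List.length_eq_zero_iff.1 hlen
    refine ⟨fun _ => L, integrable_const _, fun x y => (hstep x y).trans ?_, fun ω => ?_⟩
    · have h1 : closedValue ℓ H L a ([] : List (X × I)) = 0 := by simp [closedValue]
      have h2 : blockOf a ([] : List (X × I)) = [] := by simp [blockOf]
      rw [h1, h2, zero_add]
      have h3 : (sched (2 ^ a) ([] : List (X × I)).length).block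
          - (sched (2 ^ a) ([] : List (X × I)).length).pos - 1 = 0 := by simp [sched]
      rw [h3]
      refine expect_le univ_nonempty fun w _ => ?_
      have hb : ∀ e : ℤˣ, -mixedERM ℓ H [] L ((e, x) ::
          hallucination (poolOf [] x (sched (2 ^ a) ([] : List (X × I)).length).pool) w) ≤ L := by
        intro e
        have := (abs_le.1 (hl.abs_mixedERM_le hL hH [] ((e, x) ::
          hallucination (poolOf [] x (sched (2 ^ a) ([] : List (X × I)).length).pool) w))).1
        simp [hallucination] at this ⊢
        linarith
      have := hb 1; have := hb (-1)
      linarith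
    · have h4 := rademacher_nonneg hH 1
      simp only [h0, List.length_nil, roundCost, sched, if_true, integral_const, probReal_univ,
        one_smul, zero_add]
      have := mul_nonneg hL h4
      linarith
  · have hN : (sched (2 ^ a) hist.length).pool ≤ hist.length := by
      have := hs.pool_le; omega
    have hf : ∀ ω : ℕ → X, ∃ y : Fin (sched (2 ^ a) hist.length).pos → I, ∀ x,
        relaxAt ℓ H L (blockOf a hist) (poolOf hist x₀ (sched (2 ^ a) hist.length).pool)
          ((sched (2 ^ a) hist.length).block - (sched (2 ^ a) hist.length).pos - 1) x
        = relaxAt ℓ H L (sampleAt (hist.length - (sched (2 ^ a) hist.length).pos)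
            (splice (hist.map Prod.fst) ω) y)
          (fun i : Fin (sched (2 ^ a) hist.length).pool => splice (hist.map Prod.fst) ω i)
          ((sched (2 ^ a) hist.length).block - (sched (2 ^ a) hist.length).pos - 1) x := by
      intro ω
      obtain ⟨y, hy⟩ := blockOf_eq_sampleAt ha ha1 hist ω
      exact ⟨y, fun x => by rw [hy, poolOf_eq_splice hN x₀ ω]⟩
    have hint : Integrable (relaxAt ℓ H L (blockOf a hist)
        (poolOf hist x₀ (sched (2 ^ a) hist.length).pool)
        ((sched (2 ^ a) hist.length).block - (sched (2 ^ a) hist.length).pos - 1)) μ := by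
      obtain ⟨y, hy⟩ := hf fun _ => x₀
      rw [funext hy]
      exact hl.integrable_relaxAt μ hL hH hM _ _ _ _ _
    refine ⟨_, (integrable_const (closedValue ℓ H L a hist)).add hint, fun x y => ?_, fun ω => ?_⟩
    · refine (hstep x y).trans (le_of_eq ?_)
      have e := poolOf_eq hN x x₀ []
      rw [List.append_nil] at e
      rw [e]; rfl
    · rw [integral_add' (integrable_const _) hint, integral_const, probReal_univ, one_smul,
        potential, add_assoc]
      refine add_le_add le_rfl ?_
      obtain ⟨y, hy⟩ := hf ω
      have hdev := hl.deviation_le_deviationSup μ hL hH hM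
        (hist.length - (sched (2 ^ a) hist.length).pos) (sched (2 ^ a) hist.length).pool
        ((sched (2 ^ a) hist.length).block - (sched (2 ^ a) hist.length).pos - 1) y
        (splice (hist.map Prod.fst) ω)
      have hpool : 𝔼 i : Fin (sched (2 ^ a) hist.length).pool,
          relaxAt ℓ H L (sampleAt (hist.length - (sched (2 ^ a) hist.length).pos)
            (splice (hist.map Prod.fst) ω) y)
          (fun i : Fin (sched (2 ^ a) hist.length).pool => splice (hist.map Prod.fst) ω i)
          ((sched (2 ^ a) hist.length).block - (sched (2 ^ a) hist.length).pos - 1)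
          (splice (hist.map Prod.fst) ω i)
          = relax ℓ H L (blockOf a hist) (poolOf hist x₀ (sched (2 ^ a) hist.length).pool)
            ((sched (2 ^ a) hist.length).block - (sched (2 ^ a) hist.length).pos) := by
        have hm : (sched (2 ^ a) hist.length).block - (sched (2 ^ a) hist.length).pos
            = (sched (2 ^ a) hist.length).block - (sched (2 ^ a) hist.length).pos - 1 + 1 := by
          have := hs.pos_lt; omega
        conv_rhs => rw [hm]
        rw [relax_succ]
        refine expect_congr rfl fun i _ => ?_
        rw [hy, poolOf_eq_splice hN x₀ ω]
      rw [deviation, hpool] at hdev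
      rw [funext hy, roundCost, if_neg (by omega : hist.length ≠ 0)]
      split_ifs with hp
      · have hrad := relax_nil_le (ℓ := ℓ) hL hH
          (poolOf hist x₀ (sched (2 ^ a) hist.length).pool) (sched (2 ^ a) hist.length).block
        have e : relax ℓ H L (blockOf a hist)
            (poolOf hist x₀ (sched (2 ^ a) hist.length).pool)
            ((sched (2 ^ a) hist.length).block - (sched (2 ^ a) hist.length).pos)
            = relax ℓ H L [] (poolOf hist x₀ (sched (2 ^ a) hist.length).pool)
              (sched (2 ^ a) hist.length).block := by
          rw [blockOf_of_pos_eq_zero hp, hp, Nat.sub_zero]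
        rw [e] at hdev
        linarith
      · linarith

lemma IsConvexLipschitzLoss.integral_roundCost_le (hl : IsConvexLipschitzLoss L ℓ) (hL : 0 ≤ L)
    (hH : H.Nonempty) (hM : MeasurableERM ℓ H) (ha : 0 ≤ a) (ha1 : a ≤ 1) {s T : ℕ}
    (hsT : s < T) :
    ∫ ω, roundCost μ ℓ H L a s ω ∂(featureLaw μ)
      ≤ (if (sched (2 ^ a) s).pos = 0 then L * rademacher H (sched (2 ^ a) s).block else 0) +
        L * (√(((sched (2 ^ a) s).block : ℝ) / (sched (2 ^ a) s).pool)
          * (3 + 2 * √(Real.log T))) := by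
  have hs := schedSpec ha ha1 s
  have : NeZero (sched (2 ^ a) s).pool := ⟨by have := hs.pool_pos; omega⟩
  set N := (sched (2 ^ a) s).pool with hNdef
  set M := (sched (2 ^ a) s).block with hMdef
  set r := (sched (2 ^ a) s).pos with hrdef
  have hN : (1 : ℝ) ≤ N := by exact_mod_cast hs.pool_pos
  have hM1 : (1 : ℝ) ≤ M := by exact_mod_cast hs.block_pos
  have hMN : (M : ℝ) ≤ N := by exact_mod_cast hs.block_le_pool
  have hT : (0 : ℝ) ≤ Real.log T := Real.log_natCast_nonneg T
  have hMN1 : (M : ℝ) / N ≤ √((M : ℝ) / N) := by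
    refine Real.le_sqrt_of_sq_le ?_
    rw [sq]
    exact mul_le_of_le_one_left (by positivity) ((div_le_one (by linarith)).2 hMN)
  unfold roundCost
  rcases Nat.eq_zero_or_pos s with rfl | hs0
  · simp only [if_true, integral_const, probReal_univ, one_smul]
    refine add_le_add le_rfl ?_
    have e : (M : ℝ) / N = 1 := by simp [hMdef, hNdef, sched]
    rw [e, Real.sqrt_one, one_mul]
    have := Real.sqrt_nonneg (Real.log T)
    nlinarith
  · simp only [if_neg hs0.ne']
    have hNs : N + r ≤ s := by have := hs.pool_le; omega
    have hdi : Integrable (deviationSup μ ℓ H L (s - r) N r (M - r - 1)) (featureLaw μ) :=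
      Integrable.of_bound (hl.measurable_deviationSup μ hL hH hM _ _ _ _).aestronglyMeasurable _
        (Filter.Eventually.of_forall fun ω => hl.abs_deviationSup_le μ hL hH hM _ _ _ _ ω)
    rw [integral_add (integrable_const _) hdi, integral_const, probReal_univ, one_smul]
    refine add_le_add le_rfl ?_
    -- The case L = 0 is set apart because the parameter s chosen below has L in its denominator.
    rcases hL.eq_or_lt with h0 | h0
    · have : ∀ ω, deviationSup μ ℓ H L (s - r) N r (M - r - 1) ω = 0 := fun ω => by
        have := hl.abs_deviationSup_le μ hL hH hM (s - r) N r (M - r - 1) ω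
        rw [← h0] at this ⊢
        simpa using this
      simp only [this, integral_zero]
      rw [← h0, zero_mul]
    · set g := Real.log ((N : ℝ) + 1) with hg
      have hg0 : 0 < g := Real.log_pos (by linarith)
      have hgT : g ≤ Real.log T := by
        refine Real.log_le_log (by linarith) ?_
        have : N + 1 ≤ T := by omega
        exact_mod_cast this
      have hpos : 0 < √(N * M * g) := Real.sqrt_pos.2 (by positivity)
      -- Up to a constant, this s balances the entropy M g / s against the variance term s L² /
      -- (2N).
      have key := hl.integral_deviationSup_le μ hL hH hM (b := s - r) (N := N) (by omega) r
        (M - r - 1) (s := √(N * M * g) / L) (by positivity)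
      refine key.trans ?_
      have hrM : (r : ℝ) ≤ M := by exact_mod_cast hs.pos_lt.le
      have hmM : ((M - r - 1 : ℕ) : ℝ) ≤ M := by exact_mod_cast (by omega : M - r - 1 ≤ M)
      have hsq : √(N * M * g) = N * (√((M : ℝ) / N) * √g) := by
        rw [← Real.sqrt_mul (by positivity)]
        have e : (N : ℝ) * M * g = N ^ 2 * ((M : ℝ) / N * g) := by field_simp
        rw [e, Real.sqrt_mul (by positivity), Real.sqrt_sq (by linarith)]
      have hsq2 : √(N * M * g) ^ 2 = N * M * g := Real.sq_sqrt (by positivity)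
      have t1 : 2 * L * r / N + L * ((M - r - 1 : ℕ) : ℝ) / N ≤ 3 * (L * (M / N)) := by
        have e : 3 * (L * ((M : ℝ) / N)) = 2 * L * M / N + L * M / N := by ring
        rw [e]
        gcongr
      have t2 : r * g / (√(N * M * g) / L) ≤ L * (√((M : ℝ) / N) * √g) := by
        rw [div_div_eq_mul_div, div_le_iff₀ hpos]
        have : L * (√((M : ℝ) / N) * √g) * √(N * M * g) = M * g * L := by
          have e2 : √((M : ℝ) / N) * √g = √(N * M * g) / N := by rw [hsq]; field_simp
          rw [e2]
          have : L * (√(N * M * g) / N) * √(N * M * g) = L * (√(N * M * g) ^ 2 / N) := by ring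
          rw [this, hsq2]; field_simp
        rw [this]
        gcongr
      have t3 : √(N * M * g) / L * L ^ 2 / (2 * N) = L * (√((M : ℝ) / N) * √g) / 2 := by
        rw [hsq]; field_simp
      have t4 : √g ≤ √(Real.log T) := Real.sqrt_le_sqrt hgT
      have t5 : L * (√((M : ℝ) / N) * √g) ≤ L * (√((M : ℝ) / N) * √(Real.log T)) := by gcongr
      have t6 : L * ((M : ℝ) / N) ≤ L * √((M : ℝ) / N) := by gcongr
      have t7 : 0 ≤ L * (√((M : ℝ) / N) * √(Real.log T)) := by positivity
      rw [t3]
      nlinarith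

end Regret

/-! ### Summation over the rounds -/

section Summation

/-- Bernoulli's inequality shows that x^(1−κ) grows by at least (1−κ)(T+1)^(−κ) from T to T + 1. The
factor 2 compensates 1 − κ ≥ 1/2. -/
lemma sum_rpow_neg_le {κ : ℝ} (h0 : 0 ≤ κ) (h1 : κ ≤ 1 / 2) (T : ℕ) :
    ∑ s ∈ range T, ((s : ℝ) + 1) ^ (-κ) ≤ 2 * (T : ℝ) ^ (1 - κ) := by
  induction T with
  | zero => simp; positivity
  | succ T ih =>
    rw [sum_range_succ]
    have hT : (0 : ℝ) < (T : ℝ) + 1 := by positivity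
    have hb : (1 + -(1 / ((T : ℝ) + 1))) ^ (1 - κ) ≤ 1 + (1 - κ) * -(1 / ((T : ℝ) + 1)) :=
      rpow_one_add_le_one_add_mul_self
        (by rw [neg_le_neg_iff, div_le_one hT]; linarith) (by linarith) (by linarith)
    have e1 : (T : ℝ) = (T + 1) * (1 + -(1 / ((T : ℝ) + 1))) := by field_simp; ring
    have hnn : 0 ≤ 1 + -(1 / ((T : ℝ) + 1)) := by
      have : 1 / ((T : ℝ) + 1) ≤ 1 := by rw [div_le_one hT]; linarith
      linarith
    have h2 : (T : ℝ) ^ (1 - κ)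
        = ((T : ℝ) + 1) ^ (1 - κ) * (1 + -(1 / ((T : ℝ) + 1))) ^ (1 - κ) := by
      rw [← Real.mul_rpow hT.le hnn, ← e1]
    have e2 : ((T : ℝ) + 1) ^ (1 - κ) = ((T : ℝ) + 1) * ((T : ℝ) + 1) ^ (-κ) := by
      rw [show (1 - κ) = 1 + -κ by ring, Real.rpow_add hT, Real.rpow_one]
    have hp : 0 < ((T : ℝ) + 1) ^ (-κ) := Real.rpow_pos_of_pos hT _
    have h3 := mul_le_mul_of_nonneg_left hb (Real.rpow_nonneg hT.le (1 - κ))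
    rw [← h2, e2] at h3
    have h4 : ((T : ℝ) + 1) * ((T : ℝ) + 1) ^ (-κ) * (1 + (1 - κ) * -(1 / ((T : ℝ) + 1)))
        = ((T : ℝ) + 1) * ((T : ℝ) + 1) ^ (-κ) - (1 - κ) * ((T : ℝ) + 1) ^ (-κ) := by
      field_simp; ring
    push_cast
    rw [e2]
    nlinarith

variable {a : ℝ}

/-- Amortization: the cost M^q at the start of a block is spread evenly over its M rounds. Only the
unfinished block at time T leaves a remainder. -/
lemma sum_block_start_le (ha : 0 ≤ a) (ha1 : a ≤ 1) {q : ℝ} (T : ℕ) :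
    ∑ s ∈ range T, (if (sched (2 ^ a) s).pos = 0 then ((sched (2 ^ a) s).block : ℝ) ^ q else 0)
      ≤ ∑ s ∈ range T, ((sched (2 ^ a) s).block : ℝ) ^ (q - 1)
        + ((sched (2 ^ a) T).block : ℝ) ^ q := by
  have key : ∑ s ∈ range T,
      (if (sched (2 ^ a) s).pos = 0 then ((sched (2 ^ a) s).block : ℝ) ^ q else 0)
      = ∑ s ∈ range T, ((sched (2 ^ a) s).block : ℝ) ^ (q - 1)
        + if (sched (2 ^ a) T).pos = 0 then 0 else
          (((sched (2 ^ a) T).block : ℝ) - (sched (2 ^ a) T).pos)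
            * ((sched (2 ^ a) T).block : ℝ) ^ (q - 1) := by
    induction T with
    | zero => simp [sched]
    | succ T ih =>
      rw [sum_range_succ, sum_range_succ, ih]
      have hb : (0 : ℝ) < (sched (2 ^ a) T).block := by
        exact_mod_cast (schedSpec ha ha1 T).block_pos
      have e : ((sched (2 ^ a) T).block : ℝ) ^ q
          = (sched (2 ^ a) T).block * ((sched (2 ^ a) T).block : ℝ) ^ (q - 1) := by
        conv_lhs => rw [show q = 1 + (q - 1) by ring, Real.rpow_add hb, Real.rpow_one]
      rcases sched_succ ha ha1 T with ⟨_, h2, -, h4⟩ | ⟨h1, h2⟩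
      · rw [h4, h2, e, if_neg (Nat.succ_ne_zero (sched (2 ^ a) T).pos)]
        push_cast
        split_ifs with h
        · rw [h]; push_cast; ring
        · ring
      · have hc : ((sched (2 ^ a) T).block : ℝ) = (sched (2 ^ a) T).pos + 1 := by
          exact_mod_cast h1.symm
        rw [if_pos h2, e]
        split_ifs with h
        · rw [hc, h]; push_cast; ring
        · rw [hc]; ring
  rw [key]
  refine add_le_add le_rfl ?_
  have hb : (0 : ℝ) < (sched (2 ^ a) T).block := by
    exact_mod_cast (schedSpec ha ha1 T).block_pos
  split_ifs
  · positivity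
  · conv_rhs => rw [show q = 1 + (q - 1) by ring, Real.rpow_add hb, Real.rpow_one]
    refine mul_le_mul_of_nonneg_right ?_ (by positivity)
    have : (0 : ℝ) ≤ (sched (2 ^ a) T).pos := by positivity
    linarith

lemma pool_rpow_neg_le (ha : 0 ≤ a) (ha1 : a ≤ 1) {κ : ℝ} (h0 : 0 ≤ κ) (h1 : κ ≤ 1) (s : ℕ) :
    ((sched (2 ^ a) s).pool : ℝ) ^ (-κ) ≤ 2 * ((s : ℝ) + 1) ^ (-κ) := by
  have hs := schedSpec ha ha1 s
  have hN : (0 : ℝ) < (sched (2 ^ a) s).pool := by exact_mod_cast hs.pool_pos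
  have hle : (s : ℝ) + 1 ≤ 2 * (sched (2 ^ a) s).pool := by exact_mod_cast hs.lt_pool
  have h2 : (2 * ((sched (2 ^ a) s).pool : ℝ)) ^ (-κ) ≤ ((s : ℝ) + 1) ^ (-κ) :=
    Real.rpow_le_rpow_of_nonpos (by positivity) hle (by linarith)
  rw [Real.mul_rpow (by norm_num) hN.le] at h2
  have h3 : (1 / 2 : ℝ) ≤ 2 ^ (-κ) := by
    calc (1 / 2 : ℝ) = 2 ^ (-1 : ℝ) := by rw [Real.rpow_neg_one]; norm_num
      _ ≤ _ := Real.rpow_le_rpow_of_exponent_le (by norm_num) (by linarith)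
  have h4 : 0 < ((sched (2 ^ a) s).pool : ℝ) ^ (-κ) := Real.rpow_pos_of_pos hN _
  nlinarith

end Summation

/-! ### Regret under a power bound on the Rademacher complexities -/

section MainBound

variable {X : Type u} [MeasurableSpace X] {ℓ : ℝ → ℝ → ℝ} {H : Set (X → I)} {L : ℝ}

/-- The regret of the program for classes with Rademacher complexities `W M ^ q`. -/
theorem IsConvexLipschitzLoss.hybridRegret_le (hl : IsConvexLipschitzLoss L ℓ) (hL : 0 ≤ L)
    (hH : H.Nonempty) (hM : MeasurableERM ℓ H) {q : ℝ} (hq : 1 / 2 ≤ q) (hq1 : q ≤ 1) {W : ℝ}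
    (hW : 0 ≤ W) {T : ℕ} (hT : 2 ≤ T)
    (hrad : ∀ M : ℕ, 1 ≤ M → M ≤ T → rademacher H M ≤ W * (M : ℝ) ^ q) :
    hybridRegret ℓ H ((program (2 ^ (1 / (3 - 2 * q))) L).rule ℓ H) T
      ≤ ((L * (6 * W + 36 * √(Real.log T)) * (T : ℝ) ^ ((2 - q) / (3 - 2 * q)) : ℝ) : EReal) := by
  set a : ℝ := 1 / (3 - 2 * q) with ha_def
  have hd : 0 < 3 - 2 * q := by linarith
  have ha : 0 ≤ a := by positivity
  have ha1 : a ≤ 1 := by rw [ha_def, div_le_one hd]; linarith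
  -- At M = N^a both M^(q−1) and √(M/N) equal N^(−κ). This is the balance that determines a, and
  -- summing over the rounds gives T^(1−κ).
  set κ : ℝ := (1 - q) / (3 - 2 * q) with hκ_def
  have hκ0 : 0 ≤ κ := div_nonneg (by linarith) hd.le
  have hκ1 : κ ≤ 1 / 2 := by rw [hκ_def, div_le_iff₀ hd]; linarith
  have hθ : (2 - q) / (3 - 2 * q) = 1 - κ := by rw [hκ_def]; field_simp; ring
  have haq : a * (q - 1) = -κ := by rw [hκ_def, ha_def]; field_simp; ring
  have haκ : (a - 1) / 2 = -κ := by rw [hκ_def, ha_def]; field_simp; ring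
  rw [hθ]
  have hT0 : (0 : ℝ) < T := by positivity
  have hT1 : (1 : ℝ) ≤ T := by exact_mod_cast (by omega : 1 ≤ T)
  have hpow : 0 < (T : ℝ) ^ (1 - κ) := Real.rpow_pos_of_pos hT0 _
  -- Used in the last step, where the additive constant 18 must be at most 24 √(log T).
  have hlog : (0.8 : ℝ) ≤ √(Real.log T) := by
    refine Real.le_sqrt_of_sq_le ?_
    have : Real.log 2 ≤ Real.log T := Real.log_le_log (by norm_num) (by exact_mod_cast hT)
    have := Real.log_two_gt_d9
    norm_num; linarith
  have hN : ∀ s, (0 : ℝ) < (sched (2 ^ a) s).pool := fun s => by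
    exact_mod_cast (schedSpec ha ha1 s).pool_pos
  have hMp : ∀ s, (0 : ℝ) < (sched (2 ^ a) s).block := fun s => by
    exact_mod_cast (schedSpec ha ha1 s).block_pos
  have hsum : ∑ s ∈ range T, ((sched (2 ^ a) s).pool : ℝ) ^ (-κ) ≤ 4 * (T : ℝ) ^ (1 - κ) := by
    calc _ ≤ ∑ s ∈ range T, 2 * ((s : ℝ) + 1) ^ (-κ) :=
          sum_le_sum fun s _ => pool_rpow_neg_le ha ha1 hκ0 (by linarith) s
      _ = 2 * ∑ s ∈ range T, ((s : ℝ) + 1) ^ (-κ) := by rw [mul_sum]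
      _ ≤ _ := by have := sum_rpow_neg_le hκ0 hκ1 T; linarith
  -- The block is at most twice the rate, and √2 ≤ 3/2.
  have hsqrt : ∀ s, √(((sched (2 ^ a) s).block : ℝ) / (sched (2 ^ a) s).pool)
      ≤ 3 / 2 * ((sched (2 ^ a) s).pool : ℝ) ^ (-κ) := by
    intro s
    have hs := schedSpec ha ha1 s
    rw [Real.sqrt_le_left (by have := hN s; positivity), mul_pow, ← Real.rpow_natCast (_ ^ (-κ)),
      ← Real.rpow_mul (hN s).le, div_le_iff₀ (hN s), ← haκ, mul_assoc]
    have e : ((sched (2 ^ a) s).pool : ℝ) ^ ((a - 1) / 2 * ((2 : ℕ) : ℝ)) * (sched (2 ^ a) s).pool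
        = ((sched (2 ^ a) s).pool : ℝ) ^ a := by
      conv_lhs => rw [← Real.rpow_one ((sched (2 ^ a) s).pool : ℝ), ← Real.rpow_mul (hN s).le,
        ← Real.rpow_add (hN s)]
      congr 1; push_cast; ring
    rw [e, ← hs.rate]
    have h1 := hs.block_le
    have h2 := hMp s
    nlinarith
  have hstart : ∑ s ∈ range T, (if (sched (2 ^ a) s).pos = 0 then
      ((sched (2 ^ a) s).block : ℝ) ^ q else 0) ≤ 6 * (T : ℝ) ^ (1 - κ) := by
    refine (sum_block_start_le ha ha1 T).trans ?_
    have h1 : ∀ s, ((sched (2 ^ a) s).block : ℝ) ^ (q - 1)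
        ≤ ((sched (2 ^ a) s).pool : ℝ) ^ (-κ) := by
      intro s
      have hs := schedSpec ha ha1 s
      rw [← haq, Real.rpow_mul (hN s).le, ← hs.rate]
      refine Real.rpow_le_rpow_of_nonpos ?_ hs.rate_le (by linarith)
      rw [hs.rate]; exact Real.rpow_pos_of_pos (hN s) _
    have h2 : ((sched (2 ^ a) T).block : ℝ) ^ q ≤ 2 * (T : ℝ) ^ (1 - κ) := by
      have hs := schedSpec ha ha1 T
      have hNT : ((sched (2 ^ a) T).pool : ℝ) ≤ T := by
        have := hs.pool_le
        exact_mod_cast (by omega : (sched (2 ^ a) T).pool ≤ T)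
      have hr0 : 0 ≤ (sched (2 ^ a) T).rate := by
        rw [hs.rate]; exact Real.rpow_nonneg (hN T).le _
      calc ((sched (2 ^ a) T).block : ℝ) ^ q ≤ (2 * (sched (2 ^ a) T).rate) ^ q :=
            Real.rpow_le_rpow (hMp T).le hs.block_le (by linarith)
        _ = 2 ^ q * (sched (2 ^ a) T).rate ^ q := Real.mul_rpow (by norm_num) hr0
        _ ≤ 2 * (T : ℝ) ^ (1 - κ) := by
          refine mul_le_mul ?_ ?_ (Real.rpow_nonneg hr0 _) (by norm_num)
          · calc (2 : ℝ) ^ q ≤ 2 ^ (1 : ℝ) :=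
                  Real.rpow_le_rpow_of_exponent_le (by norm_num) hq1
              _ = 2 := by simp
          · rw [hs.rate, ← Real.rpow_mul (hN T).le]
            calc _ ≤ (T : ℝ) ^ (a * q) :=
                  Real.rpow_le_rpow (hN T).le hNT (mul_nonneg ha (by linarith))
              _ ≤ _ := by
                  refine Real.rpow_le_rpow_of_exponent_le hT1 ?_
                  have : a * q = a - κ := by linarith
                  linarith
    have h3 := sum_le_sum (s := range T) fun s _ => h1 s
    linarith
  refine iSup_le fun μ => ?_
  refine (hl.gameValue_le_sum (μ : Measure X) hL hH hM ha ha1 T).trans ?_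
  rw [EReal.coe_le_coe_iff]
  calc _ ≤ ∑ s ∈ range T, (L * W * (if (sched (2 ^ a) s).pos = 0 then
          ((sched (2 ^ a) s).block : ℝ) ^ q else 0)
        + L * (3 / 2 * (3 + 2 * √(Real.log T))) * ((sched (2 ^ a) s).pool : ℝ) ^ (-κ)) := by
        refine sum_le_sum fun s hs => ?_
        have hsT := mem_range.1 hs
        have hsp := schedSpec ha ha1 s
        refine (hl.integral_roundCost_le (μ : Measure X) hL hH hM ha ha1 hsT).trans ?_
        refine add_le_add ?_ ?_
        · split_ifs
          · rw [mul_assoc]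
            refine mul_le_mul_of_nonneg_left (hrad _ hsp.block_pos ?_) hL
            have h1 := hsp.block_le_pool
            have h2 := hsp.pool_le
            omega
          · simp
        · rw [mul_assoc]
          refine mul_le_mul_of_nonneg_left ?_ hL
          have := mul_le_mul_of_nonneg_right (hsqrt s)
            (by positivity : 0 ≤ 3 + 2 * √(Real.log T))
          linarith
    _ = L * W * ∑ s ∈ range T, (if (sched (2 ^ a) s).pos = 0 then
          ((sched (2 ^ a) s).block : ℝ) ^ q else 0)
        + L * (3 / 2 * (3 + 2 * √(Real.log T)))
          * ∑ s ∈ range T, ((sched (2 ^ a) s).pool : ℝ) ^ (-κ) := by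
        rw [sum_add_distrib, mul_sum, mul_sum]
    _ ≤ L * W * (6 * (T : ℝ) ^ (1 - κ))
        + L * (3 / 2 * (3 + 2 * √(Real.log T))) * (4 * (T : ℝ) ^ (1 - κ)) :=
        add_le_add (mul_le_mul_of_nonneg_left hstart (mul_nonneg hL hW))
          (mul_le_mul_of_nonneg_left hsum (by positivity))
    _ ≤ _ := by
        have : 0 ≤ L * (T : ℝ) ^ (1 - κ) := by positivity
        nlinarith

end MainBound

/-! ### Rademacher averages of finite families -/

section FiniteClass

/-- Independence of the signs factors the moment into a product of cosh(s v_t), each at most exp(s²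
v_t² / 2). -/
lemma expect_exp_signs_le {T : ℕ} {v : Fin T → ℝ} {b : ℝ} (hv : ∀ t, |v t| ≤ b) (s : ℝ) :
    𝔼 ε : Fin T → ℤˣ, Real.exp (s * ∑ t, ((ε t : ℤ) : ℝ) * v t)
      ≤ Real.exp (s ^ 2 * b ^ 2 * T / 2) := by
  have h1 : ∑ ε : Fin T → ℤˣ, Real.exp (s * ∑ t, ((ε t : ℤ) : ℝ) * v t)
      = ∏ t, (2 * Real.cosh (s * v t)) := by
    have : ∀ t, 2 * Real.cosh (s * v t)
        = ∑ e : ℤˣ, Real.exp (s * (((e : ℤ) : ℝ) * v t)) := by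
      intro t
      have : (Finset.univ : Finset ℤˣ) = {1, -1} := by decide
      rw [this, sum_pair (by decide), Real.cosh_eq]
      push_cast
      ring_nf
    simp only [this]
    rw [prod_univ_sum, Fintype.piFinset_univ]
    refine sum_congr rfl fun ε _ => ?_
    rw [← Real.exp_sum, mul_sum]
  rw [Fintype.expect_eq_sum_div_card, h1, prod_mul_distrib]
  simp only [prod_const, card_univ, Fintype.card_fin, Fintype.card_pi, Fintype.card_units_int]
  push_cast
  rw [mul_div_cancel_left₀ _ (by positivity)]
  calc ∏ t, Real.cosh (s * v t) ≤ ∏ _t : Fin T, Real.exp (s ^ 2 * b ^ 2 / 2) := by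
        refine prod_le_prod (fun t _ => (Real.cosh_pos _).le) fun t _ => ?_
        refine (Real.cosh_le_exp_half_sq _).trans (Real.exp_le_exp.2 ?_)
        have : v t ^ 2 ≤ b ^ 2 := sq_le_sq' (abs_le.1 (hv t)).1 (abs_le.1 (hv t)).2
        rw [mul_pow]
        nlinarith [sq_nonneg s]
    _ = _ := by
        rw [prod_const, card_univ, Fintype.card_fin, ← Real.exp_nat_mul]
        congr 1; ring

/-- Massart's finite class lemma. -/
lemma expect_iSup_signs_le {J : Type*} [Finite J] [Nonempty J] {T : ℕ} (v : J → Fin T → ℝ) {b N : ℝ}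
    (hb : 0 ≤ b) (hv : ∀ j t, |v j t| ≤ b) (hN : 2 ≤ N) (hJ : (Nat.card J : ℝ) ≤ N) :
    𝔼 ε : Fin T → ℤˣ, ⨆ j, ∑ t, ((ε t : ℤ) : ℝ) * v j t ≤ b * √(2 * T * Real.log N) := by
  cases nonempty_fintype J
  rw [Nat.card_eq_fintype_card] at hJ
  have hlog : 0 < Real.log N := Real.log_pos (by linarith)
  rcases eq_or_lt_of_le hb with rfl | hb
  · have : ∀ j t, v j t = 0 := fun j t => abs_nonpos_iff.1 (hv j t)
    simp [this]
  rcases Nat.eq_zero_or_pos T with rfl | hT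
  · simp
  have hT' : (0 : ℝ) < T := by exact_mod_cast hT
  set r := √(2 * T * Real.log N) with hr
  have hr0 : 0 < r := Real.sqrt_pos.2 (by positivity)
  have hr2 : r ^ 2 = 2 * T * Real.log N := Real.sq_sqrt (by positivity)
  -- The minimizer of log N / s + s b² T / 2, whose minimum is b r.
  set s := r / (T * b) with hs
  have hs0 : 0 < s := by positivity
  set c := Real.log N + s ^ 2 * b ^ 2 * T / 2 with hc
  have hpt : ∀ ε : Fin T → ℤˣ, ⨆ j, ∑ t, ((ε t : ℤ) : ℝ) * v j t
      ≤ s⁻¹ * (Real.exp (-c) * ∑ j, Real.exp (s * ∑ t, ((ε t : ℤ) : ℝ) * v j t) + (c - 1)) := by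
    intro ε
    refine ciSup_le fun j => ?_
    have h1 := Real.add_one_le_exp (-c + s * ∑ t, ((ε t : ℤ) : ℝ) * v j t)
    have h2 : Real.exp (s * ∑ t, ((ε t : ℤ) : ℝ) * v j t)
        ≤ ∑ j, Real.exp (s * ∑ t, ((ε t : ℤ) : ℝ) * v j t) :=
      single_le_sum (f := fun j => Real.exp (s * ∑ t, ((ε t : ℤ) : ℝ) * v j t))
        (fun j _ => (Real.exp_pos _).le) (mem_univ j)
    have h3 := mul_le_mul_of_nonneg_left h2 (Real.exp_pos (-c)).le
    rw [Real.exp_add] at h1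
    calc ∑ t, ((ε t : ℤ) : ℝ) * v j t = s⁻¹ * (s * ∑ t, ((ε t : ℤ) : ℝ) * v j t) := by field_simp
      _ ≤ _ := mul_le_mul_of_nonneg_left (by linarith) (by positivity)
  refine (expect_le_expect fun ε _ => hpt ε).trans ?_
  rw [← mul_expect, expect_add_distrib, ← mul_expect, Fintype.expect_const, expect_sum_comm]
  have h4 : ∑ j, 𝔼 ε : Fin T → ℤˣ, Real.exp (s * ∑ t, ((ε t : ℤ) : ℝ) * v j t)
      ≤ N * Real.exp (s ^ 2 * b ^ 2 * T / 2) := by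
    refine (sum_le_card_nsmul _ _ _ fun j _ => expect_exp_signs_le (hv j) s).trans ?_
    rw [nsmul_eq_mul, card_univ]
    exact mul_le_mul_of_nonneg_right hJ (Real.exp_pos _).le
  have h5 : Real.exp (-c) * (N * Real.exp (s ^ 2 * b ^ 2 * T / 2)) = 1 := by
    rw [hc, neg_add, Real.exp_add, Real.exp_neg, Real.exp_neg, Real.exp_log (by linarith)]
    have := (Real.exp_pos (s ^ 2 * b ^ 2 * T / 2)).ne'
    field_simp
  have h6 := mul_le_mul_of_nonneg_left h4 (Real.exp_pos (-c)).le
  rw [h5] at h6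
  calc _ ≤ s⁻¹ * (1 + (c - 1)) := mul_le_mul_of_nonneg_left (by linarith) (by positivity)
    _ = s⁻¹ * c := by ring
    _ = b * r := by
      have h7 : Real.log N = r ^ 2 / (2 * T) := by rw [hr2]; field_simp
      rw [hc, h7, hs]
      field_simp
      ring

/-- A set of at most d points is listed by d slots, each holding a point or nothing. -/
lemma card_filter_card_le {α : Type*} [Fintype α] [DecidableEq α] (d : ℕ) :
    #{s : Finset α | #s ≤ d} ≤ (Fintype.card α + 1) ^ d := by
  have hsub : ({s : Finset α | #s ≤ d} : Finset (Finset α)) ⊆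
      univ.image fun f : Fin d → Option α => (univ.image f).eraseNone := by
    intro s hs
    simp only [mem_filter, mem_univ, true_and] at hs
    refine mem_image.2 ⟨fun i => s.toList[(i : ℕ)]?, mem_univ _, ?_⟩
    ext a
    simp only [mem_eraseNone, mem_image, mem_univ, true_and]
    rw [← mem_toList, List.mem_iff_getElem?]
    constructor
    · rintro ⟨i, hi⟩; exact ⟨i, hi⟩
    · rintro ⟨i, hi⟩
      have : i < s.toList.length := (List.getElem?_eq_some_iff.1 hi).1
      rw [length_toList] at this
      exact ⟨⟨i, by omega⟩, hi⟩
  refine (card_le_card hsub).trans (card_image_le.trans (le_of_eq ?_))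
  simp

end FiniteClass

/-! ### Classes of finite VC-dimension -/

section VC

variable {X : Type u} {H : Set (X → I)}

/-- A binary hypothesis matters only through its trace on x. By Sauer–Shelah there are at most (T +
1)^d traces, to which Massart's lemma applies. -/
lemma rademacherAt_le_of_vcDim (hH : H.Nonempty) (hB : IsBinary H) {d : ℕ} (hd : 1 ≤ d)
    (hvc : vcDim H ≤ (d : ℕ∞)) {T : ℕ} (hT : 1 ≤ T) (x : Fin T → X) :
    rademacherAt H x ≤ √(2 * T * (d * Real.log (T + 1))) := by
  classical
  let 𝒜 : Finset (Finset (Fin T)) := univ.filter fun A => ∃ h ∈ H, ∀ t, t ∈ A ↔ h (x t) = 1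
  have hmem : ∀ h ∈ H, (univ.filter fun t => h (x t) = 1) ∈ 𝒜 := fun h hh =>
    mem_filter.2 ⟨mem_univ _, h, hh, fun t => by simp⟩
  have hsh : 𝒜.shatterer ⊆ ({s : Finset (Fin T) | #s ≤ d} : Finset (Finset (Fin T))) := by
    intro s hs
    rw [mem_shatterer] at hs
    -- The tuple may repeat features, but not inside a shattered index set: a trace that cuts out
    -- {t} cannot distinguish t from t' when x t = x t'.
    have hinj : Set.InjOn x s := by
      intro t ht t' ht' htt
      obtain ⟨A, hA, hsA⟩ := hs (t := {t}) (by simpa using ht)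
      obtain ⟨h, -, hh⟩ := (mem_filter.1 hA).2
      have e1 : t ∈ s ∩ A := by rw [hsA]; simp
      have e2 : t' ∈ A := by rw [hh, ← htt, ← hh]; exact (mem_inter.1 e1).2
      have e3 : t' ∈ s ∩ A := mem_inter.2 ⟨ht', e2⟩
      rw [hsA, mem_singleton] at e3
      exact e3.symm
    have hS : Shatters H (s.image x) := by
      intro B hB'
      obtain ⟨A, hA, hsA⟩ := hs (t := s.filter fun t => x t ∈ B) (filter_subset _ _)
      obtain ⟨h, hhH, hh⟩ := (mem_filter.1 hA).2
      refine ⟨h, hhH, fun z hz => ?_⟩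
      obtain ⟨t, ht, rfl⟩ := mem_image.1 hz
      have e : t ∈ A ↔ x t ∈ B := by
        constructor
        · intro h1
          have : t ∈ s ∩ A := mem_inter.2 ⟨ht, h1⟩
          rw [hsA] at this
          exact (mem_filter.1 this).2
        · intro h1
          have : t ∈ s ∩ A := by rw [hsA]; exact mem_filter.2 ⟨ht, h1⟩
          exact (mem_inter.1 this).2
      refine ⟨fun h1 => (hh t).1 (e.2 h1), fun h1 => ?_⟩
      exact (hB h hhH (x t)).resolve_right fun h2 => h1 (e.1 ((hh t).2 h2))
    have hc : ((s.image x).card : ℕ∞) ≤ d :=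
      (le_iSup₂ (f := fun (S : Finset X) (_ : Shatters H S) => (S.card : ℕ∞)) _ hS).trans hvc
    rw [card_image_of_injOn hinj] at hc
    exact mem_filter.2 ⟨mem_univ _, by exact_mod_cast hc⟩
  have hcard : #𝒜 ≤ (T + 1) ^ d := by
    refine (card_le_card_shatterer 𝒜).trans ((card_le_card hsh).trans ?_)
    simpa using card_filter_card_le (α := Fin T) d
  obtain ⟨h₀, hh₀⟩ := hH
  have : Nonempty 𝒜 := ⟨⟨_, hmem h₀ hh₀⟩⟩
  have : Nonempty H := ⟨⟨h₀, hh₀⟩⟩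
  have key := expect_iSup_signs_le (J := 𝒜) (T := T)
    (fun A t => if t ∈ A.1 then 1 else 0) (b := 1) (N := ((T : ℝ) + 1) ^ d) zero_le_one
    (fun A t => by split_ifs <;> simp) ?_ ?_
  · rw [Real.log_pow, one_mul] at key
    refine le_trans (expect_le_expect fun ε _ => ciSup_le fun h => ?_) key
    refine le_trans (le_of_eq ?_) (le_ciSup (Set.finite_range _).bddAbove ⟨_, hmem h.1 h.2⟩)
    refine sum_congr rfl fun t _ => ?_
    rcases hB h.1 h.2 (x t) with h1 | h1 <;> simp [h1]
  · have h2 : (2 : ℝ) ≤ (T : ℝ) + 1 := by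
      have : (1 : ℝ) ≤ T := by exact_mod_cast hT
      linarith
    calc (2 : ℝ) ≤ ((T : ℝ) + 1) ^ 1 := by simpa using h2
      _ ≤ _ := pow_le_pow_right₀ (by linarith) hd
  · rw [Nat.card_eq_fintype_card, Fintype.card_coe]
    exact_mod_cast hcard

end VC

/-! ### Separated families of integer-valued functions -/

section Separated

variable {ι : Type*} [Fintype ι] [DecidableEq ι]

/-- The graphs of the partial functions that are strongly shattered by a family of functions with
values in `{0, …, b - 1}`. -/
noncomputable def shatteredGraphs (b : ℕ) (F : Finset (ι → ℕ)) : Finset (Finset (ι × Fin b)) :=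
  open Classical in
  univ.filter fun G => Set.InjOn Prod.fst (G : Set (ι × Fin b)) ∧
    ∀ B : Finset ι, ∃ f ∈ F, ∀ p ∈ G,
      (p.1 ∈ B → (p.2 : ℕ) + 1 ≤ f p.1) ∧ (p.1 ∉ B → f p.1 + 1 ≤ p.2)

/-- Two functions are separated if they differ by at least two somewhere. -/
def Separated (f g : ι → ℕ) : Prop := ∃ i, f i + 2 ≤ g i ∨ g i + 2 ≤ f i

lemma mem_shatteredGraphs {b : ℕ} {F : Finset (ι → ℕ)} {G : Finset (ι × Fin b)} :
    G ∈ shatteredGraphs b F ↔ Set.InjOn Prod.fst (G : Set (ι × Fin b)) ∧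
      ∀ B : Finset ι, ∃ f ∈ F, ∀ p ∈ G,
        (p.1 ∈ B → (p.2 : ℕ) + 1 ≤ f p.1) ∧ (p.1 ∉ B → f p.1 + 1 ≤ p.2) := by
  simp [shatteredGraphs]

lemma shatteredGraphs_mono {b : ℕ} {F F' : Finset (ι → ℕ)} (h : F ⊆ F') :
    shatteredGraphs b F ⊆ shatteredGraphs b F' := by
  intro G hG
  rw [mem_shatteredGraphs] at hG ⊢
  refine ⟨hG.1, fun B => ?_⟩
  obtain ⟨f, hf, hf'⟩ := hG.2 B
  exact ⟨f, h hf, hf'⟩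

/-- A point above i would need members of F both above and below its level, but all of them take the
same value at i. -/
lemma fst_ne_of_mem_shatteredGraphs {b : ℕ} {F : Finset (ι → ℕ)} {i : ι} {u : ℕ}
    (hF : ∀ f ∈ F, f i = u) {G : Finset (ι × Fin b)} (hG : G ∈ shatteredGraphs b F)
    {p : ι × Fin b} (hp : p ∈ G) : p.1 ≠ i := by
  rintro rfl
  rw [mem_shatteredGraphs] at hG
  obtain ⟨f, hf, hf'⟩ := hG.2 univ
  obtain ⟨g, hg, hg'⟩ := hG.2 ∅
  have h1 := (hf' p hp).1 (mem_univ _)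
  have h2 := (hg' p hp).2 (by simp)
  rw [hF f hf] at h1
  rw [hF g hg] at h2
  omega

/-- If two subfamilies take values at least two apart at a point, the number of shattered graphs is
superadditive. -/
lemma card_shatteredGraphs_add_le {b : ℕ} {F F₁ F₂ : Finset (ι → ℕ)} (h₁ : F₁ ⊆ F) (h₂ : F₂ ⊆ F)
    {i : ι} {u v : ℕ} (hu : ∀ f ∈ F₁, f i = u) (hv : ∀ f ∈ F₂, f i = v) (huv : v + 2 ≤ u)
    (hub : u < b) :
    #(shatteredGraphs b F₁) + #(shatteredGraphs b F₂) ≤ #(shatteredGraphs b F) := by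
  classical
  set S₁ := shatteredGraphs b F₁
  set S₂ := shatteredGraphs b F₂
  -- At i the level v + 1 lies strictly between the values v and u. A graph shattered by both
  -- subfamilies therefore stays shattered by F when p₀ is added, using F₁ above the level and F₂
  -- below. Such graphs are thus counted twice.
  let p₀ : ι × Fin b := (i, ⟨v + 1, by omega⟩)
  have hnot : ∀ G ∈ S₁ ∪ S₂, ∀ p ∈ G, p.1 ≠ i := by
    intro G hG p hp
    rcases mem_union.1 hG with hG | hG
    · exact fst_ne_of_mem_shatteredGraphs hu hG hp
    · exact fst_ne_of_mem_shatteredGraphs hv hG hp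
  have hnot' : ∀ G ∈ S₁ ∪ S₂, p₀ ∉ G := fun G hG hp => hnot G hG p₀ hp rfl
  have hinj : Set.InjOn (insert p₀) ((S₁ ∩ S₂ : Finset _) : Set (Finset (ι × Fin b))) := by
    intro G hG G' hG' h
    have e1 : p₀ ∉ G := hnot' G (mem_union_left _ (mem_inter.1 hG).1)
    have e2 : p₀ ∉ G' := hnot' G' (mem_union_left _ (mem_inter.1 hG').1)
    rw [← erase_insert e1, ← erase_insert e2]
    exact congrArg (fun s => s.erase p₀) h
  have hdisj : Disjoint (S₁ ∪ S₂) ((S₁ ∩ S₂).image (insert p₀)) := by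
    rw [disjoint_left]
    intro G hG hG'
    obtain ⟨G', -, rfl⟩ := mem_image.1 hG'
    exact hnot' _ hG (mem_insert_self _ _)
  have hsub : (S₁ ∪ S₂) ∪ (S₁ ∩ S₂).image (insert p₀) ⊆ shatteredGraphs b F := by
    refine union_subset (union_subset (shatteredGraphs_mono h₁) (shatteredGraphs_mono h₂)) ?_
    intro G' hG'
    obtain ⟨G, hG, rfl⟩ := mem_image.1 hG'
    have hG1 := mem_shatteredGraphs.1 (mem_inter.1 hG).1
    have hG2 := mem_shatteredGraphs.1 (mem_inter.1 hG).2
    have hne := hnot G (mem_union_left _ (mem_inter.1 hG).1)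
    rw [mem_shatteredGraphs]
    constructor
    · rw [coe_insert,
        Set.injOn_insert (by simpa using hnot' G (mem_union_left _ (mem_inter.1 hG).1))]
      refine ⟨hG1.1, ?_⟩
      rintro ⟨p, hp, hpi⟩
      exact hne p hp hpi
    · intro B
      by_cases hB : i ∈ B
      · obtain ⟨f, hf, hf'⟩ := hG1.2 B
        refine ⟨f, h₁ hf, fun p hp => ?_⟩
        rcases mem_insert.1 hp with rfl | hp
        · exact ⟨fun _ => by simp only [p₀]; rw [hu f hf]; omega, fun h => absurd hB h⟩
        · exact hf' p hp
      · obtain ⟨f, hf, hf'⟩ := hG2.2 B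
        refine ⟨f, h₂ hf, fun p hp => ?_⟩
        rcases mem_insert.1 hp with rfl | hp
        · exact ⟨fun h => absurd h hB, fun _ => by simp only [p₀]; rw [hv f hf]⟩
        · exact hf' p hp
  calc #S₁ + #S₂ = #(S₁ ∪ S₂) + #(S₁ ∩ S₂) := (card_union_add_card_inter _ _).symm
    _ = #(S₁ ∪ S₂) + #((S₁ ∩ S₂).image (insert p₀)) := by rw [card_image_of_injOn hinj]
    _ = #((S₁ ∪ S₂) ∪ (S₁ ∩ S₂).image (insert p₀)) := (card_union_of_disjoint hdisj).symm
    _ ≤ _ := card_le_card hsub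

/-- A large separated family contains two large subfamilies that take two values at least two apart
at some point. -/
lemma exists_split [Nonempty ι] {b h : ℕ} (hb : 1 ≤ b) {F : Finset (ι → ℕ)}
    (hFb : ∀ f ∈ F, ∀ i, f i < b) (hsep : ∀ f ∈ F, ∀ g ∈ F, f ≠ g → Separated f g)
    (hcard : 2 * (Fintype.card ι * b ^ 2 * h) ≤ #F) :
    ∃ F₁ ⊆ F, ∃ F₂ ⊆ F, h ≤ #F₁ ∧ h ≤ #F₂ ∧ (h ≠ 0 → ∃ i u v, (∀ f ∈ F₁, f i = u) ∧
      (∀ f ∈ F₂, f i = v) ∧ v + 2 ≤ u ∧ u < b) := by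
  classical
  rcases Nat.eq_zero_or_pos h with rfl | hh
  · exact ⟨∅, by simp, ∅, by simp, by simp, by simp, by simp⟩
  -- Take 2P members in P disjoint pairs. Each pair is separated at some point with two values, and
  -- the pigeonhole principle over the |ι| b² possible triples leaves h pairs sharing one triple.
  set P := Fintype.card ι * b ^ 2 * h with hP
  let e : Fin (2 * P) → (ι → ℕ) := fun k => (F.equivFin.symm (Fin.castLE hcard k)).1
  have heF : ∀ k, e k ∈ F := fun k => (F.equivFin.symm (Fin.castLE hcard k)).2
  have heinj : Function.Injective e := fun k k' hk =>
    Fin.castLE_injective hcard (F.equivFin.symm.injective (Subtype.ext hk))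
  let k₀ : Fin P → Fin (2 * P) := fun p => ⟨2 * p, by omega⟩
  let k₁ : Fin P → Fin (2 * P) := fun p => ⟨2 * p + 1, by omega⟩
  have hpair : ∀ p : Fin P, ∃ (i : ι) (k k' : Fin (2 * P)), (k : ℕ) / 2 = p ∧ (k' : ℕ) / 2 = p ∧
      e k' i + 2 ≤ e k i := by
    intro p
    have hne : e (k₀ p) ≠ e (k₁ p) := fun h => by
      have := congrArg Fin.val (heinj h)
      simp [k₀, k₁] at this
    obtain ⟨i, hi | hi⟩ := hsep _ (heF _) _ (heF _) hne
    · exact ⟨i, k₁ p, k₀ p, by simp only [k₁]; omega, by simp only [k₀]; omega, hi⟩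
    · exact ⟨i, k₀ p, k₁ p, by simp only [k₀]; omega, by simp only [k₁]; omega, hi⟩
  choose idx hi lo hhi hlo hdiff using hpair
  have hhinj : Function.Injective fun p => e (hi p) := fun p p' h => by
    have := heinj h
    exact Fin.ext (by rw [← hhi p, ← hhi p', this])
  have hlinj : Function.Injective fun p => e (lo p) := fun p p' h => by
    have := heinj h
    exact Fin.ext (by rw [← hlo p, ← hlo p', this])
  obtain ⟨⟨i, u, v⟩, -, hy⟩ := exists_le_card_fiber_of_mul_le_card_of_maps_to
    (s := (univ : Finset (Fin P))) (t := (univ : Finset (ι × Fin b × Fin b)))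
    (f := fun p => (idx p, ⟨e (hi p) (idx p), hFb _ (heF _) _⟩,
      ⟨e (lo p) (idx p), hFb _ (heF _) _⟩)) (n := h) (fun _ _ => mem_univ _)
    (by have : Nonempty (Fin b) := ⟨⟨0, by omega⟩⟩
        exact univ_nonempty)
    (le_of_eq (by simp only [card_univ, Fintype.card_prod, Fintype.card_fin, hP]; ring))
  set s : Finset (Fin P) := univ.filter fun p => (idx p,
      (⟨e (hi p) (idx p), hFb _ (heF _) _⟩ : Fin b),
      (⟨e (lo p) (idx p), hFb _ (heF _) _⟩ : Fin b)) = (i, u, v) with hs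
  have hmem : ∀ p ∈ s, idx p = i ∧ e (hi p) i = u ∧ e (lo p) i = v := by
    intro p hp
    have := (mem_filter.1 hp).2
    simp only [Prod.mk.injEq] at this
    obtain ⟨h1, h2, h3⟩ := this
    refine ⟨h1, ?_, ?_⟩
    · rw [← h2, ← h1]
    · rw [← h3, ← h1]
  refine ⟨s.image fun p => e (hi p), ?_, s.image fun p => e (lo p), ?_, ?_, ?_, fun _ =>
    ⟨i, u, v, ?_, ?_, ?_, u.2⟩⟩
  · intro f hf; obtain ⟨p, -, rfl⟩ := mem_image.1 hf; exact heF _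
  · intro f hf; obtain ⟨p, -, rfl⟩ := mem_image.1 hf; exact heF _
  · rwa [card_image_of_injective _ hhinj]
  · rwa [card_image_of_injective _ hlinj]
  · intro f hf; obtain ⟨p, hp, rfl⟩ := mem_image.1 hf; exact (hmem p hp).2.1
  · intro f hf; obtain ⟨p, hp, rfl⟩ := mem_image.1 hf; exact (hmem p hp).2.2
  · obtain ⟨p, hp⟩ : s.Nonempty := card_pos.1 (hh.trans_le hy)
    obtain ⟨h1, h2, h3⟩ := hmem p hp
    have := hdiff p
    rw [h1, h2, h3] at this
    exact this

/-- Each split reduces the size by a factor 2 |ι| b², and superadditivity over the two parts doubles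
the number of graphs. -/
lemma two_pow_le_card_shatteredGraphs [Nonempty ι] {b : ℕ} (hb : 1 ≤ b) (k : ℕ) :
    ∀ F : Finset (ι → ℕ), (∀ f ∈ F, ∀ i, f i < b) →
      (∀ f ∈ F, ∀ g ∈ F, f ≠ g → Separated f g) →
      (2 * Fintype.card ι * b ^ 2) ^ k ≤ #F → 2 ^ k ≤ #(shatteredGraphs b F) := by
  induction k with
  | zero =>
    intro F _ _ hF
    rw [pow_zero] at hF ⊢
    obtain ⟨f, hf⟩ := card_pos.1 hF
    exact card_pos.2 ⟨∅, mem_shatteredGraphs.2 ⟨by simp, fun B => ⟨f, hf, by simp⟩⟩⟩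
  | succ k ih =>
    intro F hFb hsep hF
    obtain ⟨F₁, h₁, F₂, h₂, c₁, c₂, h⟩ := exists_split hb hFb hsep
      (h := (2 * Fintype.card ι * b ^ 2) ^ k) (le_trans (le_of_eq (by ring)) hF)
    obtain ⟨i, u, v, hu, hv, huv, hub⟩ := h (by positivity)
    have e₁ := ih F₁ (fun f hf => hFb f (h₁ hf))
      (fun f hf g hg => hsep f (h₁ hf) g (h₁ hg)) c₁
    have e₂ := ih F₂ (fun f hf => hFb f (h₂ hf))
      (fun f hf g hg => hsep f (h₂ hf) g (h₂ hg)) c₂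
    have := card_shatteredGraphs_add_le h₁ h₂ hu hv huv hub
    rw [pow_succ]
    omega

/-- Separated families whose strongly shattered graphs are small are not too large. -/
lemma card_separated_lt [Nonempty ι] {b d k : ℕ} (hb : 1 ≤ b) {F : Finset (ι → ℕ)}
    (hFb : ∀ f ∈ F, ∀ i, f i < b) (hsep : ∀ f ∈ F, ∀ g ∈ F, f ≠ g → Separated f g)
    (hd : ∀ G ∈ shatteredGraphs b F, #G ≤ d) (hk : (Fintype.card ι * b + 1) ^ d < 2 ^ k) :
    #F < (2 * Fintype.card ι * b ^ 2) ^ k := by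
  by_contra! h
  have h1 := two_pow_le_card_shatteredGraphs hb k F hFb hsep h
  have h2 : #(shatteredGraphs b F) ≤ (Fintype.card (ι × Fin b) + 1) ^ d := by
    refine (card_le_card fun G hG => ?_).trans (card_filter_card_le d)
    exact mem_filter.2 ⟨mem_univ _, hd G hG⟩
  simp only [Fintype.card_prod, Fintype.card_fin] at h2
  omega

end Separated

/-! ### Classes of finite fat-shattering dimension -/

section Fat

variable {X : Type u} {H : Set (X → I)}

/-- The values of `h` along `x`, rounded down to multiples of `2 ^ (-j)`. -/
noncomputable def discretize {T : ℕ} (x : Fin T → X) (j : ℕ) (h : X → I) (t : Fin T) : ℕ :=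
  ⌊(h (x t) : ℝ) * 2 ^ j⌋₊

lemma discretize_lt {T : ℕ} (x : Fin T → X) (j : ℕ) (h : X → I) (t : Fin T) :
    discretize x j h t < 2 ^ j + 1 := by
  rw [Nat.lt_succ_iff]
  refine Nat.floor_le_of_le ?_
  push_cast
  exact mul_le_of_le_one_left (by positivity) (h (x t)).2.2

lemma discretize_le {T : ℕ} (x : Fin T → X) (j : ℕ) (h : X → I) (t : Fin T) :
    (discretize x j h t : ℝ) ≤ (h (x t) : ℝ) * 2 ^ j :=
  Nat.floor_le (mul_nonneg (h (x t)).2.1 (by positivity))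

lemma lt_discretize_add_one {T : ℕ} (x : Fin T → X) (j : ℕ) (h : X → I) (t : Fin T) :
    (h (x t) : ℝ) * 2 ^ j < discretize x j h t + 1 :=
  Nat.lt_floor_add_one _

/-- A graph shattered by discretized hypotheses yields a fat-shattered set of the same size. -/
lemma exists_fatShatters_of_mem_shatteredGraphs {T : ℕ} (x : Fin T → X) (j : ℕ)
    {F : Finset (Fin T → ℕ)} (hF : ∀ f ∈ F, ∃ h ∈ H, discretize x j h = f)
    {G : Finset (Fin T × Fin (2 ^ j + 1))} (hG : G ∈ shatteredGraphs (2 ^ j + 1) F) :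
    ∃ S : Finset X, FatShatters H (1 / 2 ^ (j + 1)) S ∧ #S = #G := by
  classical
  rw [mem_shatteredGraphs] at hG
  obtain ⟨hinj, hG⟩ := hG
  -- Features may repeat along x. Over one feature, asking for values above p and below p' forces
  -- the level of p under that of p'. Exchanging the roles is contradictory, so G projects
  -- injectively to features.
  have hlt : ∀ p ∈ G, ∀ p' ∈ G, x p.1 = x p'.1 → p ≠ p' → (p.2 : ℕ) < p'.2 := by
    intro p hp p' hp' hx hne
    have h1 : p'.1 ∉ ({p.1} : Finset (Fin T)) := by
      rw [mem_singleton]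
      exact fun h => hne (hinj hp hp' h.symm)
    obtain ⟨f, hf, hf'⟩ := hG {p.1}
    obtain ⟨h, -, rfl⟩ := hF f hf
    have h2 := (hf' p hp).1 (mem_singleton_self _)
    have h3 := (hf' p' hp').2 h1
    have h4 : discretize x j h p.1 = discretize x j h p'.1 := by simp only [discretize, hx]
    omega
  have hxinj : Set.InjOn (fun p : Fin T × Fin (2 ^ j + 1) => x p.1)
      (G : Set (Fin T × Fin (2 ^ j + 1))) := by
    intro p hp p' hp' hx
    by_contra hne
    have h1 := hlt p hp p' hp' hx hne
    have h2 := hlt p' hp' p hp hx.symm (Ne.symm hne)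
    omega
  refine ⟨G.image fun p => x p.1, ?_, card_image_of_injOn hxinj⟩
  -- The witness sits half a unit above the level. Integer values that avoid the level then leave a
  -- margin of half a unit on both sides, that is 2^(−j−1).
  let r : X → ℝ := fun z =>
    if hz : ∃ p ∈ G, x p.1 = z then (((hz.choose.2 : ℕ) : ℝ) + 1 / 2) / 2 ^ j else 0
  have hr : ∀ p ∈ G, r (x p.1) = (((p.2 : ℕ) : ℝ) + 1 / 2) / 2 ^ j := by
    intro p hp
    have hz : ∃ p' ∈ G, x p'.1 = x p.1 := ⟨p, hp, rfl⟩
    have : hz.choose = p := hxinj hz.choose_spec.1 hp hz.choose_spec.2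
    simp only [r, dif_pos hz, this]
  have hpos : (0 : ℝ) < 2 ^ j := by positivity
  refine ⟨r, fun A _ => ?_⟩
  obtain ⟨f, hf, hf'⟩ := hG (univ.filter fun t => x t ∈ A)
  obtain ⟨h, hh, rfl⟩ := hF f hf
  refine ⟨h, hh, fun z hz => ?_⟩
  obtain ⟨p, hp, rfl⟩ := mem_image.1 hz
  simp only [hr p hp]
  obtain ⟨h1, h2⟩ := hf' p hp
  simp only [mem_filter, mem_univ, true_and] at h1 h2
  constructor
  · intro hA
    have h3 : ((p.2 : ℕ) : ℝ) + 1 ≤ discretize x j h p.1 := by exact_mod_cast h1 hA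
    have h4 := h3.trans (discretize_le x j h p.1)
    rw [← div_le_iff₀ hpos] at h4
    refine le_trans (le_of_eq ?_) h4
    rw [pow_succ]; field_simp; ring
  · intro hA
    have h3 : (discretize x j h p.1 : ℝ) + 1 ≤ ((p.2 : ℕ) : ℝ) := by exact_mod_cast h2 hA
    have h4 := ((lt_discretize_add_one x j h p.1).trans_le h3).le
    rw [← le_div_iff₀ hpos] at h4
    refine h4.trans (le_of_eq ?_)
    rw [pow_succ]; field_simp; ring

/-- Classes of finite fat-shattering dimension have small uniform covers. -/
lemma exists_cover {T : ℕ} (hT : 1 ≤ T) (x : Fin T → X) {j d k : ℕ}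
    (hd : ∀ S : Finset X, FatShatters H (1 / 2 ^ (j + 1)) S → #S ≤ d)
    (hk : (T * (2 ^ j + 1) + 1) ^ d < 2 ^ k) :
    ∃ F : Finset (Fin T → ℝ), #F ≤ (2 * T * (2 ^ j + 1) ^ 2) ^ k ∧
      ∀ h ∈ H, ∃ f ∈ F, ∀ t, |(h (x t) : ℝ) - f t| ≤ 2 / 2 ^ j := by
  classical
  have : Nonempty (Fin T) := ⟨⟨0, hT⟩⟩
  have hb : 1 ≤ 2 ^ j + 1 := Nat.le_add_left 1 _
  have hpos : (0 : ℝ) < 2 ^ j := by positivity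
  let D : Finset (Fin T → ℕ) :=
    (Fintype.piFinset fun _ => range (2 ^ j + 1)).filter fun f => ∃ h ∈ H, discretize x j h = f
  have hD : ∀ h ∈ H, discretize x j h ∈ D := fun h hh =>
    mem_filter.2 ⟨Fintype.mem_piFinset.2 fun t => mem_range.2 (discretize_lt x j h t), h, hh, rfl⟩
  -- A separated family of maximal size is a net: any discretized hypothesis differs from some
  -- member by at most one everywhere, hence by at most two units before rounding.
  obtain ⟨F, hF, hmax⟩ := exists_max_image
    (D.powerset.filter fun F => ∀ f ∈ F, ∀ g ∈ F, f ≠ g → Separated f g) card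
    ⟨∅, mem_filter.2 ⟨empty_mem_powerset _, by simp⟩⟩
  obtain ⟨hFD, hsep⟩ := mem_filter.1 hF
  rw [mem_powerset] at hFD
  have hcard := card_separated_lt (b := 2 ^ j + 1) (d := d) (k := k) hb (F := F)
    (fun f hf t => mem_range.1 (Fintype.mem_piFinset.1 (mem_filter.1 (hFD hf)).1 t)) hsep
    (fun G hG => by
      obtain ⟨S, hS, hSG⟩ := exists_fatShatters_of_mem_shatteredGraphs x j
        (fun f hf => (mem_filter.1 (hFD hf)).2) hG
      exact hSG ▸ hd S hS)
    (by rwa [Fintype.card_fin])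
  rw [Fintype.card_fin] at hcard
  refine ⟨F.image fun f t => (f t : ℝ) / 2 ^ j, card_image_le.trans hcard.le, fun h hh => ?_⟩
  obtain ⟨f, hf, hnear⟩ : ∃ f ∈ F, ¬ Separated f (discretize x j h) := by
    by_contra! hcon
    have hnot : discretize x j h ∉ F := by
      intro hmem
      obtain ⟨i, hi⟩ := hcon _ hmem
      omega
    have hsep' : ∀ f ∈ insert (discretize x j h) F, ∀ g ∈ insert (discretize x j h) F,
        f ≠ g → Separated f g := by
      intro f hf g hg hne
      rcases mem_insert.1 hf with rfl | hf
      · rcases mem_insert.1 hg with rfl | hg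
        · exact absurd rfl hne
        · obtain ⟨i, hi⟩ := hcon g hg
          exact ⟨i, hi.symm⟩
      · rcases mem_insert.1 hg with rfl | hg
        · exact hcon f hf
        · exact hsep f hf g hg hne
    have := hmax _ (mem_filter.2 ⟨mem_powerset.2 (insert_subset (hD h hh) hFD), hsep'⟩)
    rw [card_insert_of_notMem hnot] at this
    omega
  refine ⟨_, mem_image_of_mem _ hf, fun t => ?_⟩
  have h1 := discretize_le x j h t
  have h2 := lt_discretize_add_one x j h t
  have h3 : ¬ (f t + 2 ≤ discretize x j h t ∨ discretize x j h t + 2 ≤ f t) :=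
    fun h => hnear ⟨t, h⟩
  have h4 : (discretize x j h t : ℝ) ≤ f t + 1 := by
    have : discretize x j h t ≤ f t + 1 := by omega
    exact_mod_cast this
  have h5 : (f t : ℝ) ≤ discretize x j h t + 1 := by
    have : f t ≤ discretize x j h t + 1 := by omega
    exact_mod_cast this
  have h6 : (h (x t) : ℝ) - f t / 2 ^ j = ((h (x t) : ℝ) * 2 ^ j - f t) / 2 ^ j := by field_simp
  rw [h6, abs_div, abs_of_pos hpos]
  refine div_le_div_of_nonneg_right (abs_le.2 ⟨?_, ?_⟩) hpos.le <;> linarith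

/-- Dyadic chaining. -/
lemma rademacherAt_le_of_covers (hH : H.Nonempty) {T : ℕ} (x : Fin T → X) (K : ℕ)
    (F : ℕ → Finset (Fin T → ℝ)) (hF0 : F 0 = {0})
    (hF : ∀ j ≤ K, ∀ h ∈ H, ∃ f ∈ F j, ∀ t, |(h (x t) : ℝ) - f t| ≤ 2 / 2 ^ j)
    (N : ℕ → ℝ) (hN : ∀ j < K, 2 ≤ N j) (hFN : ∀ j < K, ((#(F j) * #(F (j + 1)) : ℕ) : ℝ) ≤ N j) :
    rademacherAt H x ≤ 2 * T / 2 ^ K + ∑ j ∈ range K, 3 / 2 ^ j * √(2 * T * Real.log (N j)) := by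
  classical
  choose! e heF he using hF
  -- The links of the chain between scales j and j + 1. Their size is at most 2/2^j + 2/2^(j+1) =
  -- 3/2^j, and the filter keeps only differences within this radius.
  let D : ℕ → Finset (Fin T → ℝ) := fun j =>
    ((F j ×ˢ F (j + 1)).image fun p => p.2 - p.1).filter fun v => ∀ t, |v t| ≤ 3 / 2 ^ j
  have hD : ∀ j < K, ∀ h ∈ H, e (j + 1) h - e j h ∈ D j := by
    intro j hj h hh
    refine mem_filter.2 ⟨mem_image.2 ⟨(e j h, e (j + 1) h),
      mem_product.2 ⟨heF j hj.le h hh, heF (j + 1) hj h hh⟩, rfl⟩, fun t => ?_⟩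
    have h1 := abs_le.1 (he j hj.le h hh t)
    have h2 := abs_le.1 (he (j + 1) hj h hh t)
    have h3 : (2 : ℝ) / 2 ^ j + 2 / 2 ^ (j + 1) = 3 / 2 ^ j := by
      rw [pow_succ]; field_simp; norm_num
    rw [Pi.sub_apply, abs_le]
    constructor <;> linarith [h1.1, h1.2, h2.1, h2.2]
  have hne : Nonempty H := hH.to_subtype
  have hmass : ∀ j < K, 𝔼 ε : Fin T → ℤˣ, ⨆ v : D j, ∑ t, ((ε t : ℤ) : ℝ) * v.1 t
      ≤ 3 / 2 ^ j * √(2 * T * Real.log (N j)) := by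
    intro j hj
    obtain ⟨h, hh⟩ := hH
    have : Nonempty (D j) := ⟨⟨_, hD j hj h hh⟩⟩
    refine expect_iSup_signs_le (fun v : D j => v.1) (by positivity)
      (fun v t => (mem_filter.1 v.2).2 t) (hN j hj) (le_trans ?_ (hFN j hj))
    rw [Nat.card_eq_fintype_card, Fintype.card_coe]
    exact_mod_cast (card_filter_le _ _).trans (card_image_le.trans (card_product _ _).le)
  have hpt : ∀ ε : Fin T → ℤˣ, ⨆ h : H, ∑ t, ((ε t : ℤ) : ℝ) * (h.1 (x t) : ℝ)
      ≤ 2 * T / 2 ^ K + ∑ j ∈ range K, ⨆ v : D j, ∑ t, ((ε t : ℤ) : ℝ) * v.1 t := by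
    intro ε
    refine ciSup_le fun h => ?_
    have h0 : e 0 h.1 = 0 := by
      have := heF 0 (Nat.zero_le _) h.1 h.2
      rwa [hF0, mem_singleton] at this
    have h1 : ∀ t, (h.1 (x t) : ℝ)
        = (h.1 (x t) - e K h.1 t) + ∑ j ∈ range K, (e (j + 1) h.1 t - e j h.1 t) := by
      intro t
      rw [sum_range_sub (fun j => e j h.1 t), h0]
      simp
    have h2 : ∑ t, ((ε t : ℤ) : ℝ) * (h.1 (x t) : ℝ)
        = ∑ t, ((ε t : ℤ) : ℝ) * (h.1 (x t) - e K h.1 t)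
          + ∑ j ∈ range K, ∑ t, ((ε t : ℤ) : ℝ) * (e (j + 1) h.1 - e j h.1) t := by
      rw [sum_comm, ← sum_add_distrib]
      refine sum_congr rfl fun t _ => ?_
      conv_lhs => rw [h1 t]
      rw [mul_add, mul_sum]
      rfl
    rw [h2]
    refine add_le_add ?_ (sum_le_sum fun j hj => ?_)
    · calc ∑ t, ((ε t : ℤ) : ℝ) * (h.1 (x t) - e K h.1 t) ≤ ∑ _t : Fin T, (2 : ℝ) / 2 ^ K := by
            refine sum_le_sum fun t _ => (le_abs_self _).trans ?_
            rw [abs_mul, abs_sign, one_mul]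
            exact he K le_rfl h.1 h.2 t
        _ = _ := by rw [sum_const, card_univ, Fintype.card_fin, nsmul_eq_mul]; ring
    · exact le_ciSup (f := fun v : D j => ∑ t, ((ε t : ℤ) : ℝ) * v.1 t)
        (Set.finite_range _).bddAbove ⟨_, hD j (mem_range.1 hj) h.1 h.2⟩
  refine (expect_le_expect fun ε _ => hpt ε).trans ?_
  rw [expect_add_distrib, Fintype.expect_const, expect_sum_comm]
  gcongr with j hj
  exact hmass j (mem_range.1 hj)

/-- Covers at the scale `2 ^ (-j)` of classes of polynomial fat-shattering dimension. -/
lemma exists_cover_card_le_exp {T : ℕ} (hT : 1 ≤ T) (x : Fin T → X) {j : ℕ} {D : ℝ} (hD1 : 1 ≤ D)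
    (hj : 2 ^ j ≤ 2 * T)
    (hD : ∀ S : Finset X, FatShatters H (1 / 2 ^ (j + 1)) S → (#S : ℝ) ≤ D) :
    ∃ F : Finset (Fin T → ℝ), (#F : ℝ) ≤ Real.exp (80 * D * Real.log (T + 1) ^ 2) ∧
      ∀ h ∈ H, ∃ f ∈ F, ∀ t, |(h (x t) : ℝ) - f t| ≤ 2 / 2 ^ j := by
  have hT' : (1 : ℝ) ≤ T := by exact_mod_cast hT
  set Λ := Real.log (T + 1) with hΛ
  have hl2 : (0.69 : ℝ) < Real.log 2 := by linarith [Real.log_two_gt_d9]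
  have hΛ2 : Real.log 2 ≤ Λ := Real.log_le_log (by norm_num) (by linarith)
  have hTΛ : Real.log T ≤ Λ := Real.log_le_log (by linarith) (by linarith)
  -- Chosen so that 2^u exceeds T(2^j + 1) + 1, which is at most 4T² because 2^j ≤ 2T.
  set u := Nat.log 2 (4 * T ^ 2) + 1 with hu
  have hu1 : 4 * T ^ 2 < 2 ^ u := Nat.lt_pow_succ_log_self (by norm_num) _
  have hu2 : (u : ℝ) ≤ 8 * Λ := by
    have h1 : 2 ^ u ≤ 8 * T ^ 2 := by
      have := Nat.pow_log_le_self 2 (x := 4 * T ^ 2) (by positivity)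
      rw [hu, pow_succ]; omega
    have h2 : ((2 : ℝ)) ^ u ≤ 2 ^ 3 * T ^ 2 := by
      have : ((2 ^ u : ℕ) : ℝ) ≤ ((8 * T ^ 2 : ℕ) : ℝ) := by exact_mod_cast h1
      push_cast at this; linarith
    have h3 := Real.log_le_log (by positivity) h2
    rw [Real.log_pow, Real.log_mul (by positivity) (by positivity), Real.log_pow,
      Real.log_pow] at h3
    push_cast at h3
    have h4 : (u : ℝ) * 0.69 ≤ u * Real.log 2 := by gcongr
    linarith
  set d := ⌊D⌋₊ with hd
  have hdD : (d : ℝ) ≤ D := Nat.floor_le (by linarith)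
  -- The extra 1 makes the comparison strict, also when d = 0.
  set k := d * u + 1 with hk
  have hb : 2 ^ j + 1 ≤ 3 * T := by omega
  have hb1 : T * (2 ^ j + 1) + 1 ≤ 4 * T ^ 2 := by nlinarith
  obtain ⟨F, hF, hcov⟩ := exists_cover (H := H) hT x (j := j) (d := d) (k := k)
    (fun S hS => Nat.le_floor (hD S hS)) (by
      calc (T * (2 ^ j + 1) + 1) ^ d ≤ (2 ^ u) ^ d := by gcongr; omega
        _ = 2 ^ (d * u) := by rw [← pow_mul, mul_comm]
        _ < 2 ^ k := Nat.pow_lt_pow_right (by norm_num) (by omega))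
  refine ⟨F, ?_, hcov⟩
  have h1 : (#F : ℝ) ≤ (2 ^ 5 * (T : ℝ) ^ 3) ^ k := by
    have h2 : #F ≤ (2 ^ 5 * T ^ 3) ^ k := by
      refine hF.trans (Nat.pow_le_pow_left ?_ k)
      calc 2 * T * (2 ^ j + 1) ^ 2 ≤ 2 * T * (3 * T) ^ 2 := by gcongr
        _ = 18 * T ^ 3 := by ring
        _ ≤ _ := by gcongr; norm_num
    exact_mod_cast h2
  refine h1.trans ?_
  rw [← Real.exp_log (show (0 : ℝ) < (2 ^ 5 * (T : ℝ) ^ 3) ^ k by positivity)]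
  refine Real.exp_le_exp.2 ?_
  rw [Real.log_pow, Real.log_mul (by positivity) (by positivity), Real.log_pow, Real.log_pow]
  have h3 : (k : ℝ) ≤ 10 * D * Λ := by
    rw [hk]; push_cast
    have : (d : ℝ) * u ≤ D * (8 * Λ) := by gcongr
    nlinarith
  calc (k : ℝ) * (((5 : ℕ) : ℝ) * Real.log 2 + ((3 : ℕ) : ℝ) * Real.log T)
      ≤ (10 * D * Λ) * (8 * Λ) := by
        have h0 : 0 ≤ Real.log T := Real.log_nonneg hT'
        push_cast
        refine mul_le_mul h3 (by linarith) (by linarith) ?_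
        have : 0 ≤ Λ := by linarith
        positivity
    _ = _ := by ring

/-- The Rademacher complexity of classes of polynomial fat-shattering dimension. -/
lemma rademacherAt_le_of_fatShatters (hH : H.Nonempty) {P c : ℝ} (hP : 2 ≤ P) (hc : 1 ≤ c)
    (hfat : ∀ j : ℕ, ∀ S : Finset X, FatShatters H (1 / 2 ^ (j + 1)) S →
      (#S : ℝ) ≤ c * (2 ^ (j + 1)) ^ P)
    {T : ℕ} (hT : 1 ≤ T) (x : Fin T → X) :
    rademacherAt H x
      ≤ (8 + 162 * (c * 4 ^ P)) * Real.log (T + 1) ^ 2 * (T : ℝ) ^ (1 - 1 / P) := by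
  have hT' : (1 : ℝ) ≤ T := by exact_mod_cast hT
  have hP0 : 0 < P := by linarith
  set Λ := Real.log (T + 1) with hΛ
  have hl2 : (0.69 : ℝ) < Real.log 2 := by linarith [Real.log_two_gt_d9]
  have hΛ2 : Real.log 2 ≤ Λ := Real.log_le_log (by norm_num) (by linarith)
  have hTΛ : Real.log T ≤ Λ := Real.log_le_log (by linarith) (by linarith)
  -- Chaining stops at scale about 1/Z, where the discretization error T/Z already has the target
  -- order T^(1 − 1/P).
  set Z : ℝ := (T : ℝ) ^ (1 / P) with hZ
  have hZ1 : 1 ≤ Z := Real.one_le_rpow hT' (by positivity)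
  have hZT : Z ≤ T := by
    conv_rhs => rw [← Real.rpow_one (T : ℝ)]
    refine Real.rpow_le_rpow_of_exponent_le hT' ?_
    rw [div_le_one hP0]; linarith
  have hZP : Z ^ P = T := by
    rw [hZ, ← Real.rpow_mul (by linarith), one_div_mul_cancel hP0.ne', Real.rpow_one]
  have hTZ : (T : ℝ) ^ (1 - 1 / P) = T / Z := by
    rw [Real.rpow_sub (by linarith), Real.rpow_one]
  obtain ⟨n, hn1, hn2⟩ := exists_nat_pow_near hZ1 (one_lt_two : (1 : ℝ) < 2)
  set K := n + 1 with hK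
  have hzj : ∀ j < K, (2 : ℝ) ^ j ≤ Z := fun j hj =>
    (pow_le_pow_right₀ (by norm_num) (by omega)).trans hn1
  have hKT : 2 ^ K ≤ 2 * T := by
    have : (2 : ℝ) ^ K ≤ 2 * T := by rw [hK, pow_succ]; linarith
    exact_mod_cast this
  set D : ℕ → ℝ := fun j => c * (2 ^ (j + 1)) ^ P with hDdef
  have hD1 : ∀ j, 1 ≤ D j := fun j =>
    one_le_mul_of_one_le_of_one_le hc (Real.one_le_rpow (one_le_pow₀ (by norm_num)) hP0.le)
  have hDmono : ∀ j, D j ≤ D (j + 1) := fun j => by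
    refine mul_le_mul_of_nonneg_left (Real.rpow_le_rpow (by positivity) ?_ hP0.le) (by linarith)
    exact pow_le_pow_right₀ (by norm_num) (by omega)
  have hcov : ∀ j : ℕ, ∃ F : Finset (Fin T → ℝ), (j = 0 → F = {0}) ∧ (j ≤ K →
      (#F : ℝ) ≤ Real.exp (80 * D j * Λ ^ 2) ∧
      ∀ h ∈ H, ∃ f ∈ F, ∀ t, |(h (x t) : ℝ) - f t| ≤ 2 / 2 ^ j) := by
    intro j
    rcases Nat.eq_zero_or_pos j with rfl | hj
    · refine ⟨{0}, fun _ => rfl, fun _ => ⟨?_, fun h _ => ⟨0, mem_singleton_self _, fun t => ?_⟩⟩⟩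
      · rw [card_singleton, Nat.cast_one]
        refine Real.one_le_exp ?_
        have := hD1 0
        positivity
      · have h1 := (h (x t)).2.1
        have h2 := (h (x t)).2.2
        rw [Pi.zero_apply, sub_zero, abs_of_nonneg h1]
        norm_num
        linarith
    · by_cases hjK : j ≤ K
      · obtain ⟨F, h1, h2⟩ := exists_cover_card_le_exp hT x (hD1 j)
          ((Nat.pow_le_pow_right (by norm_num) hjK).trans hKT) (hfat j)
        exact ⟨F, fun h => absurd h hj.ne', fun _ => ⟨h1, h2⟩⟩
      · exact ⟨{0}, fun _ => rfl, fun h => absurd h hjK⟩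
  choose F hF0 hF using hcov
  have hbase : 1 ≤ 160 * Λ ^ 2 := by nlinarith
  have key := rademacherAt_le_of_covers hH x K F (hF0 0 rfl) (fun j hj => (hF j hj).2)
    (fun j => Real.exp (160 * D (j + 1) * Λ ^ 2)) ?_ ?_
  · refine key.trans ?_
    have hterm : ∀ j ∈ range K,
        3 / 2 ^ j * √(2 * T * Real.log (Real.exp (160 * D (j + 1) * Λ ^ 2)))
        ≤ 54 * (c * 4 ^ P) * Λ * (T / Z) := by
      intro j hj
      rw [Real.log_exp]
      set z : ℝ := 2 ^ j with hz
      have hz0 : 0 < z := by positivity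
      have hzZ : z ≤ Z := hzj j (mem_range.1 hj)
      have hDj : D (j + 1) = c * 4 ^ P * z ^ P := by
        simp only [hDdef]
        rw [mul_assoc, ← Real.mul_rpow (by norm_num) hz0.le, hz]
        congr 2
        rw [pow_succ, pow_succ]; ring
      have hcP : 1 ≤ c * 4 ^ P :=
        one_le_mul_of_one_le_of_one_le hc (Real.one_le_rpow (by norm_num) hP0.le)
      -- Since P ≥ 2, the quantity z^(P−2) is nondecreasing, so every link is at most of order T/Z
      -- up to a logarithm. The number of links is O(log T), which gives the second logarithm.
      have hzP : z ^ P / z ^ 2 ≤ T / Z ^ 2 := by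
        rw [← hZP, ← Real.rpow_natCast z, ← Real.rpow_natCast Z, ← Real.rpow_sub hz0,
          ← Real.rpow_sub (by linarith)]
        exact Real.rpow_le_rpow hz0.le hzZ (by push_cast; linarith)
      have hΛ0 : 0 ≤ Λ := by linarith
      rw [show (3 : ℝ) / z * √(2 * T * (160 * D (j + 1) * Λ ^ 2))
          = √((3 / z) ^ 2 * (2 * T * (160 * D (j + 1) * Λ ^ 2))) by
        rw [Real.sqrt_mul (sq_nonneg (3 / z)), Real.sqrt_sq (by positivity)]]
      refine Real.sqrt_le_iff.2 ⟨by positivity, ?_⟩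
      have e1 : (3 / z) ^ 2 * (2 * T * (160 * D (j + 1) * Λ ^ 2))
          = 2880 * T * Λ ^ 2 * (c * 4 ^ P) * (z ^ P / z ^ 2) := by
        rw [hDj]; field_simp; ring
      have e2 : (54 * (c * 4 ^ P) * Λ * (T / Z)) ^ 2
          = 2916 * T * Λ ^ 2 * (c * 4 ^ P) ^ 2 * (T / Z ^ 2) := by
        field_simp; ring
      rw [e1, e2]
      gcongr
      · norm_num
      · nlinarith
    have hKΛ : (K : ℝ) ≤ 3 * Λ := by
      have h2 : ((2 : ℝ)) ^ K ≤ 2 * T := by exact_mod_cast hKT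
      have h3 := Real.log_le_log (by positivity) h2
      rw [Real.log_pow, Real.log_mul (by positivity) (by positivity)] at h3
      have h4 : (K : ℝ) * 0.69 ≤ K * Real.log 2 := by gcongr
      linarith
    have hsum := sum_le_sum hterm
    rw [sum_const, card_range, nsmul_eq_mul] at hsum
    have hZ0 : 0 < Z := by linarith
    have hTZ0 : 0 ≤ T / Z := by positivity
    have hfirst : 2 * (T : ℝ) / 2 ^ K ≤ 8 * Λ ^ 2 * (T / Z) := by
      calc 2 * (T : ℝ) / 2 ^ K ≤ 2 * T / Z := by gcongr
        _ = 2 * (T / Z) := by ring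
        _ ≤ _ := by
          refine mul_le_mul_of_nonneg_right ?_ hTZ0
          nlinarith
    have hc4 : 0 ≤ c * (4 : ℝ) ^ P := by positivity
    have hΛ0 : 0 ≤ Λ := by linarith
    have hsecond : (K : ℝ) * (54 * (c * 4 ^ P) * Λ * (T / Z))
        ≤ 3 * Λ * (54 * (c * 4 ^ P) * Λ * (T / Z)) := by gcongr
    rw [hTZ]
    calc _ ≤ 8 * Λ ^ 2 * (T / Z) + 3 * Λ * (54 * (c * 4 ^ P) * Λ * (T / Z)) :=
          add_le_add hfirst (hsum.trans hsecond)
      _ = _ := by ring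
  · intro j _
    have := hD1 (j + 1)
    have h1 : 1 ≤ 160 * D (j + 1) * Λ ^ 2 := by nlinarith
    linarith [Real.add_one_le_exp (160 * D (j + 1) * Λ ^ 2)]
  · intro j hj
    push_cast
    calc (#(F j) : ℝ) * #(F (j + 1))
        ≤ Real.exp (80 * D (j + 1) * Λ ^ 2) * Real.exp (80 * D (j + 1) * Λ ^ 2) := by
          refine mul_le_mul ((hF j hj.le).1.trans (Real.exp_le_exp.2 ?_)) (hF (j + 1) hj).1
            (by positivity) (by positivity)
          have := hDmono j
          gcongr
      _ = _ := by rw [← Real.exp_add]; ring_nf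

end Fat

/-! ### Efficiency of the program and the regret bounds -/

section Main

variable {X : Type u} {H : Set (X → I)} {ℓ : ℝ → ℝ → ℝ} {L : ℝ}

lemma runsInTime_program (hL : 0 ≤ L) {a A : ℝ} (ha : 0 ≤ a) (ha1 : a ≤ 1) (hA : 28 ≤ A) :
    (program (2 ^ a) L).RunsInTime ℓ H A 1 := by
  intro hist x c hc
  have hs := schedSpec ha ha1 hist.length
  obtain ⟨K, hK⟩ : ∃ K, (sched (2 ^ a) hist.length).pool = K + 1 :=
    ⟨_, (Nat.sub_add_cancel hs.pool_pos).symm⟩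
  obtain ⟨F, hF, hF'⟩ := run_program (ℓ := ℓ) (H := H) hL hist x hK rfl hs.pos_le
  rw [hF, PMF.support_map] at hc
  obtain ⟨w, -, rfl⟩ := hc
  have h1 := (hF' w).2.2
  have h2 := hs.block_le_pool
  have h3 := hs.pool_le
  -- The number of draws is less than the block length, which is at most the pool size and so at
  -- most max s 1. Hence 23 + 22 s steps suffice.
  have h4 : (F w).steps ≤ 28 * (hist.length + 1) := by omega
  calc ((F w).steps : ℝ) ≤ ((28 * (hist.length + 1) : ℕ) : ℝ) := by exact_mod_cast h4
    _ = 28 * ((hist.length + 1 : ℕ) : ℝ) := by push_cast; ring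
    _ ≤ A * ((hist.length + 1 : ℕ) : ℝ) ^ 1 := by rw [pow_one]; gcongr

lemma callsAtMost_program (hL : 0 ≤ L) {a B : ℝ} (ha : 0 ≤ a) (ha1 : a ≤ 1) (hB : 2 ≤ B) (T : ℕ) :
    (program (2 ^ a) L).CallsAtMost ℓ H T B := by
  intro hist x _ c hc
  have hs := schedSpec ha ha1 hist.length
  obtain ⟨K, hK⟩ : ∃ K, (sched (2 ^ a) hist.length).pool = K + 1 :=
    ⟨_, (Nat.sub_add_cancel hs.pool_pos).symm⟩
  obtain ⟨F, hF, hF'⟩ := run_program (ℓ := ℓ) (H := H) hL hist x hK rfl hs.pos_le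
  rw [hF, PMF.support_map] at hc
  obtain ⟨w, -, rfl⟩ := hc
  rw [(hF' w).2.1]
  exact_mod_cast hB

lemma log_ge_of_two_le {T : ℕ} (hT : 2 ≤ T) : 0.69 ≤ Real.log T := by
  have h : Real.log 2 ≤ Real.log T := Real.log_le_log (by norm_num) (by exact_mod_cast hT)
  linarith [Real.log_two_gt_d9]

lemma log_add_one_le {T : ℕ} (hT : 2 ≤ T) : Real.log (T + 1) ≤ 2 * Real.log T := by
  have h : (2 : ℝ) ≤ T := by exact_mod_cast hT
  calc Real.log (T + 1) ≤ Real.log ((T : ℝ) ^ 2) := Real.log_le_log (by linarith) (by nlinarith)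
    _ = _ := by rw [Real.log_pow]; norm_num

lemma log_le_log_max_mul {T : ℕ} (hT : 2 ≤ T) (L : ℝ) :
    Real.log T ≤ Real.log (max L 1 * T) := by
  have h : (2 : ℝ) ≤ T := by exact_mod_cast hT
  exact Real.log_le_log (by linarith) (le_mul_of_one_le_left (by linarith) (le_max_right _ _))

lemma two_le_mul_max_mul_sqrt_mul_log {T : ℕ} (hT : 2 ≤ T) {A : ℝ} (hA : 28 ≤ A) (L : ℝ) :
    2 ≤ A * max L 1 * √(T : ℝ) * Real.log T := by
  have h1 : (1 : ℝ) ≤ √(T : ℝ) := Real.one_le_sqrt.2 (by exact_mod_cast (by omega : 1 ≤ T))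
  have h2 := log_ge_of_two_le hT
  calc (2 : ℝ) ≤ 28 * 1 * 1 * 0.69 := by norm_num
    _ ≤ _ := by gcongr; exact le_max_right _ _

lemma rademacher_le {T : ℕ} {B : ℝ} (hB : 0 ≤ B) (h : ∀ x : Fin T → X, rademacherAt H x ≤ B) :
    rademacher H T ≤ B := by
  rw [rademacher_eq]
  exact Real.iSup_le h hB

lemma efficient_program (hL : 0 ≤ L) {q A : ℝ} (hq1 : q ≤ 1) (hA : 28 ≤ A) :
    (program (2 ^ (1 / (3 - 2 * q))) L).RunsInTime ℓ H A 1 ∧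
      ∀ T : ℕ, 2 ≤ T → (program (2 ^ (1 / (3 - 2 * q))) L).CallsAtMost ℓ H T
        (A * max L 1 * √(T : ℝ) * Real.log T) := by
  have hd : 0 < 3 - 2 * q := by linarith
  have ha : 0 ≤ 1 / (3 - 2 * q) := by positivity
  have ha1 : 1 / (3 - 2 * q) ≤ 1 := by rw [div_le_one hd]; linarith
  exact ⟨runsInTime_program hL ha ha1 hA, fun T hT =>
    callsAtMost_program hL ha ha1 (two_le_mul_max_mul_sqrt_mul_log hT hA L) T⟩

lemma card_le_of_fatDim_le {p c : ℝ}
    (hfat : ∀ α : ℝ, 0 < α → α ≤ 1 → (fatDim H α : ℝ≥0∞) ≤ ENNReal.ofReal (c * α ^ (-p)))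
    (j : ℕ) (S : Finset X) (hS : FatShatters H (1 / 2 ^ (j + 1)) S) :
    (#S : ℝ) ≤ max c 1 * (2 ^ (j + 1)) ^ max p 2 := by
  have h2 : (1 : ℝ) ≤ 2 ^ (j + 1) := one_le_pow₀ (by norm_num)
  have h1 : (#S : ℝ≥0∞) ≤ ENNReal.ofReal (c * (1 / 2 ^ (j + 1)) ^ (-p)) := by
    refine le_trans ?_ (hfat (1 / 2 ^ (j + 1)) (by positivity)
      ((div_le_one (by positivity)).2 h2))
    rw [← ENat.toENNReal_coe]
    exact ENat.toENNReal_le.2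
      (le_iSup₂ (f := fun (S : Finset X) (_ : FatShatters H (1 / 2 ^ (j + 1)) S) =>
        (S.card : ℕ∞)) S hS)
  rw [← ENNReal.ofReal_natCast, ENNReal.ofReal_le_ofReal_iff', one_div,
    Real.inv_rpow (by positivity), Real.rpow_neg (by positivity), inv_inv] at h1
  -- `ENNReal.ofReal` truncates at zero: either the real inequality holds, or the cardinality is at
  -- most zero.
  rcases h1 with h1 | h1
  · refine h1.trans ?_
    gcongr
    · exact le_max_left _ _
    · exact le_max_left _ _
  · exact h1.trans (by positivity)

variable [MeasurableSpace X]

lemma IsConvexLipschitzLoss.hybridRegret_le_of_rademacher (hl : IsConvexLipschitzLoss L ℓ)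
    (hL : 0 ≤ L) (hH : H.Nonempty) (hM : MeasurableERM ℓ H) {q : ℝ} (hq : 1 / 2 ≤ q) (hq1 : q ≤ 1)
    {c : ℝ} (hrad : ∀ T : ℕ, 1 ≤ T → rademacher H T ≤ c * (T : ℝ) ^ q) {T : ℕ} (hT : 2 ≤ T) :
    hybridRegret ℓ H ((program (2 ^ (1 / (3 - 2 * q))) L).rule ℓ H) T ≤
      (((8 * |c| + 36) * L * √(Real.log (max L 1 * T)) *
        (T : ℝ) ^ ((2 - q) / (3 - 2 * q)) : ℝ) : EReal) := by
  refine (hl.hybridRegret_le hL hH hM hq hq1 (abs_nonneg c) hT fun M hM1 _ =>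
    (hrad M hM1).trans (by gcongr; exact le_abs_self c)).trans (EReal.coe_le_coe_iff.2 ?_)
  refine mul_le_mul_of_nonneg_right ?_ (by positivity)
  have h1 := log_ge_of_two_le hT
  -- Turns 6|c| into 8|c| √(log T).
  have h2 : (3 / 4 : ℝ) ≤ √(Real.log T) := Real.le_sqrt_of_sq_le (by norm_num at h1 ⊢; linarith)
  have h3 := Real.sqrt_le_sqrt (log_le_log_max_mul hT L)
  calc L * (6 * |c| + 36 * √(Real.log T)) ≤ L * ((8 * |c| + 36) * √(Real.log T)) := by
        gcongr
        nlinarith [abs_nonneg c]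
    _ ≤ L * ((8 * |c| + 36) * √(Real.log (max L 1 * T))) := by gcongr
    _ = _ := by ring

lemma IsConvexLipschitzLoss.hybridRegret_le_of_vcDim (hl : IsConvexLipschitzLoss L ℓ)
    (hL : 0 ≤ L) (hH : H.Nonempty) (hM : MeasurableERM ℓ H) (hB : IsBinary H) {d : ℕ} (hd : 1 ≤ d)
    (hvc : vcDim H ≤ (d : ℕ∞)) {T : ℕ} (hT : 2 ≤ T) :
    hybridRegret ℓ H ((program (2 ^ (1 / (3 - 2 * (1 / 2 : ℝ)))) L).rule ℓ H) T ≤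
      ((48 * L * √(d * Real.log (max L 1 * T)) * (T : ℝ) ^ (3 / 4 : ℝ) : ℝ) : EReal) := by
  have h1 := log_ge_of_two_le hT
  have hd' : (1 : ℝ) ≤ d := by exact_mod_cast hd
  -- W may involve d and T because the program does not use it. Blocks within the horizon have M ≤
  -- T, so log(M + 1) ≤ 2 log T.
  set W := 2 * √(d * Real.log T) with hW
  have hrad : ∀ M : ℕ, 1 ≤ M → M ≤ T → rademacher H M ≤ W * (M : ℝ) ^ (1 / 2 : ℝ) := by
    intro M hM1 hMT
    have hM' : (M : ℝ) ≤ T := by exact_mod_cast hMT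
    refine (rademacher_le (by positivity) fun x =>
      rademacherAt_le_of_vcDim hH hB hd hvc hM1 x).trans ?_
    rw [← Real.sqrt_eq_rpow]
    have h2 : Real.log (M + 1) ≤ 2 * Real.log T :=
      (Real.log_le_log (by positivity) (by linarith)).trans (log_add_one_le hT)
    calc √(2 * M * (d * Real.log (M + 1))) ≤ √(2 ^ 2 * (d * Real.log T) * M) := by
          refine Real.sqrt_le_sqrt ?_
          calc 2 * (M : ℝ) * (d * Real.log (M + 1)) ≤ 2 * (M : ℝ) * (d * (2 * Real.log T)) := by
                gcongr
            _ = _ := by ring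
      _ = W * √M := by
          rw [Real.sqrt_mul (by positivity), Real.sqrt_mul (by positivity),
            Real.sqrt_sq (by norm_num)]
  refine (hl.hybridRegret_le hL hH hM le_rfl (by norm_num) (by positivity) hT hrad).trans
    (EReal.coe_le_coe_iff.2 ?_)
  rw [show (2 - 1 / 2 : ℝ) / (3 - 2 * (1 / 2)) = 3 / 4 by norm_num]
  refine mul_le_mul_of_nonneg_right ?_ (by positivity)
  have h2 : √(Real.log T) ≤ √(d * Real.log T) :=
    Real.sqrt_le_sqrt (le_mul_of_one_le_left (by linarith) hd')
  have h3 : √(d * Real.log T) ≤ √(d * Real.log (max L 1 * T)) :=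
    Real.sqrt_le_sqrt (mul_le_mul_of_nonneg_left (log_le_log_max_mul hT L) (by linarith))
  calc L * (6 * W + 36 * √(Real.log T)) ≤ L * (48 * √(d * Real.log (max L 1 * T))) := by
        gcongr
        linarith
    _ = _ := by ring

lemma IsConvexLipschitzLoss.hybridRegret_le_of_fatDim (hl : IsConvexLipschitzLoss L ℓ)
    (hL : 0 ≤ L) (hH : H.Nonempty) (hM : MeasurableERM ℓ H) {p c : ℝ} (hp : 0 < p)
    (hfat : ∀ α : ℝ, 0 < α → α ≤ 1 → (fatDim H α : ℝ≥0∞) ≤ ENNReal.ofReal (c * α ^ (-p)))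
    {T : ℕ} (hT : 2 ≤ T) :
    hybridRegret ℓ H ((program (2 ^ (1 / (3 - 2 * (1 - 1 / max p 2)))) L).rule ℓ H) T ≤
      (((24 * (8 + 162 * (max c 1 * 4 ^ max p 2)) + 72) * L * Real.log (max L 1 * T) ^ 2 *
        (T : ℝ) ^ (max (3 / 4) ((p + 1) / (p + 2))) : ℝ) : EReal) := by
  have h1 := log_ge_of_two_le hT
  -- Below p = 2 chaining gives nothing better than √M up to logarithms, so the exponent is raised
  -- to 2. With q = 1 − 1/P the regret exponent is (P + 1)/(P + 2), which equals 3/4 at P = 2.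
  set P := max p 2 with hPdef
  have hP : 2 ≤ P := le_max_right _ _
  have hP0 : 0 < P := by linarith
  set C := 8 + 162 * (max c 1 * 4 ^ P) with hC
  have hC0 : 0 ≤ C := by positivity
  have hPinv : 1 / P ≤ 1 / 2 := one_div_le_one_div_of_le (by norm_num) hP
  have hPinv0 : 0 < 1 / P := by positivity
  have hrad : ∀ M : ℕ, 1 ≤ M → M ≤ T →
      rademacher H M ≤ C * (2 * Real.log T) ^ 2 * (M : ℝ) ^ (1 - 1 / P) := by
    intro M hM1 hMT
    have hM' : (M : ℝ) ≤ T := by exact_mod_cast hMT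
    have hM0 : 0 ≤ Real.log ((M : ℝ) + 1) :=
      Real.log_nonneg (by linarith [(Nat.cast_nonneg M : (0 : ℝ) ≤ M)])
    refine (rademacher_le (by positivity) fun x => rademacherAt_le_of_fatShatters hH hP
      (le_max_right c 1) (card_le_of_fatDim_le hfat) hM1 x).trans ?_
    have h2 : Real.log (M + 1) ≤ 2 * Real.log T :=
      (Real.log_le_log (by positivity) (by linarith)).trans (log_add_one_le hT)
    gcongr
  refine (hl.hybridRegret_le hL hH hM (by linarith) (by linarith) (by positivity) hT hrad).trans
    (EReal.coe_le_coe_iff.2 ?_)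
  have hexp : (2 - (1 - 1 / P)) / (3 - 2 * (1 - 1 / P)) = max (3 / 4) ((p + 1) / (p + 2)) := by
    have e1 : (2 - (1 - 1 / P)) / (3 - 2 * (1 - 1 / P)) = (P + 1) / (P + 2) := by
      rw [div_eq_div_iff (by linarith) (by linarith)]
      field_simp
      ring
    rw [e1]
    rcases le_total p 2 with h | h
    · rw [hPdef, max_eq_right h, max_eq_left]
      · norm_num
      · rw [div_le_div_iff₀ (by linarith) (by norm_num)]; linarith
    · rw [hPdef, max_eq_left h, max_eq_right]
      rw [div_le_div_iff₀ (by norm_num) (by linarith)]; linarith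
  rw [hexp]
  refine mul_le_mul_of_nonneg_right ?_ (by positivity)
  have h2 : √(Real.log T) ≤ 2 * Real.log T ^ 2 := by
    refine Real.sqrt_le_iff.2 ⟨by positivity, ?_⟩
    have h3 : (0.69 : ℝ) ^ 3 ≤ Real.log T ^ 3 := by gcongr
    have h4 : 1 ≤ 4 * Real.log T ^ 3 := by norm_num at h3 ⊢; linarith
    calc Real.log T = Real.log T * 1 := (mul_one _).symm
      _ ≤ Real.log T * (4 * Real.log T ^ 3) := by gcongr
      _ = _ := by ring
  have h3 := log_le_log_max_mul hT L
  calc L * (6 * (C * (2 * Real.log T) ^ 2) + 36 * √(Real.log T))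
      ≤ L * (6 * (C * (2 * Real.log T) ^ 2) + 36 * (2 * Real.log T ^ 2)) := by gcongr
    _ = (24 * C + 72) * L * Real.log T ^ 2 := by ring
    _ ≤ _ := by gcongr

end Main

end HybridLearning

theorem theorem3p2 :
    -- classes whose Rademacher complexity is `O(T ^ q)`
    (∀ q : ℝ, 1 / 2 ≤ q → q ≤ 1 → ∀ c : ℝ, ∃ (A : ℝ) (k : ℕ), ∀ L : ℝ, 0 ≤ L → ∃ P : Prog,
      ∀ (X : Type u) [MeasurableSpace X] (H : Set (X → I)) (ℓ : ℝ → ℝ → ℝ),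
        H.Nonempty → IsConvexLipschitzLoss L ℓ → MeasurableERM ℓ H →
        (∀ T : ℕ, 1 ≤ T → rademacher H T ≤ c * (T : ℝ) ^ q) →
        P.RunsInTime ℓ H A k ∧
        ∀ T : ℕ, 2 ≤ T →
          P.CallsAtMost ℓ H T (A * max L 1 * √(T : ℝ) * Real.log T) ∧
          hybridRegret ℓ H (P.rule ℓ H) T ≤
            ((A * L * √(Real.log (max L 1 * T)) * (T : ℝ) ^ ((2 - q) / (3 - 2 * q)) : ℝ) :
              EReal)) ∧
    -- binary-valued classes of finite VC-dimension
    (∃ (A : ℝ) (k : ℕ), ∀ L : ℝ, 0 ≤ L → ∃ P : Prog,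
      ∀ (X : Type u) [MeasurableSpace X] (H : Set (X → I)) (ℓ : ℝ → ℝ → ℝ) (d : ℕ),
        H.Nonempty → IsConvexLipschitzLoss L ℓ → MeasurableERM ℓ H →
        IsBinary H → 1 ≤ d → vcDim H ≤ (d : ℕ∞) →
        P.RunsInTime ℓ H A k ∧
        ∀ T : ℕ, 2 ≤ T →
          P.CallsAtMost ℓ H T (A * max L 1 * √(T : ℝ) * Real.log T) ∧
          hybridRegret ℓ H (P.rule ℓ H) T ≤
            ((A * L * √(d * Real.log (max L 1 * T)) * (T : ℝ) ^ (3 / 4 : ℝ) : ℝ) : EReal)) ∧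
    -- real-valued classes whose `α`-fat shattering dimension is of order `α ^ (-p)`
    (∀ p : ℝ, 0 < p → ∀ c : ℝ, ∃ (A : ℝ) (k m : ℕ), ∀ L : ℝ, 0 ≤ L → ∃ P : Prog,
      ∀ (X : Type u) [MeasurableSpace X] (H : Set (X → I)) (ℓ : ℝ → ℝ → ℝ),
        H.Nonempty → IsConvexLipschitzLoss L ℓ → MeasurableERM ℓ H →
        (∀ α : ℝ, 0 < α → α ≤ 1 →
          (fatDim H α : ℝ≥0∞) ≤ ENNReal.ofReal (c * α ^ (-p))) →
        P.RunsInTime ℓ H A k ∧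
        ∀ T : ℕ, 2 ≤ T →
          P.CallsAtMost ℓ H T (A * max L 1 * √(T : ℝ) * Real.log T) ∧
          hybridRegret ℓ H (P.rule ℓ H) T ≤
            ((A * L * Real.log (max L 1 * T) ^ m *
              (T : ℝ) ^ (max (3 / 4) ((p + 1) / (p + 2))) : ℝ) : EReal)) := by
  -- The same program serves all three parts and depends only on L and the exponent q, which is 1/2
  -- for VC classes and 1 − 1/max(p, 2) for fat-shattering classes.
  refine ⟨fun q hq hq1 c => ⟨8 * |c| + 36, 1, fun L hL => ⟨program (2 ^ (1 / (3 - 2 * q))) L, ?_⟩⟩,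
    ⟨48, 1, fun L hL => ⟨program (2 ^ (1 / (3 - 2 * (1 / 2 : ℝ)))) L, ?_⟩⟩,
    fun p hp c => ⟨24 * (8 + 162 * (max c 1 * 4 ^ max p 2)) + 72, 1, 2, fun L hL =>
      ⟨program (2 ^ (1 / (3 - 2 * (1 - 1 / max p 2)))) L, ?_⟩⟩⟩
  · intro X _ H ℓ hH hl hM hrad
    have he := efficient_program (ℓ := ℓ) (H := H) hL hq1
      (A := 8 * |c| + 36) (by linarith [abs_nonneg c])
    exact ⟨he.1, fun T hT =>
      ⟨he.2 T hT, hl.hybridRegret_le_of_rademacher hL hH hM hq hq1 hrad hT⟩⟩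
  · intro X _ H ℓ d hH hl hM hB hd hvc
    have he := efficient_program (ℓ := ℓ) (H := H) hL (q := 1 / 2) (by norm_num)
      (A := 48) (by norm_num)
    exact ⟨he.1, fun T hT => ⟨he.2 T hT, hl.hybridRegret_le_of_vcDim hL hH hM hB hd hvc hT⟩⟩
  · intro X _ H ℓ hH hl hM hfat
    have h0 : 0 < 1 / max p 2 := by positivity
    have h1 : (0 : ℝ) ≤ max c 1 * 4 ^ max p 2 := by positivity
    have he := efficient_program (ℓ := ℓ) (H := H) hL (q := 1 - 1 / max p 2) (by linarith)
      (A := 24 * (8 + 162 * (max c 1 * 4 ^ max p 2)) + 72) (by linarith)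
    exact ⟨he.1, fun T hT => ⟨he.2 T hT, hl.hybridRegret_le_of_fatDim hL hH hM hp hfat hT⟩⟩
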